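/- **Model.** The input is an unknown finite simple undirected graph $G=(V,E)$ with $n=|V|\ge 2$ vertices, whose vertices carry arbitrary distinct names, with no isolated vertices; write $m=|E|$ and let $d=2m/n$ be its average degree. The number $n$ is known to the algorithm. A randomized adaptive algorithm accesses $G$ only through oracle queries: $\mathrm{RandEdge}()$ returns a uniformly random edge; $\mathrm{RandNbr}(x)$ returns a uniformly random neighbor of $x$; $\mathrm{Degree}(x)$ returns the degree of $x$; $\mathrm{Pair}(x,y)$ tells whether $xy\in E$; $\mathrm{Additive}(S)$ returns the number of edges with both endpoints in $S$; $\mathrm{FullNbr}(x)$ returns the set of all neighbors of $x$. There are no random vertex queries: at the start no vertex is known, and queries may only name vertices that appeared in earlier answers. $\mathrm{Additive}(S)$ costs $|S|$ and every other query costs $1$; the cost of a run is the sum of the costs of its queries. All random answers and the internal randomness are independent. **Theorem.** (a) There are absolute constants $C>0$ and $k\in\mathbb N$ and an algorithm which is given $n$ and $\varepsilon\in(0,1)$, uses only $\mathrm{RandEdge}$, $\mathrm{RandNbr}$, $\mathrm{Degree}$ and $\mathrm{Additive}$ queries, and on every such graph $G$, with probability greater than $0.99$, outputs a number in $[(1-\varepsilon)d,(1+\varepsilon)d]$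 at cost at most $$C\,\varepsilon^{-2}(\log n)^k\,\min\bigl(d,\sqrt{n/d}\bigr).$$ In particular, for the same algorithm this also holds with the cost bound $C\,\varepsilon^{-2}(\log n)^k\,n^{1/3}$. (b) For every $c\ge 1$ there are $c_0>0$ and $N$ such that the following holds for all $n\ge N$ and every vertex set $V$ with $|V|=n$. If an algorithm, which may use all six query types, and a number $B$ are such that on every graph on $V$ without isolated vertices, with probability at least $2/3$, the algorithm outputs a number in $[d/c,cd]$ at cost at most $B$, then $B\ge c_0\,n^{1/3}$. Moreover, for every $c\ge 1$ there are $c_0,c_1>0$ and $N$ such that the following holds for all $n\ge N$, every vertex set $V$ with $|V|=n$ and every real $D$ with $\sqrt n\le D\le n$. If an algorithm, which uses only $\mathrm{RandEdge}$, $\mathrm{RandNbr}$, $\mathrm{Degree}$ and $\mathrm{Pair}$ queries, and a number $B$ are such that on every graph on $V$ without isolated vertices and with average degree $d\in[c_1D,D]$, with probability at least $2/3$, the algorithm outputs a number in $[d/c,cd]$ at cost at most $B$, then $B\ge c_0\min(\sqrt n,\,n/D)$. (For $D=\sqrt n$ this is a lower bound $c_0\sqrt n$.) -/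

import Mathlib

/-- A finite simple undirected graph whose vertices are named by natural numbers.  The vertex set
`verts` is part of the (unknown) input; only vertices may be endpoints of edges. -/
structure NetGraph where
  verts : Finset ℕ
  graph : SimpleGraph ℕ
  mem_of_adj : ∀ u v : ℕ, graph.Adj u v → u ∈ verts

namespace NetGraph

open Classical in
/-- The set of edges with both endpoints in `S`. -/
noncomputable def edgesWithin (G : NetGraph) (S : Finset ℕ) : Finset (Sym2 ℕ) :=
  S.sym2.filter (fun e => e ∈ G.graph.edgeSet)

/-- The edge set of the graph. -/
noncomputable def edges (G : NetGraph) : Finset (Sym2 ℕ) :=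
  G.edgesWithin G.verts

open Classical in
/-- The set of neighbours of `x`. -/
noncomputable def nbrs (G : NetGraph) (x : ℕ) : Finset ℕ :=
  G.verts.filter (fun y => G.graph.Adj x y)

/-- The average degree `2m / n`. -/
noncomputable def avgDegree (G : NetGraph) : ℝ :=
  2 * (G.edges.card : ℝ) / (G.verts.card : ℝ)

/-- Every vertex has degree at least one. -/
def NoIsolated (G : NetGraph) : Prop :=
  ∀ x ∈ G.verts, ∃ y, G.graph.Adj x y

end NetGraph

/-- The queries.  There is deliberately no random vertex query. -/
inductive Query where
  | randEdge : Query
  | randNbr (x : ℕ) : Query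
  | degree (x : ℕ) : Query
  | pair (x y : ℕ) : Query
  | additive (S : Finset ℕ) : Query
  | fullNbr (x : ℕ) : Query

namespace Query

/-- The type of answers to a query. -/
def Answer : Query → Type
  | randEdge => Sym2 ℕ
  | randNbr _ => ℕ
  | degree _ => ℕ
  | pair _ _ => Bool
  | additive _ => ℕ
  | fullNbr _ => Finset ℕ

/-- An additive query on `S` costs `|S|`, every other query has unit cost. -/
def cost : Query → ℕ
  | additive S => S.card
  | _ => 1

end Query

open Classical in
/-- The (random) answer of the oracle for `G` to a query, when `known` is the set of vertices that
earlier answers have revealed.  An algorithm has no access to vertices other than through the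
oracle, so a query that names a vertex outside `known` gets a fixed answer that does not depend on
the graph.  The two remaining fallback values (no edges, no neighbours) never occur for a nonempty
graph without isolated vertices. -/
noncomputable def respond (G : NetGraph) (known : Finset ℕ) : (q : Query) → PMF q.Answer
  | .randEdge =>
      if h : G.edges.Nonempty then PMF.uniformOfFinset G.edges h else PMF.pure s(0, 0)
  | .randNbr x =>
      if h : x ∈ known ∧ (G.nbrs x).Nonempty then PMF.uniformOfFinset (G.nbrs x) h.2
      else PMF.pure x
  | .degree x => PMF.pure (if x ∈ known then (G.nbrs x).card else (0 : ℕ))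
  | .pair x y => PMF.pure (decide (x ∈ known ∧ y ∈ known ∧ G.graph.Adj x y))
  | .additive S => PMF.pure (if S ⊆ known then (G.edgesWithin S).card else (0 : ℕ))
  | .fullNbr x => PMF.pure (if x ∈ known then G.nbrs x else (∅ : Finset ℕ))

/-- The set of revealed vertices after the answer to a query. -/
def learn (known : Finset ℕ) : (q : Query) → q.Answer → Finset ℕ
  | .randEdge, e => known ∪ Sym2.toFinset e
  | .randNbr x, y => if x ∈ known then known ∪ {y} else known
  | .fullNbr x, N => if x ∈ known then known ∪ N else known
  | .degree _, _ => known
  | .pair _ _, _ => known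
  | .additive _, _ => known

/-- Randomized adaptive query algorithms that use only queries from `M`, as decision trees: an
algorithm stops with a real output, or draws internal randomness, or asks a query and continues
depending on the answer.  Every branch is finite; an algorithm that may run forever is turned into
one of these, with the same behaviour within a given budget, by stopping it when the budget is
exhausted. -/
inductive Algorithm (M : Set Query) : Type where
  | output (r : ℝ) : Algorithm M
  | random (μ : PMF ℕ) (next : ℕ → Algorithm M) : Algorithm M
  | query (q : Query) (allowed : q ∈ M) (next : q.Answer → Algorithm M) : Algorithm M

/-- The joint law of the output and the total query cost of an algorithm on the graph `G`, started
when the vertices in `known` have been revealed. -/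
noncomputable def Algorithm.runFrom {M : Set Query} (G : NetGraph) :
    Algorithm M → Finset ℕ → PMF (ℝ × ℕ)
  | .output r, _ => PMF.pure (r, 0)
  | .random μ next, known => μ.bind fun i => (next i).runFrom G known
  | .query q _ next, known =>
      (respond G known q).bind fun a =>
        ((next a).runFrom G (learn known q a)).map fun p => (p.1, p.2 + q.cost)

/-- The joint law of the output and the total query cost; at the start no vertex is revealed. -/
noncomputable def Algorithm.run {M : Set Query} (A : Algorithm M) (G : NetGraph) : PMF (ℝ × ℕ) :=
  A.runFrom G ∅

/-- The probability that, on `G`, the output satisfies `good` and the total cost is at most `B`. -/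
noncomputable def Algorithm.successProb {M : Set Query} (A : Algorithm M) (G : NetGraph)
    (good : ℝ → Prop) (B : ℝ) : ENNReal :=
  (A.run G).toOuterMeasure {p | good p.1 ∧ (p.2 : ℝ) ≤ B}

/-- Random edges, random neighbours, degrees and additive queries. -/
def additiveModel : Set Query :=
  {q | match q with
    | .randEdge | .randNbr _ | .degree _ | .additive _ => True
    | .pair _ _ | .fullNbr _ => False}

/-- Random edges, random neighbours, degrees and pair queries. -/
def pairModel : Set Query :=
  {q | match q with
    | .randEdge | .randNbr _ | .degree _ | .pair _ _ => True
    | .additive _ | .fullNbr _ => False}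

/-- All queries: random edges, random neighbours, degrees, pair, additive and full neighbourhood
queries (but no random vertices). -/
def fullNbrModel : Set Query := Set.univ

/-- `r` is a `(1 ± ε)`-approximation to `d`. -/
def IsRelApprox (ε d r : ℝ) : Prop := (1 - ε) * d ≤ r ∧ r ≤ (1 + ε) * d

/-- `r` is a `c`-factor approximation to `d`. -/
def IsFactorApprox (c d r : ℝ) : Prop := d / c ≤ r ∧ r ≤ c * d

/-! Upper bound. A random edge has an end point x with probability proportional to the degree of x,
and weights 1/deg undo this bias. For a random edge uv the mean of 1/deg(u) + 1/deg(v) is n/m = 2/d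
(`avg_recip`), so drawing edges until these terms add up to T of order ε⁻² takes about Td/2 draws.
This costs order d.

For large d a second method is cheaper. Call an edge heavy if both its end points have degree at
least τ, and let p be the fraction of heavy edges. Take two samples of s edges. The number H of
heavy edges in the first sample has mean sp. The number Z of adjacent pairs between the end points
of the two samples, weighted by ⌊Q/deg⌋ at end points of degree at least τ, has mean about 2s²Q²p/m.
So H/Z determines m, and p cancels. By the second moment bound `tupleAvg_bilinear_le`, s of order
ε⁻²√(n/τ) suffices, provided that τ is at least a constant times d and p is at least a constant.
Both are likely if τ is the smaller end degree of one random edge (`avg_minDeg_lt_le`,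
`avg_heavy_lt_le`). Z is a bilinear form of the adjacency matrix; binary digits of the weights and
inclusion-exclusion reduce it to O(log² n) additive queries (`sum_bilinearQueries`). The first
method is abandoned for the second after s draws, which gives the minimum of the two costs.

Lower bounds. The hard graphs are N cliques of size t and a star on the remaining vertices, with
randomly placed names. Two families whose values of N differ by a factor K ≥ 4c² have incompatible
average degrees. As long as no star edge is drawn and no clique is met twice independently, the
answers carry no information on N: they can be simulated by an ideal oracle common to both families.
`exists_common_law` proves this by induction on the decision tree, with a loss factor per query, and
`survival_le_of_disjoint_goals` concludes that the total loss is at least a constant.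

With all queries, the oracle may reveal the whole clique of each random edge, after which all other
answers are determined (`clique_exposure_step`). The b-th draw is lost with probability of order b/N
+ 1/t, and t ≈ n^(1/3) is the best choice. With pair queries in place of additive and
full-neighbourhood queries, only groups of vertices known to share a clique are revealed. Two groups
collide with probability about 1/N (`card_collision_mul_le`), so about N, which is of order n/D for
t of order D, pair queries are needed before a collision is seen. -/

open scoped ENNReal

/-! ### Truncated algorithms and comparison with an ideal oracle. -/

namespace Algorithm

/-- The algorithm stopped, with the junk output `-1`, as soon as its cost would exceed `b`. -/
def trunc {M : Set Query} : Algorithm M → ℕ → Algorithm M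
  | .output r, _ => .output r
  | .random μ next, b => .random μ fun i => (next i).trunc b
  | .query q h next, b =>
      if q.cost ≤ b then .query q h fun a => (next a).trunc (b - q.cost) else .output (-1)

/-- The probability that the output lies in `E`. -/
noncomputable def outProb {M : Set Query} (A : Algorithm M) (G : NetGraph) (known : Finset ℕ)
    (E : Set ℝ) : ℝ≥0∞ :=
  (A.runFrom G known).toOuterMeasure {p | p.1 ∈ E}

variable {M : Set Query}

theorem outProb_output (G : NetGraph) (known : Finset ℕ) (E : Set ℝ) (r : ℝ) [Decidable (r ∈ E)] :
    (output r : Algorithm M).outProb G known E = if r ∈ E then 1 else 0 := by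
  classical
  simp only [outProb, runFrom]
  rw [PMF.toOuterMeasure_pure_apply]
  simp only [Set.mem_ofPred_eq]
  congr

theorem outProb_random (G : NetGraph) (known : Finset ℕ) (E : Set ℝ) (μ : PMF ℕ)
    (next : ℕ → Algorithm M) :
    (random μ next).outProb G known E = ∑' i, μ i * (next i).outProb G known E := by
  simp only [outProb, runFrom]
  rw [PMF.toOuterMeasure_bind_apply]

theorem outProb_query (G : NetGraph) (known : Finset ℕ) (E : Set ℝ) (q : Query) (h : q ∈ M)
    (next : q.Answer → Algorithm M) :
    (query q h next).outProb G known E =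
      ∑' a, respond G known q a * (next a).outProb G (learn known q a) E := by
  simp only [outProb, runFrom]
  rw [PMF.toOuterMeasure_bind_apply]
  congr 1
  funext a
  rw [PMF.toOuterMeasure_map_apply]
  rfl

theorem outProb_add_compl (A : Algorithm M) (G : NetGraph) (known : Finset ℕ) (E : Set ℝ) :
    A.outProb G known E + A.outProb G known Eᶜ = 1 := by
  simp only [outProb, PMF.toOuterMeasure_apply]
  rw [← ENNReal.tsum_add, ← PMF.tsum_coe (A.runFrom G known)]
  congr 1
  funext p
  by_cases hp : p.1 ∈ E <;> simp [Set.indicator, hp]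

/-- Runs within budget are untouched by truncation. Only an inequality holds, since the junk output
of a stopped run may happen to be good. -/
theorem le_outProb_trunc (A : Algorithm M) (G : NetGraph) (good : Set ℝ) :
    ∀ (known : Finset ℕ) (b : ℕ),
      (A.runFrom G known).toOuterMeasure {p | p.1 ∈ good ∧ p.2 ≤ b} ≤
        (A.trunc b).outProb G known good := by
  induction A with
  | output r =>
    intro known b
    simp only [trunc, outProb]
    apply PMF.toOuterMeasure_mono
    rintro p ⟨hp, -⟩
    exact hp.1
  | random μ next ih =>
    intro known b
    simp only [trunc, outProb_random, runFrom]
    rw [PMF.toOuterMeasure_bind_apply]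
    exact ENNReal.tsum_le_tsum fun i => mul_le_mul_right (ih i known b) _
  | query q h next ih =>
    intro known b
    simp only [trunc, runFrom]
    rw [PMF.toOuterMeasure_bind_apply]
    split_ifs with hq
    · rw [outProb_query]
      refine ENNReal.tsum_le_tsum fun a => mul_le_mul_right ?_ _
      refine le_trans ?_ (ih a (learn known q a) (b - q.cost))
      rw [PMF.toOuterMeasure_map_apply]
      apply PMF.toOuterMeasure_mono
      rintro p ⟨hp, -⟩
      simp only [Set.mem_preimage, Set.mem_ofPred_eq] at hp ⊢
      exact ⟨hp.1, by omega⟩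
    · refine le_trans (le_of_eq ?_) zero_le
      rw [ENNReal.tsum_eq_zero]
      intro a
      rw [mul_eq_zero]
      right
      rw [PMF.toOuterMeasure_map_apply, PMF.toOuterMeasure_apply_eq_zero_iff]
      rw [Set.disjoint_right]
      rintro p hp
      simp only [Set.mem_preimage, Set.mem_ofPred_eq] at hp
      omega

end Algorithm

/-- If the answers of all graphs of the families `G i` dominate, state by state, those of a common
ideal oracle, then the law of the output of a truncated algorithm, averaged over a family, dominates
a law that does not depend on the family. -/
theorem exists_common_law {M : Set Query} {ι : Type} {Idx : ι → Type} [∀ i, DecidableEq (Idx i)]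
    (G : ∀ i, Idx i → NetGraph) {State : Type} (Comp : ∀ i, State → Finset (Idx i))
    (W : ι → State → ℕ) (fac leafc : ℝ≥0∞)
    (Inv : State → Finset ℕ → ℕ → Prop)
    (hleaf : ∀ σ κ b, Inv σ κ b → ∀ i, leafc * W i σ ≤ (Comp i σ).card)
    (hfac : fac ≤ 1)
    (hstep : ∀ σ κ b q, q ∈ M → Inv σ κ b → q.cost ≤ b →
      ∃ (Ω : Type) (I : PMF Ω) (ans : Ω → q.Answer) (st : Ω → State),
        (∀ ω ∈ I.support, Inv (st ω) (learn κ q (ans ω)) (b - q.cost) ∧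
          ∀ i, Comp i (st ω) ⊆ Comp i σ ∧ W i (st ω) ≠ 0) ∧
        ∀ i, ∀ π ∈ Comp i σ, ∀ f : q.Answer → ℝ≥0∞,
          fac ^ q.cost * ∑' ω, I ω * ((W i σ : ℝ≥0∞) / W i (st ω)) *
            (if π ∈ Comp i (st ω) then f (ans ω) else 0) ≤
          ∑' a, respond (G i π) κ q a * f a)
    (A : Algorithm M) :
    ∀ σ κ b, Inv σ κ b → ∃ D : PMF ℝ, ∀ i, ∀ E : Set ℝ,
      fac ^ b * leafc * W i σ * D.toOuterMeasure E ≤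
        ∑ π ∈ Comp i σ, (A.trunc b).outProb (G i π) κ E := by
  classical
  -- The leaf case is needed twice: for genuine outputs and for the junk output when the budget does
  -- not cover the next query.
  have key : ∀ (r : ℝ) σ κ b, Inv σ κ b → ∃ D : PMF ℝ, ∀ i, ∀ E : Set ℝ,
      fac ^ b * leafc * W i σ * D.toOuterMeasure E ≤
        ∑ π ∈ Comp i σ, (Algorithm.output r : Algorithm M).outProb (G i π) κ E := by
    intro r σ κ b hinv
    refine ⟨PMF.pure r, fun i E => ?_⟩
    simp only [Algorithm.outProb_output, Finset.sum_const, nsmul_eq_mul]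
    rw [PMF.toOuterMeasure_pure_apply]
    refine mul_le_mul ?_ (by split_ifs <;> rfl) zero_le zero_le
    refine le_trans ?_ (hleaf σ κ b hinv i)
    rw [mul_assoc]
    exact mul_le_of_le_one_left zero_le (pow_le_one₀ zero_le hfac)
  induction A with
  | output r => exact fun σ κ b h => key r σ κ b h
  | random μ next ih =>
    intro σ κ b hinv
    choose D hD using fun k => ih k σ κ b hinv
    refine ⟨μ.bind D, fun i E => ?_⟩
    simp only [Algorithm.trunc, Algorithm.outProb_random]
    rw [PMF.toOuterMeasure_bind_apply, ← ENNReal.tsum_mul_left,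
      ← Summable.tsum_finsetSum (fun _ _ => ENNReal.summable)]
    refine ENNReal.tsum_le_tsum fun k => ?_
    rw [← Finset.mul_sum]
    calc _ = μ k * (fac ^ b * leafc * W i σ * (D k).toOuterMeasure E) := by ring
      _ ≤ _ := mul_le_mul_right (hD k i E) _
  | query q hq next ih =>
    intro σ κ b hinv
    by_cases hc : q.cost ≤ b
    swap
    · simp only [Algorithm.trunc, hc, if_false]
      exact key _ σ κ b hinv
    obtain ⟨Ω, I, ans, st, hsupp, hdom⟩ := hstep σ κ b q hq hinv hc
    have : ∀ ω, ∃ D : PMF ℝ, ω ∈ I.support → ∀ i, ∀ E : Set ℝ,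
        fac ^ (b - q.cost) * leafc * W i (st ω) * D.toOuterMeasure E ≤
        ∑ π ∈ Comp i (st ω), ((next (ans ω)).trunc (b - q.cost)).outProb (G i π)
          (learn κ q (ans ω)) E := by
      intro ω
      by_cases hω : ω ∈ I.support
      · obtain ⟨D, hD⟩ := ih (ans ω) (st ω) _ _ (hsupp ω hω).1
        exact ⟨D, fun _ => hD⟩
      -- Off the support any law serves, because its weight `I ω` vanishes.
      · exact ⟨PMF.pure 0, fun h => absurd h hω⟩
    choose D hD using this
    refine ⟨I.bind D, fun i E => ?_⟩
    simp only [Algorithm.trunc, hc, if_true, Algorithm.outProb_query]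
    rw [PMF.toOuterMeasure_bind_apply]
    set F : q.Answer → Idx i → ℝ≥0∞ := fun a π =>
      ((next a).trunc (b - q.cost)).outProb (G i π) (learn κ q a) E with hF
    -- The ratio of weights is a Bayes factor: it cancels the weight of the new state in the
    -- induction hypothesis and restores the weight of the old one.
    calc fac ^ b * leafc * W i σ * ∑' ω, I ω * (D ω).toOuterMeasure E
        = ∑' ω, fac ^ q.cost * (I ω * ((W i σ : ℝ≥0∞) / W i (st ω)) *
            (fac ^ (b - q.cost) * leafc * W i (st ω) * (D ω).toOuterMeasure E)) := by
          rw [← ENNReal.tsum_mul_left]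
          refine tsum_congr fun ω => ?_
          by_cases hω : ω ∈ I.support
          · have hW := ((hsupp ω hω).2 i).2
            have h1 : (W i σ : ℝ≥0∞) / W i (st ω) * W i (st ω) = W i σ :=
              ENNReal.div_mul_cancel (by exact_mod_cast hW) (ENNReal.natCast_ne_top _)
            have h2 : fac ^ b = fac ^ q.cost * fac ^ (b - q.cost) := by
              rw [← pow_add]; congr 1; omega
            rw [h2]
            conv_lhs => rw [← h1]
            ring
          · have : I ω = 0 := by simpa [PMF.mem_support_iff] using hω
            simp [this]
      _ ≤ ∑' ω, fac ^ q.cost * (I ω * ((W i σ : ℝ≥0∞) / W i (st ω)) *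
            ∑ π ∈ Comp i (st ω), F (ans ω) π) := by
          refine ENNReal.tsum_le_tsum fun ω => ?_
          by_cases hω : ω ∈ I.support
          · exact mul_le_mul_right (mul_le_mul_right (hD ω hω i E) _) _
          · have : I ω = 0 := by simpa [PMF.mem_support_iff] using hω
            simp [this]
      -- The instances compatible with the new state are among those compatible with the old one, so
      -- an indicator allows the two sums to be exchanged.
      _ = ∑' ω, ∑ π ∈ Comp i σ, fac ^ q.cost * (I ω * ((W i σ : ℝ≥0∞) / W i (st ω)) *
            (if π ∈ Comp i (st ω) then F (ans ω) π else 0)) := by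
          refine tsum_congr fun ω => ?_
          by_cases hω : ω ∈ I.support
          · rw [← Finset.mul_sum, ← Finset.mul_sum, ← Finset.sum_filter,
              Finset.filter_mem_eq_inter, Finset.inter_eq_right.2 ((hsupp ω hω).2 i).1]
          · have : I ω = 0 := by simpa [PMF.mem_support_iff] using hω
            simp [this]
      _ = ∑ π ∈ Comp i σ, fac ^ q.cost * ∑' ω, (I ω * ((W i σ : ℝ≥0∞) / W i (st ω)) *
            (if π ∈ Comp i (st ω) then F (ans ω) π else 0)) := by
          rw [Summable.tsum_finsetSum (fun _ _ => ENNReal.summable)]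
          exact Finset.sum_congr rfl fun π _ => ENNReal.tsum_mul_left
      _ ≤ _ := Finset.sum_le_sum fun π hπ => hdom i π hπ fun a => F a π

/-- No output is good for both families, so the failure probabilities of the common law `D` for the
two goals add up to at least 1. Scaled by the surviving mass, each is at most the average failure
probability 1/3 on its family. -/
theorem survival_le_of_disjoint_goals {M : Set Query} {Idx : Bool → Type}
    [∀ i, DecidableEq (Idx i)] [∀ i, Fintype (Idx i)] [∀ i, Nonempty (Idx i)]
    (G : ∀ i, Idx i → NetGraph) (fac leafc : ℝ≥0∞) (b : ℕ) (A : Algorithm M)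
    (hlaw : ∃ D : PMF ℝ, ∀ i, ∀ E : Set ℝ,
      fac ^ b * leafc * (Fintype.card (Idx i) : ℝ≥0∞) * D.toOuterMeasure E ≤
        ∑ π, (A.trunc b).outProb (G i π) ∅ E)
    (good : Bool → Set ℝ) (hdisj : Disjoint (good true) (good false)) (B : ℝ) (hB : B < b + 1)
    (hA : ∀ i π, 2 / 3 ≤ A.successProb (G i π) (fun r => r ∈ good i) B) :
    fac ^ b * leafc ≤ 2 / 3 := by
  obtain ⟨D, hD⟩ := hlaw
  have h13 : (2 : ℝ≥0∞) / 3 + 1 / 3 = 1 := by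
    rw [ENNReal.div_add_div_same]
    norm_num
    exact ENNReal.div_self (by norm_num) (by norm_num)
  have hfail : ∀ i π, (A.trunc b).outProb (G i π) ∅ (good i)ᶜ ≤ 1 / 3 := by
    intro i π
    have h1 : 2 / 3 ≤ (A.trunc b).outProb (G i π) ∅ (good i) := by
      refine le_trans (hA i π) (le_trans ?_ (A.le_outProb_trunc (G i π) (good i) ∅ b))
      apply PMF.toOuterMeasure_mono
      rintro p ⟨⟨hp1, hp2⟩, -⟩
      refine ⟨hp1, ?_⟩
      have : (p.2 : ℝ) < ((b + 1 : ℕ) : ℝ) := by push_cast; linarith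
      have := Nat.cast_lt.1 this
      omega
    have h2 := (A.trunc b).outProb_add_compl (G i π) ∅ (good i)
    rw [← h13] at h2
    have h3 : (2 : ℝ≥0∞) / 3 + (A.trunc b).outProb (G i π) ∅ (good i)ᶜ ≤ 2 / 3 + 1 / 3 :=
      (add_le_add_left h1 _).trans h2.le
    exact (ENNReal.add_le_add_iff_left (ENNReal.div_ne_top (by norm_num) (by norm_num))).1 h3
  have hhalf : ∀ i, fac ^ b * leafc * D.toOuterMeasure (good i)ᶜ ≤ 1 / 3 := by
    intro i
    have h1 := (hD i (good i)ᶜ).trans (Finset.sum_le_sum fun π _ => hfail i π)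
    rw [Finset.sum_const, nsmul_eq_mul, Finset.card_univ] at h1
    have hc : (Fintype.card (Idx i) : ℝ≥0∞) ≠ 0 := by exact_mod_cast Fintype.card_ne_zero
    refine (ENNReal.mul_le_mul_iff_right hc (ENNReal.natCast_ne_top _)).1 (le_trans (le_of_eq ?_) h1)
    ring
  have hone : 1 ≤ D.toOuterMeasure (good true)ᶜ + D.toOuterMeasure (good false)ᶜ := by
    have : D.toOuterMeasure Set.univ = 1 := by
      rw [PMF.toOuterMeasure_apply_eq_one_iff]; exact Set.subset_univ _
    rw [← this]
    refine le_trans (MeasureTheory.measure_mono ?_) (MeasureTheory.measure_union_le _ _)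
    intro r _
    by_contra h
    simp only [Set.mem_union, Set.mem_compl_iff, not_or, not_not] at h
    exact Set.disjoint_left.1 hdisj h.1 h.2
  calc fac ^ b * leafc = fac ^ b * leafc * 1 := by ring
    _ ≤ fac ^ b * leafc * (D.toOuterMeasure (good true)ᶜ + D.toOuterMeasure (good false)ᶜ) := by
        gcongr
    _ ≤ 1 / 3 + 1 / 3 := by rw [mul_add]; exact add_le_add (hhalf _) (hhalf _)
    _ = 2 / 3 := by rw [ENNReal.div_add_div_same]; norm_num

/-! ### Ordered adjacent pairs and degree counting. -/

namespace NetGraph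

open Classical in
/-- The ordered pairs of adjacent vertices. -/
noncomputable def arcs (G : NetGraph) : Finset (ℕ × ℕ) :=
  (G.verts ×ˢ G.verts).filter fun p => G.graph.Adj p.1 p.2

variable (G : NetGraph)

theorem mem_verts_left {u v : ℕ} (h : G.graph.Adj u v) : u ∈ G.verts := G.mem_of_adj u v h

theorem mem_verts_right {u v : ℕ} (h : G.graph.Adj u v) : v ∈ G.verts := G.mem_of_adj v u h.symm

theorem mem_arcs {p : ℕ × ℕ} : p ∈ G.arcs ↔ G.graph.Adj p.1 p.2 := by
  simp only [arcs, Finset.mem_filter, Finset.mem_product, and_iff_right_iff_imp]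
  exact fun h => ⟨G.mem_verts_left h, G.mem_verts_right h⟩

theorem mem_nbrs {x y : ℕ} : y ∈ G.nbrs x ↔ G.graph.Adj x y := by
  simp only [nbrs, Finset.mem_filter, and_iff_right_iff_imp]
  exact fun h => G.mem_verts_right h

theorem mk_mem_edgesWithin {S : Finset ℕ} {u v : ℕ} :
    s(u, v) ∈ G.edgesWithin S ↔ u ∈ S ∧ v ∈ S ∧ G.graph.Adj u v := by
  simp [edgesWithin, and_assoc]

theorem mk_mem_edges {u v : ℕ} : s(u, v) ∈ G.edges ↔ G.graph.Adj u v := by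
  rw [edges, mk_mem_edgesWithin]
  exact ⟨fun h => h.2.2, fun h => ⟨G.mem_verts_left h, G.mem_verts_right h, h⟩⟩

theorem sum_arcs {R : Type*} [AddCommMonoid R] (f : Sym2 ℕ → R) :
    ∑ p ∈ G.arcs, f s(p.1, p.2) = 2 • ∑ e ∈ G.edges, f e := by
  classical
  have hmap : ∀ p ∈ G.arcs, s(p.1, p.2) ∈ G.edges := fun p hp =>
    G.mk_mem_edges.2 (G.mem_arcs.1 hp)
  rw [← Finset.sum_fiberwise_of_maps_to hmap, Finset.smul_sum]
  refine Finset.sum_congr rfl fun e he => ?_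
  induction e using Sym2.ind with
  | _ u v =>
    have hadj := G.mk_mem_edges.1 he
    have hne : u ≠ v := hadj.ne
    have hset : G.arcs.filter (fun p => s(p.1, p.2) = s(u, v)) = {(u, v), (v, u)} := by
      ext ⟨a, b⟩
      simp only [Finset.mem_filter, mem_arcs, Sym2.eq_iff, Finset.mem_insert,
        Finset.mem_singleton, Prod.mk.injEq]
      constructor
      · exact fun h => h.2
      · rintro (⟨rfl, rfl⟩ | ⟨rfl, rfl⟩)
        · exact ⟨hadj, Or.inl ⟨rfl, rfl⟩⟩
        · exact ⟨hadj.symm, Or.inr ⟨rfl, rfl⟩⟩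
    rw [hset, Finset.sum_pair (by simp [hne]), two_nsmul, Sym2.eq_swap (a := v)]

theorem sum_arcs_eq_sum_nbrs {R : Type*} [AddCommMonoid R] (f : ℕ → ℕ → R) :
    ∑ p ∈ G.arcs, f p.1 p.2 = ∑ x ∈ G.verts, ∑ y ∈ G.nbrs x, f x y := by
  rw [Finset.sum_sigma']
  refine Finset.sum_bij' (fun p _ => ⟨p.1, p.2⟩) (fun p _ => (p.1, p.2)) ?_ ?_ ?_ ?_ ?_
  · intro p hp
    have := G.mem_arcs.1 hp
    simp only [Finset.mem_sigma]
    exact ⟨G.mem_verts_left this, G.mem_nbrs.2 this⟩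
  · intro p hp
    exact G.mem_arcs.2 (G.mem_nbrs.1 (Finset.mem_sigma.1 hp).2)
  all_goals intros; rfl

theorem two_mul_card_edges : 2 * G.edges.card = ∑ x ∈ G.verts, (G.nbrs x).card := by
  have h1 := G.sum_arcs (fun _ => (1 : ℕ))
  have h2 := G.sum_arcs_eq_sum_nbrs (fun _ _ => (1 : ℕ))
  simp only [Finset.sum_const, smul_eq_mul, mul_one] at h1 h2
  rw [← h1, h2]

end NetGraph

/-! ### The hard graphs: equal cliques and a star with randomly placed vertices. -/

/-- The places of `N` cliques of size `t` and of a star with `r` vertices. -/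
abbrev Slot (N t r : ℕ) : Type := (Fin N × Fin t) ⊕ Fin r

/-- Adjacency of places: `N` disjoint cliques and a star centred at its first vertex. -/
def slotAdj {N t r : ℕ} : Slot N t r → Slot N t r → Prop
  | .inl p, .inl q => p.1 = q.1 ∧ p ≠ q
  | .inr a, .inr b => a ≠ b ∧ (a.val = 0 ∨ b.val = 0)
  | _, _ => False

theorem slotAdj_symm {N t r : ℕ} : ∀ p q : Slot N t r, slotAdj p q → slotAdj q p
  | .inl _, .inl _, h => ⟨h.1.symm, h.2.symm⟩
  | .inr _, .inr _, h => ⟨h.1.symm, h.2.symm⟩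

theorem not_slotAdj_self {N t r : ℕ} : ∀ p : Slot N t r, ¬ slotAdj p p
  | .inl _, h => h.2 rfl
  | .inr _, h => h.1 rfl

/-- An arrangement of the vertices of `V` on the places. -/
abbrev Placement (V : Finset ℕ) (N t r : ℕ) : Type := ↥V ≃ Slot N t r

namespace Placement

variable {V : Finset ℕ} {N t r : ℕ} (π : Placement V N t r)

/-- The union of `N` cliques of size `t` and a star on the vertex set `V`, arranged by `π`. -/
def toGraph : NetGraph where
  verts := V
  graph :=
    { Adj := fun u v => ∃ hu hv, slotAdj (π ⟨u, hu⟩) (π ⟨v, hv⟩)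
      symm := ⟨fun _ _ ⟨hu, hv, h⟩ => ⟨hv, hu, slotAdj_symm _ _ h⟩⟩
      loopless := ⟨fun _ ⟨_, _, h⟩ => not_slotAdj_self _ h⟩ }
  mem_of_adj := fun _ _ ⟨hu, _, _⟩ => hu

/-- The index of the clique that contains `u`, if any. -/
def clique (u : ℕ) : Option (Fin N) :=
  if h : u ∈ V then
    match π ⟨u, h⟩ with
    | .inl p => some p.1
    | .inr _ => none
  else none

theorem clique_eq_some {u : ℕ} {i : Fin N} :
    π.clique u = some i ↔ ∃ a, ∃ h : u ∈ V, π ⟨u, h⟩ = .inl (i, a) := by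
  unfold clique
  split_ifs with h
  · rcases hp : π ⟨u, h⟩ with ⟨j, a⟩ | b
    · simp [h, hp]
    · simp [hp]
  · simp [h]

theorem mem_of_clique {u : ℕ} {i : Fin N} (h : π.clique u = some i) : u ∈ V := by
  obtain ⟨_, h, _⟩ := π.clique_eq_some.1 h
  exact h

theorem clique_symm (i : Fin N) (a : Fin t) : π.clique (π.symm (.inl (i, a))) = some i :=
  π.clique_eq_some.2 ⟨a, (π.symm (.inl (i, a))).2, by simp⟩

theorem adj_of_clique {u v : ℕ} {i : Fin N} (hu : π.clique u = some i) :
    π.toGraph.graph.Adj u v ↔ u ≠ v ∧ π.clique v = some i := by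
  obtain ⟨a, hu, h⟩ := π.clique_eq_some.1 hu
  rw [clique_eq_some]
  constructor
  · rintro ⟨hu', hv, h'⟩
    have hne : u ≠ v := by
      rintro rfl
      exact not_slotAdj_self _ h'
    rw [h] at h'
    refine ⟨hne, ?_⟩
    rcases hv' : π ⟨v, hv⟩ with ⟨j, b⟩ | b
    · rw [hv'] at h'
      exact ⟨b, hv, by rw [hv', show i = j from h'.1]⟩
    · rw [hv'] at h'
      exact h'.elim
  · rintro ⟨hne, b, hv, hb⟩
    refine ⟨hu, hv, ?_⟩
    rw [h, hb]
    refine ⟨rfl, fun hab => hne ?_⟩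
    have : (π ⟨u, hu⟩) = π ⟨v, hv⟩ := by rw [h, hb, hab]
    simpa using π.injective this

/-- The vertex set of the `i`-th clique. -/
def block (i : Fin N) : Finset ℕ := V.filter fun u => π.clique u = some i

theorem mem_block {i : Fin N} {u : ℕ} : u ∈ π.block i ↔ π.clique u = some i := by
  simp only [block, Finset.mem_filter, and_iff_right_iff_imp]
  exact π.mem_of_clique

theorem block_subset (i : Fin N) : π.block i ⊆ V := Finset.filter_subset _ _

theorem block_eq_image (i : Fin N) :
    π.block i = Finset.univ.image fun a : Fin t => (π.symm (.inl (i, a)) : ℕ) := by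
  ext u
  rw [mem_block, clique_eq_some]
  simp only [Finset.mem_image, Finset.mem_univ, true_and]
  constructor
  · rintro ⟨a, h, hu⟩
    exact ⟨a, by rw [← hu]; simp⟩
  · rintro ⟨a, rfl⟩
    exact ⟨a, (π.symm (.inl (i, a))).2, by simp⟩

theorem card_block (i : Fin N) : (π.block i).card = t := by
  rw [block_eq_image, Finset.card_image_of_injective, Finset.card_univ, Fintype.card_fin]
  intro a b h
  have := π.symm.injective (Subtype.ext h)
  simpa using this

theorem nbrs_of_clique {u : ℕ} {i : Fin N} (hu : π.clique u = some i) :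
    π.toGraph.nbrs u = (π.block i).erase u := by
  ext v
  rw [NetGraph.mem_nbrs, adj_of_clique _ hu, Finset.mem_erase, mem_block, ne_comm]

theorem card_nbrs_of_clique {u : ℕ} {i : Fin N} (hu : π.clique u = some i) :
    (π.toGraph.nbrs u).card = t - 1 := by
  rw [nbrs_of_clique π hu, Finset.card_erase_of_mem (π.mem_block.2 hu), card_block]

theorem card_nbrs_inr (b : Fin r) :
    (π.toGraph.nbrs (π.symm (.inr b))).card = if b.val = 0 then r - 1 else 1 := by
  have hset : π.toGraph.nbrs (π.symm (.inr b)) =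
      (Finset.univ.filter fun c : Fin r => b ≠ c ∧ (b.val = 0 ∨ c.val = 0)).image
        fun c => (π.symm (.inr c) : ℕ) := by
    ext v
    rw [NetGraph.mem_nbrs]
    simp only [Finset.mem_image, Finset.mem_filter, Finset.mem_univ, true_and]
    constructor
    · rintro ⟨hu, hv, h⟩
      have hu' : π ⟨(π.symm (.inr b) : ℕ), hu⟩ = .inr b := by simp
      rw [hu'] at h
      rcases hv' : π ⟨v, hv⟩ with p | c
      · rw [hv'] at h; exact h.elim
      · rw [hv'] at h
        exact ⟨c, h, by rw [← hv']; simp⟩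
    · rintro ⟨c, h, rfl⟩
      refine ⟨Subtype.prop _, Subtype.prop _, ?_⟩
      simp only [Subtype.coe_eta, Equiv.apply_symm_apply]
      exact h
  rw [hset, Finset.card_image_of_injective]
  · split_ifs with hb
    · have : (Finset.univ.filter fun c : Fin r => b ≠ c ∧ (b.val = 0 ∨ c.val = 0)) =
          Finset.univ.erase b := by
        ext c; simp [hb, eq_comm]
      rw [this, Finset.card_erase_of_mem (Finset.mem_univ _), Finset.card_univ, Fintype.card_fin]
    · rw [Finset.card_eq_one]
      refine ⟨⟨0, by have := b.2; omega⟩, ?_⟩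
      ext c
      simp only [ne_eq, hb, false_or, Finset.mem_filter, Finset.mem_univ, true_and,
        Finset.mem_singleton, Fin.ext_iff]
      omega
  · intro a c h
    have := π.symm.injective (Subtype.ext h)
    simpa using this

theorem two_mul_card_edges (hr : 1 ≤ r) :
    2 * π.toGraph.edges.card = N * (t * (t - 1)) + 2 * (r - 1) := by
  rw [NetGraph.two_mul_card_edges]
  change ∑ x ∈ V, (π.toGraph.nbrs x).card = _
  rw [← Finset.sum_coe_sort V (fun x => (π.toGraph.nbrs x).card), ← π.symm.sum_comp,
    Fintype.sum_sum_type]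
  congr 1
  · rw [Finset.sum_congr rfl (g := fun _ => t - 1)
      (fun p _ => π.card_nbrs_of_clique (π.clique_symm p.1 p.2))]
    simp [mul_assoc]
  · simp only [card_nbrs_inr]
    obtain ⟨s, rfl⟩ : ∃ s, r = s + 1 := ⟨r - 1, by omega⟩
    rw [Fin.sum_univ_succ]
    simp [two_mul]

theorem noIsolated (ht : 2 ≤ t) (hr : 2 ≤ r) : π.toGraph.NoIsolated := by
  intro x hx
  have hpos : 0 < (π.toGraph.nbrs x).card := by
    have hx' : x = π.symm (π ⟨x, hx⟩) := by simp
    rcases hp : π ⟨x, hx⟩ with p | b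
    · rw [hp] at hx'
      rw [hx', π.card_nbrs_of_clique (π.clique_symm p.1 p.2)]
      omega
    · rw [hp] at hx'
      rw [hx', card_nbrs_inr]
      split_ifs <;> omega
  obtain ⟨y, hy⟩ := Finset.card_pos.1 hpos
  exact ⟨y, (NetGraph.mem_nbrs _).1 hy⟩

theorem avgDegree_eq (hr : 1 ≤ r) :
    π.toGraph.avgDegree = (N * (t * (t - 1)) + 2 * (r - 1) : ℕ) / (V.card : ℝ) := by
  rw [← π.two_mul_card_edges hr, NetGraph.avgDegree]
  push_cast
  rfl

theorem clique_trans (τ : Equiv.Perm ↥V) (u : ↥V) :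
    Placement.clique (τ.trans π : Placement V N t r) u = π.clique (τ u) := by
  simp [clique]

theorem block_disjoint {i j : Fin N} (h : i ≠ j) : Disjoint (π.block i) (π.block j) := by
  rw [Finset.disjoint_left]
  intro u hi hj
  rw [mem_block] at hi hj
  exact h (by rw [hi] at hj; simpa using hj)

end Placement

/-! ### Exposing whole cliques: the ideal oracle for all query types. -/

theorem PMF.tsum_uniformOfFinset_mul {α : Type*} (s : Finset α) (hs : s.Nonempty) (g : α → ℝ≥0∞) :
    ∑' a, PMF.uniformOfFinset s hs a * g a = (s.card : ℝ≥0∞)⁻¹ * ∑ a ∈ s, g a := by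
  classical
  rw [tsum_eq_sum (s := s), Finset.mul_sum]
  · refine Finset.sum_congr rfl fun a ha => ?_
    rw [PMF.uniformOfFinset_apply_of_mem hs ha]
  · intro a ha
    rw [PMF.uniformOfFinset_apply_of_notMem hs ha, zero_mul]

theorem PMF.tsum_pure_mul {α : Type*} (a : α) (g : α → ℝ≥0∞) :
    ∑' b, PMF.pure a b * g b = g a := by
  classical
  rw [tsum_eq_single a]
  · simp [PMF.pure_apply]
  · intro b hb
    simp [PMF.pure_apply, hb]

/-- Ordered pairs are used because the ideal answers are drawn as ordered pairs of vertices. -/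
theorem NetGraph.tsum_respond_randEdge (G : NetGraph) (κ : Finset ℕ) (h : 0 < G.edges.card)
    (f : Sym2 ℕ → ℝ≥0∞) :
    ∑' a, respond G κ .randEdge a * f a =
      ((2 * G.edges.card : ℕ) : ℝ≥0∞)⁻¹ * ∑ p ∈ G.arcs, f s(p.1, p.2) := by
  have hne : G.edges.Nonempty := Finset.card_pos.1 h
  simp only [respond, hne, dif_pos]
  refine (PMF.tsum_uniformOfFinset_mul G.edges hne f).trans ?_
  rw [G.sum_arcs, nsmul_eq_mul, ← mul_assoc]
  congr 1
  push_cast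
  rw [ENNReal.mul_inv (by simp) (by simp), mul_right_comm, ENNReal.inv_mul_cancel (by simp) (by simp),
    one_mul]

/-- A permutation that fixes `U` and carries `D` to `D'`. -/
theorem exists_perm_fixing_mapping {α : Type*} [Fintype α] [DecidableEq α] (U D D' : Finset α)
    (hD : Disjoint D U) (hD' : Disjoint D' U) (hcard : D.card = D'.card) :
    ∃ τ : Equiv.Perm α, (∀ u ∈ U, τ u = u) ∧ ∀ u, τ u ∈ D' ↔ u ∈ D := by
  let X := {u : α // u ∉ U}
  let p : X → Prop := fun u => u.1 ∈ D
  let q : X → Prop := fun u => u.1 ∈ D'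
  have hp : Fintype.card {u : X // p u} = D.card := by
    rw [← Fintype.card_coe]
    exact Fintype.card_congr
      { toFun := fun u => ⟨u.1.1, u.2⟩
        invFun := fun u => ⟨⟨u.1, Finset.disjoint_left.1 hD u.2⟩, u.2⟩
        left_inv := fun _ => rfl
        right_inv := fun _ => rfl }
  have hq : Fintype.card {u : X // q u} = D'.card := by
    rw [← Fintype.card_coe]
    exact Fintype.card_congr
      { toFun := fun u => ⟨u.1.1, u.2⟩
        invFun := fun u => ⟨⟨u.1, Finset.disjoint_left.1 hD' u.2⟩, u.2⟩
        left_inv := fun _ => rfl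
        right_inv := fun _ => rfl }
  let e : {u : X // p u} ≃ {u : X // q u} :=
    Fintype.equivOfCardEq (by rw [hp, hq, hcard])
  let σ : Equiv.Perm X := e.extendSubtype
  refine ⟨Equiv.Perm.ofSubtype σ, fun u hu => ?_, fun u => ?_⟩
  · exact Equiv.Perm.ofSubtype_apply_of_not_mem σ (by simpa using hu)
  · by_cases hu : u ∈ U
    · rw [Equiv.Perm.ofSubtype_apply_of_not_mem σ (by simpa using hu)]
      exact ⟨fun h => absurd hu (Finset.disjoint_left.1 hD' h),
        fun h => absurd hu (Finset.disjoint_left.1 hD h)⟩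
    · rw [Equiv.Perm.ofSubtype_apply_of_mem σ hu]
      by_cases h : u ∈ D
      · exact ⟨fun _ => h, fun _ => e.extendSubtype_mem ⟨u, hu⟩ h⟩
      · exact ⟨fun h' => absurd h' (e.extendSubtype_not_mem ⟨u, hu⟩ h), fun h' => absurd h' h⟩

/-- The disjoint union of complete graphs on the members of `S`. -/
def cliqueGraph (S : Finset (Finset ℕ)) : NetGraph where
  verts := S.biUnion id
  graph :=
    { Adj := fun u v => u ≠ v ∧ ∃ C ∈ S, u ∈ C ∧ v ∈ C
      symm := ⟨fun _ _ ⟨h, C, hC, hu, hv⟩ => ⟨h.symm, C, hC, hv, hu⟩⟩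
      loopless := ⟨fun _ h => h.1 rfl⟩ }
  mem_of_adj := fun _ _ ⟨_, C, hC, hu, _⟩ => Finset.mem_biUnion.2 ⟨C, hC, hu⟩

/-- The answers to all queries but random edges depend only on the adjacencies of the known
vertices. -/
theorem respond_congr {G H : NetGraph} {κ : Finset ℕ}
    (h : ∀ x ∈ κ, ∀ y, G.graph.Adj x y ↔ H.graph.Adj x y) (q : Query) (hq : q ≠ .randEdge) :
    respond G κ q = respond H κ q := by
  classical
  have hn : ∀ x ∈ κ, G.nbrs x = H.nbrs x := fun x hx => by
    ext y; rw [G.mem_nbrs, H.mem_nbrs, h x hx]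
  have he : ∀ S ⊆ κ, G.edgesWithin S = H.edgesWithin S := fun S hS => by
    ext e
    induction e using Sym2.ind with
    | _ u v =>
      rw [G.mk_mem_edgesWithin, H.mk_mem_edgesWithin]
      refine and_congr_right fun hu => ?_
      rw [h u (hS hu)]
  cases q with
  | randEdge => exact absurd rfl hq
  | randNbr x =>
    by_cases hx : x ∈ κ
    · simp only [respond, hn x hx]
    · simp [respond, hx]
  | degree x =>
    by_cases hx : x ∈ κ
    · simp only [respond, hn x hx]
    · simp [respond, hx]
  | pair x y =>
    by_cases hx : x ∈ κ
    · simp only [respond, h x hx]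
    · simp [respond, hx]
  | additive S =>
    by_cases hS : S ⊆ κ
    · simp only [respond, he S hS]
    · simp [respond, hS]
  | fullNbr x =>
    by_cases hx : x ∈ κ
    · simp only [respond, hn x hx]
    · simp [respond, hx]

/-- The answers to queries other than random edges reveal no vertex of another component. -/
theorem learn_subset {G : NetGraph} {κ U : Finset ℕ} (hκ : κ ⊆ U) (hG : G.verts ⊆ U) (q : Query)
    (hq : q ≠ .randEdge) (a : q.Answer) (ha : a ∈ (respond G κ q).support) : learn κ q a ⊆ U := by
  classical
  cases q with
  | randEdge => exact absurd rfl hq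
  | randNbr x =>
    simp only [learn]
    split_ifs with hx
    · refine Finset.union_subset hκ (Finset.singleton_subset_iff.2 ?_)
      simp only [respond] at ha
      split_ifs at ha with h
      · exact hG (Finset.filter_subset _ _ ((PMF.mem_support_uniformOfFinset_iff h.2 a).1 ha))
      · have := (PMF.mem_support_pure_iff x a).1 ha
        rw [this]; exact hκ hx
    · exact hκ
  | fullNbr x =>
    simp only [learn]
    split_ifs with hx
    · refine Finset.union_subset hκ ?_
      have : a = G.nbrs x := by
        simp only [respond] at ha
        exact ((PMF.mem_support_pure_iff _ a).1 ha).trans (if_pos hx)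
      rw [this]
      exact (Finset.filter_subset _ _).trans hG
    · exact hκ
  | degree x => exact hκ
  | pair x y => exact hκ
  | additive S => exact hκ

namespace Placement

variable {V : Finset ℕ} {N t r : ℕ}

open Classical in
/-- The placements for which all members of `S` are cliques. -/
noncomputable def withCliques (V : Finset ℕ) (N t r : ℕ) (S : Finset (Finset ℕ)) :
    Finset (Placement V N t r) :=
  Finset.univ.filter fun π => ∀ C ∈ S, ∃ j, C = π.block j

theorem mem_withCliques {S : Finset (Finset ℕ)} {π : Placement V N t r} :
    π ∈ withCliques V N t r S ↔ ∀ C ∈ S, ∃ j, C = π.block j := by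
  simp [withCliques]

/-- A revealed clique is a whole component, so all adjacencies of its vertices are known. Hence the
rest of the placement cannot influence queries about them. -/
theorem adj_iff_cliqueGraph {S : Finset (Finset ℕ)} {π : Placement V N t r}
    (hπ : π ∈ withCliques V N t r S) {x : ℕ} (hx : x ∈ S.biUnion id) (y : ℕ) :
    π.toGraph.graph.Adj x y ↔ (cliqueGraph S).graph.Adj x y := by
  rw [mem_withCliques] at hπ
  obtain ⟨C, hC, hxC⟩ := Finset.mem_biUnion.1 hx
  obtain ⟨j, rfl⟩ := hπ C hC
  have hxj := π.mem_block.1 hxC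
  rw [π.adj_of_clique hxj]
  refine and_congr_right fun _ => ⟨fun hy => ⟨_, hC, hxC, π.mem_block.2 hy⟩, ?_⟩
  rintro ⟨C', hC', hx', hy'⟩
  obtain ⟨k, rfl⟩ := hπ C' hC'
  have hk := π.mem_block.1 hx'
  rw [hxj] at hk
  rw [Option.some.inj hk]
  exact π.mem_block.1 hy'

/-- Composing a placement with a permutation of the names that fixes the revealed vertices and
carries `C` to `C'` is an injection between the two sets of placements. -/
theorem card_withCliques_insert_le {S : Finset (Finset ℕ)} {C C' : Finset ℕ}
    (hC : C ⊆ V \ S.biUnion id) (hC' : C' ⊆ V \ S.biUnion id) (hcard : C.card = C'.card) :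
    (withCliques V N t r (insert C' S)).card ≤ (withCliques V N t r (insert C S)).card := by
  classical
  have hsub : ∀ D : Finset ℕ, D ⊆ V \ S.biUnion id →
      (Finset.univ.filter fun u : ↥V => (u : ℕ) ∈ D).card = D.card := by
    intro D hD
    rw [← Finset.card_image_of_injective _ Subtype.val_injective]
    congr 1
    ext u
    simp only [Finset.mem_image, Finset.mem_filter, Finset.mem_univ, true_and, Subtype.exists,
      exists_and_right, exists_eq_right]
    exact ⟨fun h => h.2, fun h => ⟨(Finset.mem_sdiff.1 (hD h)).1, h⟩⟩
  have hdis : ∀ D : Finset ℕ, D ⊆ V \ S.biUnion id →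
      Disjoint (Finset.univ.filter fun u : ↥V => (u : ℕ) ∈ D)
        (Finset.univ.filter fun u : ↥V => (u : ℕ) ∈ S.biUnion id) := by
    intro D hD
    rw [Finset.disjoint_left]
    intro u hu hu'
    simp only [Finset.mem_filter, Finset.mem_univ, true_and] at hu hu'
    exact (Finset.mem_sdiff.1 (hD hu)).2 hu'
  obtain ⟨τ, hτ1, hτ2⟩ := exists_perm_fixing_mapping _ _ _ (hdis C hC) (hdis C' hC')
    (by rw [hsub C hC, hsub C' hC', hcard])
  simp only [Finset.mem_filter, Finset.mem_univ, true_and] at hτ1 hτ2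
  refine Finset.card_le_card_of_injOn (fun π => τ.trans π) ?_ ?_
  · intro π hπ
    simp only [Finset.mem_coe] at hπ ⊢
    rw [mem_withCliques] at hπ ⊢
    have hblock : ∀ D D' : Finset ℕ, D ⊆ V → D' ⊆ V → (∀ u : ↥V, (τ u : ℕ) ∈ D' ↔ (u : ℕ) ∈ D) →
        ∀ j, D' = π.block j → D = Placement.block (τ.trans π : Placement V N t r) j := by
      intro D D' hD hD' h j hj
      ext u
      rw [mem_block]
      constructor
      · intro hu
        have := clique_trans π τ ⟨u, hD hu⟩
        simp only at this
        rw [this, ← mem_block, ← hj]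
        exact (h ⟨u, hD hu⟩).2 hu
      · intro hu
        have hV := mem_of_clique _ hu
        have := clique_trans π τ ⟨u, hV⟩
        simp only at this
        rw [this, ← mem_block, ← hj] at hu
        exact (h ⟨u, hV⟩).1 hu
    intro D hD
    rcases Finset.mem_insert.1 hD with rfl | hD
    · obtain ⟨j, hj⟩ := hπ C' (Finset.mem_insert_self _ _)
      exact ⟨j, hblock _ C' (hC.trans Finset.sdiff_subset) (hC'.trans Finset.sdiff_subset)
        hτ2 j hj⟩
    · obtain ⟨j, hj⟩ := hπ D (Finset.mem_insert_of_mem hD)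
      have hDV : D ⊆ V := hj ▸ π.block_subset j
      refine ⟨j, hblock _ D hDV hDV (fun u => ?_) j hj⟩
      constructor
      · intro hu
        have h1 : τ (τ u) = τ u := hτ1 (τ u) (Finset.mem_biUnion.2 ⟨D, hD, hu⟩)
        have := τ.injective h1
        rwa [this] at hu
      · intro hu
        rw [hτ1 u (Finset.mem_biUnion.2 ⟨D, hD, hu⟩)]
        exact hu
  · intro π _ π' _ h
    simp only at h
    ext1 u
    have := congrArg (fun e => e (τ.symm u)) h
    simpa using this

/-- Double counting of placements and further cliques: each placement has `N` distinct blocks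
(nonempty since `1 ≤ t`), of which those in `S` are already revealed. -/
theorem sum_card_withCliques_insert (ht : 1 ≤ t) (S : Finset (Finset ℕ)) :
    ∑ C ∈ (V \ S.biUnion id).powersetCard t, (withCliques V N t r (insert C S)).card =
      (withCliques V N t r S).card * (N - S.card) := by
  classical
  have hdouble : ∀ C, (withCliques V N t r (insert C S)).card =
      ∑ π ∈ withCliques V N t r S, if ∃ j, C = π.block j then 1 else 0 := by
    intro C
    rw [Finset.sum_ite, Finset.sum_const_zero, add_zero, Finset.sum_const, smul_eq_mul, mul_one]
    congr 1
    ext π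
    simp only [mem_withCliques, Finset.mem_filter, Finset.forall_mem_insert]
    exact and_comm
  simp only [hdouble]
  rw [Finset.sum_comm, Finset.sum_const_nat]
  intro π hπ
  have hinj : Function.Injective π.block := by
    intro i j hij
    by_contra hne
    have := π.block_disjoint hne
    rw [hij, disjoint_self, Finset.bot_eq_empty] at this
    have h2 := π.card_block j
    rw [this] at h2
    simp at h2
    omega
  rw [mem_withCliques] at hπ
  rw [Finset.sum_ite, Finset.sum_const_zero, add_zero, Finset.sum_const, smul_eq_mul, mul_one]
  have hset : (((V \ S.biUnion id).powersetCard t).filter fun C => ∃ j, C = π.block j) =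
      (Finset.univ.image π.block) \ S := by
    ext C
    simp only [Finset.mem_filter, Finset.mem_powersetCard, Finset.mem_sdiff, Finset.mem_image,
      Finset.mem_univ, true_and]
    constructor
    · rintro ⟨⟨h1, h2⟩, j, rfl⟩
      refine ⟨⟨j, rfl⟩, fun hS => ?_⟩
      obtain ⟨u, hu⟩ : (π.block j).Nonempty := by
        rw [← Finset.card_pos, h2]; omega
      exact (Finset.mem_sdiff.1 (h1 hu)).2 (Finset.mem_biUnion.2 ⟨_, hS, hu⟩)
    · rintro ⟨⟨j, rfl⟩, hS⟩
      refine ⟨⟨fun u hu => Finset.mem_sdiff.2 ⟨π.block_subset j hu, fun hu' => ?_⟩,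
        π.card_block j⟩, j, rfl⟩
      obtain ⟨D, hD, huD⟩ := Finset.mem_biUnion.1 hu'
      obtain ⟨k, rfl⟩ := hπ D hD
      by_cases hjk : j = k
      · subst hjk; exact hS hD
      · exact Finset.disjoint_left.1 (π.block_disjoint hjk) hu huD
  rw [hset, Finset.card_sdiff_of_subset, Finset.card_image_of_injective _ hinj, Finset.card_univ,
    Fintype.card_fin]
  intro C hC
  obtain ⟨j, rfl⟩ := hπ C hC
  exact Finset.mem_image_of_mem _ (Finset.mem_univ j)

/-- By symmetry all terms of the preceding sum are equal, so each is the average. -/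
theorem card_withCliques_insert (ht : 1 ≤ t) (S : Finset (Finset ℕ)) {C : Finset ℕ}
    (hC : C ∈ (V \ S.biUnion id).powersetCard t) :
    (withCliques V N t r (insert C S)).card * ((V \ S.biUnion id).powersetCard t).card =
      (withCliques V N t r S).card * (N - S.card) := by
  rw [← sum_card_withCliques_insert ht, mul_comm]
  symm
  refine Finset.sum_const_nat fun C' hC' => ?_
  rw [Finset.mem_powersetCard] at hC hC'
  exact le_antisymm
    (card_withCliques_insert_le hC.1 hC'.1 (by rw [hC.2, hC'.2]))
    (card_withCliques_insert_le hC'.1 hC.1 (by rw [hC.2, hC'.2]))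

end Placement

namespace Placement

variable {V : Finset ℕ} {N t r : ℕ}

/-- The sum over the arcs inside some of the cliques is at most the sum over all arcs. -/
theorem sum_cliques_le_sum_arcs (π : Placement V N t r) (F : Finset (Finset ℕ)) [DecidableEq ℕ]
    (hF : ∀ C ∈ F, ∃ j, C = π.block j) (f : ℕ × ℕ → ℝ≥0∞) :
    ∑ C ∈ F, ∑ p ∈ C.offDiag, f p ≤ ∑ p ∈ π.toGraph.arcs, f p := by
  classical
  rw [← Finset.sum_biUnion]
  · refine Finset.sum_le_sum_of_subset fun p hp => ?_
    obtain ⟨C, hC, hp⟩ := Finset.mem_biUnion.1 hp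
    obtain ⟨j, rfl⟩ := hF C hC
    obtain ⟨h1, h2, h3⟩ := Finset.mem_offDiag.1 hp
    rw [NetGraph.mem_arcs, π.adj_of_clique (π.mem_block.1 h1)]
    exact ⟨h3, π.mem_block.1 h2⟩
  · intro C hC C' hC' hne
    obtain ⟨j, rfl⟩ := hF C hC
    obtain ⟨k, rfl⟩ := hF C' hC'
    have hjk : j ≠ k := fun h => hne (by rw [h])
    rw [Function.onFun, Finset.disjoint_left]
    intro p hp hp'
    exact Finset.disjoint_left.1 (π.block_disjoint hjk) (Finset.mem_offDiag.1 hp).1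
      (Finset.mem_offDiag.1 hp').1

theorem card_edges_pos (π : Placement V N t r) (hr : 2 ≤ r) : 0 < π.toGraph.edges.card := by
  have := π.two_mul_card_edges (by omega)
  omega

end Placement

-- The state is the set of revealed cliques. A random edge is answered ideally by a uniformly random
-- unrevealed clique and a random pair in it, which ignores `N i` and `r i`. The price `fac` covers
-- edges in revealed cliques and edges of the star; all other queries are free.
open Placement in
theorem clique_exposure_step {V : Finset ℕ} {t : ℕ} (ht : 2 ≤ t) {N r : Bool → ℕ}
    (hr : ∀ i, 2 ≤ r i) (b₀ : ℕ) (hbN : ∀ i, b₀ < N i) (fac : ℝ≥0∞) (hfac1 : fac ≤ 1)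
    (hfac : ∀ i, fac * ((N i * (t * (t - 1)) + 2 * (r i - 1) : ℕ) : ℝ≥0∞) ≤
      ((t * (t - 1) * (N i - b₀) : ℕ) : ℝ≥0∞))
    (S : Finset (Finset ℕ)) (κ : Finset ℕ) (b : ℕ) (q : Query)
    (hinv : κ ⊆ S.biUnion id ∧ S.card + b ≤ b₀ ∧ ∀ i, (withCliques V (N i) t (r i) S).card ≠ 0)
    (hq : q.cost ≤ b) :
      ∃ (Ω : Type) (I : PMF Ω) (ans : Ω → q.Answer) (st : Ω → Finset (Finset ℕ)),
        (∀ ω ∈ I.support,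
          (learn κ q (ans ω) ⊆ (st ω).biUnion id ∧ (st ω).card + (b - q.cost) ≤ b₀ ∧
            ∀ i, (withCliques V (N i) t (r i) (st ω)).card ≠ 0) ∧
          ∀ i, withCliques V (N i) t (r i) (st ω) ⊆ withCliques V (N i) t (r i) S ∧
            (withCliques V (N i) t (r i) (st ω)).card ≠ 0) ∧
        ∀ i, ∀ π ∈ withCliques V (N i) t (r i) S, ∀ f : q.Answer → ℝ≥0∞,
          fac ^ q.cost * ∑' ω, I ω * (((withCliques V (N i) t (r i) S).card : ℝ≥0∞) /
            (withCliques V (N i) t (r i) (st ω)).card) *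
            (if π ∈ withCliques V (N i) t (r i) (st ω) then f (ans ω) else 0) ≤
          ∑' a, respond π.toGraph κ q a * f a := by
  classical
  obtain ⟨hκ, hS, hne⟩ := hinv
  by_cases hqe : q = .randEdge
  · subst hqe
    simp only [Query.cost] at hq ⊢
    set F := (V \ S.biUnion id).powersetCard t with hF
    have hWC : ∀ i, ∀ C ∈ F, (withCliques V (N i) t (r i) (insert C S)).card ≠ 0 := by
      intro i C hC h0
      have := card_withCliques_insert (N := N i) (r := r i) (by omega : 1 ≤ t) S hC
      rw [h0, zero_mul, eq_comm, mul_eq_zero] at this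
      have := hne i; have := hbN i
      omega
    have hFne : F.Nonempty := by
      have := sum_card_withCliques_insert (V := V) (N := N true) (r := r true) (by omega : 1 ≤ t) S
      by_contra h
      rw [← hF, Finset.not_nonempty_iff_eq_empty.1 h, Finset.sum_empty, eq_comm,
        mul_eq_zero] at this
      have := hne true; have := hbN true
      omega
    -- The sample space of the ideal answer depends only on `V`, `S` and `t`, hence is the same for
    -- both families.
    let T : Finset (Σ _ : Finset ℕ, ℕ × ℕ) := F.sigma fun C => C.offDiag
    have hcardC : ∀ C ∈ F, C.card = t := fun C hC => (Finset.mem_powersetCard.1 hC).2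
    have hTcard : T.card = F.card * (t * (t - 1)) := by
      rw [Finset.card_sigma]
      refine Finset.sum_const_nat fun C hC => ?_
      rw [Finset.offDiag_card, hcardC C hC, Nat.mul_sub, mul_one]
    have htt : 0 < t * (t - 1) := Nat.mul_pos (by omega) (by omega)
    have hT : T.Nonempty := by
      rw [← Finset.card_pos, hTcard]
      exact Nat.mul_pos (Finset.card_pos.2 hFne) htt
    refine ⟨Σ _ : Finset ℕ, ℕ × ℕ, PMF.uniformOfFinset T hT, fun ω => s(ω.2.1, ω.2.2),
      fun ω => insert ω.1 S, ?_, ?_⟩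
    · rintro ⟨C, u, v⟩ hω
      rw [PMF.mem_support_uniformOfFinset_iff] at hω
      obtain ⟨hC, huv⟩ := Finset.mem_sigma.1 hω
      simp only at hC huv
      obtain ⟨hu, hv, -⟩ := Finset.mem_offDiag.1 huv
      refine ⟨⟨?_, ?_, fun i => hWC i C hC⟩, fun i => ⟨?_, hWC i C hC⟩⟩
      · simp only [learn, Finset.biUnion_insert, id]
        refine Finset.union_subset (hκ.trans Finset.subset_union_right) ?_
        intro x hx
        rw [Sym2.mem_toFinset, Sym2.mem_iff] at hx
        refine Finset.mem_union_left _ ?_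
        rcases hx with rfl | rfl <;> assumption
      · have := Finset.card_insert_le C S
        simp only
        omega
      · intro π hπ
        rw [mem_withCliques] at hπ ⊢
        exact fun D hD => hπ D (Finset.mem_insert_of_mem hD)
    · intro i π hπ f
      have hπ' := mem_withCliques.1 hπ
      rw [π.toGraph.tsum_respond_randEdge κ (π.card_edges_pos (hr i)) f,
        π.two_mul_card_edges (by have := hr i; omega)]
      set W := (withCliques V (N i) t (r i) S).card with hW
      have hNS : 0 < N i - S.card := by have := hbN i; omega
      -- The probability that a given candidate is a clique of a random compatible placement is the
      -- number of unrevealed cliques over the number of candidates.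
      have hratio : ∀ C ∈ F, (W : ℝ≥0∞) / (withCliques V (N i) t (r i) (insert C S)).card =
          F.card / (N i - S.card : ℕ) := by
        intro C hC
        rw [ENNReal.div_eq_div_iff (by exact_mod_cast hNS.ne') (ENNReal.natCast_ne_top _)
          (by exact_mod_cast hWC i C hC) (ENNReal.natCast_ne_top _)]
        have := card_withCliques_insert (N := N i) (r := r i) (by omega : 1 ≤ t) S hC
        rw [mul_comm ((N i - S.card : ℕ) : ℝ≥0∞)]
        exact_mod_cast this.symm
      set F' := F.filter fun C => ∃ j, C = π.block j with hF'
      calc _ = fac * ∑' ω, PMF.uniformOfFinset T hT ω *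
            (((W : ℝ≥0∞) / (withCliques V (N i) t (r i) (insert ω.1 S)).card) *
            (if π ∈ withCliques V (N i) t (r i) (insert ω.1 S) then f s(ω.2.1, ω.2.2) else 0)) := by
            simp only [pow_one, mul_assoc]
        _ = fac * ((T.card : ℝ≥0∞)⁻¹ * ∑ C ∈ F, ∑ p ∈ C.offDiag,
            (F.card / (N i - S.card : ℕ) : ℝ≥0∞) *
              (if ∃ j, C = π.block j then f s(p.1, p.2) else 0)) := by
            rw [PMF.tsum_uniformOfFinset_mul, Finset.sum_sigma]
            congr 2
            refine Finset.sum_congr rfl fun C hC => Finset.sum_congr rfl fun p _ => ?_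
            rw [hratio C hC]
            congr 1
            simp only [mem_withCliques, Finset.forall_mem_insert]
            refine if_congr ?_ rfl rfl
            exact ⟨fun h => h.1, fun h => ⟨h, hπ'⟩⟩
        _ = fac * ((T.card : ℝ≥0∞)⁻¹ * (F.card / (N i - S.card : ℕ) : ℝ≥0∞)) *
            ∑ C ∈ F', ∑ p ∈ C.offDiag, f s(p.1, p.2) := by
            simp only [← Finset.mul_sum]
            rw [mul_assoc, mul_assoc]
            congr 3
            rw [hF', Finset.sum_filter]
            refine Finset.sum_congr rfl fun C _ => ?_
            split_ifs <;> simp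
        -- After cancelling the number of candidates, each arc of an unrevealed clique of `π` has
        -- ideal mass 1/(t(t-1)(N - |S|)). Times `fac` this is at most its true mass, as at most
        -- `b₀` cliques are revealed.
        _ ≤ ((N i * (t * (t - 1)) + 2 * (r i - 1) : ℕ) : ℝ≥0∞)⁻¹ *
            ∑ p ∈ π.toGraph.arcs, f s(p.1, p.2) := by
            refine mul_le_mul' ?_ (sum_cliques_le_sum_arcs π F'
              (fun C hC => (Finset.mem_filter.1 hC).2) fun p => f s(p.1, p.2))
            have hFc : (F.card : ℝ≥0∞) ≠ 0 := by exact_mod_cast (Finset.card_pos.2 hFne).ne'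
            have h1 : (T.card : ℝ≥0∞)⁻¹ * (F.card / (N i - S.card : ℕ) : ℝ≥0∞) =
                ((t * (t - 1) * (N i - S.card) : ℕ) : ℝ≥0∞)⁻¹ := by
              rw [hTcard]
              push_cast [-Nat.cast_sub, -ENNReal.natCast_sub]
              rw [ENNReal.mul_inv (Or.inl hFc) (Or.inl (ENNReal.natCast_ne_top _)),
                div_eq_mul_inv, ENNReal.mul_inv (b := ((N i - S.card : ℕ) : ℝ≥0∞))
                (Or.inr (ENNReal.natCast_ne_top _)) (Or.inr (by exact_mod_cast hNS.ne'))]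
              rw [mul_mul_mul_comm, mul_comm _ (F.card : ℝ≥0∞), mul_mul_mul_comm, ← mul_assoc,
                mul_right_comm (F.card : ℝ≥0∞), ENNReal.mul_inv_cancel hFc (ENNReal.natCast_ne_top _), one_mul]
            rw [h1]
            have hpos : 0 < t * (t - 1) * (N i - S.card) := Nat.mul_pos htt hNS
            have hpos2 : 0 < N i * (t * (t - 1)) + 2 * (r i - 1) := by have := hr i; omega
            rw [← div_eq_mul_inv, ENNReal.div_le_iff (by exact_mod_cast hpos.ne')
              (ENNReal.natCast_ne_top _), mul_comm, ← div_eq_mul_inv,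
              ENNReal.le_div_iff_mul_le (Or.inl (by exact_mod_cast hpos2.ne'))
              (Or.inl (ENNReal.natCast_ne_top _))]
            refine (hfac i).trans ?_
            exact_mod_cast Nat.mul_le_mul_left _ (by omega)
  -- For the other queries the true law is already common to all compatible placements, so it serves
  -- as the ideal law and the state does not change.
  · have hsame : ∀ i, ∀ π ∈ withCliques V (N i) t (r i) S,
        respond π.toGraph κ q = respond (cliqueGraph S) κ q := fun i π hπ =>
      respond_congr (fun x hx y => adj_iff_cliqueGraph hπ (hκ hx) y) q hqe
    refine ⟨q.Answer, respond (cliqueGraph S) κ q, id, fun _ => S, ?_, ?_⟩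
    · intro a ha
      exact ⟨⟨learn_subset hκ subset_rfl q hqe a ha,
        by change S.card + (b - q.cost) ≤ b₀; omega, hne⟩, fun i => ⟨subset_rfl, hne i⟩⟩
    · intro i π hπ f
      rw [hsame i π hπ]
      refine (mul_le_of_le_one_left zero_le (pow_le_one₀ zero_le hfac1)).trans (le_of_eq ?_)
      refine tsum_congr fun a => ?_
      rw [if_pos hπ, ENNReal.div_self (by exact_mod_cast hne i) (ENNReal.natCast_ne_top _), mul_one]
      rfl

-- Before any query every placement is compatible, so the common law compares averages over the full
-- families.
open Placement in
theorem clique_family_bound {M : Set Query} {V : Finset ℕ} {t : ℕ} (ht : 2 ≤ t) {N r : Bool → ℕ}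
    (hr : ∀ i, 2 ≤ r i) (hV : ∀ i, V.card = N i * t + r i) (b : ℕ) (hbN : ∀ i, b < N i)
    (fac : ℝ≥0∞) (hfac1 : fac ≤ 1)
    (hfac : ∀ i, fac * ((N i * (t * (t - 1)) + 2 * (r i - 1) : ℕ) : ℝ≥0∞) ≤
      ((t * (t - 1) * (N i - b) : ℕ) : ℝ≥0∞))
    (A : Algorithm M) (good : Bool → Set ℝ) (hdisj : Disjoint (good true) (good false))
    (B : ℝ) (hB : B < b + 1)
    (hA : ∀ i, ∀ π : Placement V (N i) t (r i),
      2 / 3 ≤ A.successProb π.toGraph (fun r => r ∈ good i) B) :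
    fac ^ b ≤ 2 / 3 := by
  classical
  have : ∀ i, Nonempty (Placement V (N i) t (r i)) := by
    intro i
    refine ⟨Fintype.equivOfCardEq ?_⟩
    simp [hV i]
  have hall : ∀ i, withCliques V (N i) t (r i) ∅ = Finset.univ := by
    intro i
    ext π
    simp [mem_withCliques]
  have h := exists_common_law (M := M) (ι := Bool) (Idx := fun i => Placement V (N i) t (r i))
    (fun i π => π.toGraph) (State := Finset (Finset ℕ)) (fun i S => withCliques V (N i) t (r i) S)
    (fun i S => (withCliques V (N i) t (r i) S).card) fac 1
    (fun S κ b' => κ ⊆ S.biUnion id ∧ S.card + b' ≤ b ∧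
      ∀ i, (withCliques V (N i) t (r i) S).card ≠ 0)
    (fun S κ b' _ i => by rw [one_mul]) hfac1
    (fun S κ b' q _ hinv hq => clique_exposure_step ht hr b hbN fac hfac1 hfac S κ b' q hinv hq)
    A ∅ ∅ b ⟨by simp, by simp, fun i => by rw [hall, Finset.card_univ]; exact Fintype.card_ne_zero⟩
  have := survival_le_of_disjoint_goals (fun i (π : Placement V (N i) t (r i)) => π.toGraph)
    fac 1 b A (by simpa only [hall, Finset.card_univ] using h) good hdisj B hB hA
  simpa using this

/-! ### Choice of parameters for the n^(1/3) lower bound. -/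

/-- The average degree of `N` cliques of size `t` and a star with `r` vertices. -/
noncomputable def familyDegree (n N t r : ℕ) : ℝ := (N * (t * (t - 1)) + 2 * (r - 1) : ℕ) / (n : ℝ)

/-- The star adds less than 2 to the average degree, which is negligible against the cliques of the
denser graph; the clique parts differ by a factor of at least 4c². Together c² times the smaller
degree stays below 3/4 of the larger. -/
theorem disjoint_factorApprox_familyDegree {c : ℝ} (hc : 1 ≤ c) {n N N' t r r' K : ℕ} (hn : 0 < n)
    (hK : 4 * c ^ 2 ≤ K) (hN : N' * K ≤ N) (hr' : r' ≤ n)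
    (hbig : 4 * c ^ 2 * n ≤ (N * (t * (t - 1)) : ℕ)) :
    Disjoint {x | IsFactorApprox c (familyDegree n N t r) x}
      {x | IsFactorApprox c (familyDegree n N' t r') x} := by
  rw [Set.disjoint_left]
  rintro x ⟨h1, -⟩ ⟨-, h2⟩
  have hn' : (0 : ℝ) < n := by exact_mod_cast hn
  have hc0 : 0 < c := by linarith
  have hlt : c * familyDegree n N' t r' < familyDegree n N t r / c := by
    rw [lt_div_iff₀ hc0, familyDegree, familyDegree]
    rw [mul_div_assoc', div_mul_eq_mul_div]
    apply div_lt_div_of_pos_right _ hn'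
    set Y := t * (t - 1) with hY
    have e1 : (((N' * Y + 2 * (r' - 1) : ℕ)) : ℝ) ≤ N' * Y + 2 * n := by
      have : N' * Y + 2 * (r' - 1) ≤ N' * Y + 2 * n := by omega
      exact_mod_cast this
    have e2 : ((N * Y : ℕ) : ℝ) ≤ (N * Y + 2 * (r - 1) : ℕ) := by
      exact_mod_cast Nat.le_add_right _ _
    have e3 : ((N' * K * Y : ℕ) : ℝ) ≤ (N * Y : ℕ) := by
      exact_mod_cast Nat.mul_le_mul_right _ hN
    push_cast at e3 hbig e2 ⊢
    have e4 : 4 * c ^ 2 * (N' * Y) ≤ K * (N' * Y : ℝ) :=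
      mul_le_mul_of_nonneg_right hK (by positivity)
    have hc2 : 0 < c ^ 2 := by positivity
    push_cast at e1
    calc c * _ * c ≤ c * ((N' : ℝ) * Y + 2 * n) * c := by gcongr
      _ = (4 * c ^ 2 * (N' * Y)) / 4 + (4 * c ^ 2 * n) / 2 := by ring
      _ ≤ N * Y / 4 + N * Y / 2 := by
          have : (K : ℝ) * (N' * Y) ≤ N * Y := by linarith
          linarith
      _ < _ := by
          have : 0 < 4 * c ^ 2 * (n : ℝ) := by positivity
          linarith
  linarith

/-- Bernoulli's inequality. -/
theorem two_thirds_lt_ofReal_pow {δ : ℝ} {b : ℕ} (h1 : b * δ < 1 / 3) :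
    2 / 3 < ENNReal.ofReal (1 - δ) ^ b := by
  rcases Nat.eq_zero_or_pos b with rfl | hb
  · rw [pow_zero, ENNReal.div_lt_iff (by simp) (by simp)]
    norm_num
  · have hb' : (1 : ℝ) ≤ b := by exact_mod_cast hb
    have hδ : δ < 1 / 3 := by nlinarith
    have h2 := one_add_mul_le_pow (a := -δ) (by linarith) b
    rw [← ENNReal.ofReal_pow (by linarith),
      show (2 : ℝ≥0∞) / 3 = ENNReal.ofReal (2 / 3) by
        rw [ENNReal.ofReal_div_of_pos (by norm_num)]; norm_num]
    refine (ENNReal.ofReal_lt_ofReal_iff_of_nonneg (by norm_num)).2 ?_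
    rw [← sub_eq_add_neg] at h2
    linarith

/-- Here `X` counts the arcs inside cliques, `Y` those of the star, and `L` those spoiled by earlier
answers. -/
theorem ofReal_mul_le_of_loss {δ : ℝ} (h0 : 0 ≤ δ) (h1 : δ ≤ 1) {X Y L : ℕ} (hL : L ≤ X)
    (h : (L : ℝ) + Y ≤ δ * X) : ENNReal.ofReal (1 - δ) * ((X + Y : ℕ) : ℝ≥0∞) ≤ ((X - L : ℕ) : ℝ≥0∞) := by
  rw [← ENNReal.ofReal_natCast (X + Y), ← ENNReal.ofReal_natCast (X - L),
    ← ENNReal.ofReal_mul (by linarith)]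
  apply ENNReal.ofReal_le_ofReal
  rw [Nat.cast_sub hL]
  push_cast
  have : 0 ≤ δ * Y := by positivity
  nlinarith

/-- The two losses are the `b` revealed cliques and the star. Since N·t is at least n/(2K) and t is
about x, each is a fraction O(K/x) of the arcs inside the cliques; `T` stands for t - 1. -/
theorem exposure_loss_le {K x t T N b n : ℝ} (hx : 0 < x) (hK : 1 ≤ K) (hb : 100 * K * b ≤ x)
    (hb0 : 0 ≤ b) (hN : 0 ≤ N) (hnx : n = x * x * x) (hn : n ≤ 2 * (K * (t * N))) (ht0 : 0 ≤ t)
    (ht : t ≤ 2 * x) (hT : x / 2 ≤ T) : t * T * b + 2 * n ≤ 20 * K / x * (N * (t * T)) := by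
  rw [div_mul_eq_mul_div, le_div_iff₀ hx]
  have hT0 : 0 < T := by linarith
  set P := K * (t * N) with hP
  have hP0 : 0 ≤ P := by positivity
  have h1 : 100 * b ≤ x := by nlinarith
  have h2 : t * b * 100 * x ≤ 4 * P := by
    have e1 : t * (100 * b) ≤ 2 * x * x := mul_le_mul ht h1 (by positivity) (by positivity)
    have e2 := mul_le_mul_of_nonneg_right e1 hx.le
    linarith
  have h3 : t * b * 100 * x * T ≤ 4 * P * T := mul_le_mul_of_nonneg_right h2 hT0.le
  have h4 : P * (x / 2) ≤ P * T := mul_le_mul_of_nonneg_left hT hP0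
  have h5 : n * x ≤ 2 * P * x := mul_le_mul_of_nonneg_right hn hx.le
  have h6 : 20 * K * (N * (t * T)) = 20 * (P * T) := by rw [hP]; ring
  have h7 : 0 ≤ P * T := by positivity
  rw [h6]
  linarith

/-- With cliques of size t a star edge appears after about t draws and a repeated clique after about
√(n/t) draws. The size n^(1/3) balances the two. -/
theorem fullNbr_lower_bound (c : ℝ) (hc : 1 ≤ c) : ∃ (c₀ : ℝ) (N : ℕ), 0 < c₀ ∧
    ∀ (n : ℕ), N ≤ n → ∀ V : Finset ℕ, V.card = n →
      ∀ (A : Algorithm fullNbrModel) (B : ℝ),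
        (∀ G : NetGraph, G.verts = V → G.NoIsolated →
          2 / 3 ≤ A.successProb G (IsFactorApprox c G.avgDegree) B) →
        c₀ * (n : ℝ) ^ (1 / 3 : ℝ) ≤ B := by
  obtain ⟨K, hK⟩ := exists_nat_ge (4 * c ^ 2)
  have hK4 : (4 : ℝ) ≤ K := by nlinarith
  have hK4' : 4 ≤ K := by exact_mod_cast hK4
  refine ⟨1 / (100 * K), (100 * K) ^ 3, by positivity, ?_⟩
  intro n hn V hV A B hA
  by_contra hlt
  push Not at hlt
  set x : ℝ := (n : ℝ) ^ (1 / 3 : ℝ) with hx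
  have hx0 : 0 ≤ x := by positivity
  have hx3 : x ^ 3 = n := by
    rw [hx, ← Real.rpow_natCast, ← Real.rpow_mul (by positivity)]; norm_num
  have hxK : 100 * (K : ℝ) ≤ x := by
    have : ((100 * (K : ℝ)) ^ 3) ≤ x ^ 3 := by rw [hx3]; exact_mod_cast hn
    exact le_of_pow_le_pow_left₀ (by norm_num) hx0 this
  -- The balancing size of the cliques.
  set t := ⌈x⌉₊ with ht
  have htx : x ≤ t := Nat.le_ceil x
  have htx' : (t : ℝ) < x + 1 := Nat.ceil_lt_add_one hx0
  have ht1 : 400 ≤ t := by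
    have : (400 : ℝ) ≤ t := by linarith
    exact_mod_cast this
  have hn2 : 2 ≤ n := (by norm_num : 2 ≤ 2 ^ 3).trans
    ((Nat.pow_le_pow_left (by omega : 2 ≤ 100 * K) 3).trans hn)
  -- Costs are integers, so cost at most `B` means cost at most `b`.
  set b := ⌊B⌋₊ with hb
  have hBb : B < b + 1 := Nat.lt_floor_add_one B
  have hbx : (b : ℝ) ≤ x / (100 * K) := by
    rcases le_or_gt 0 B with h | h
    · refine (Nat.floor_le h).trans (hlt.le.trans (le_of_eq ?_)); ring
    · rw [hb, Nat.floor_of_nonpos h.le]; push_cast; positivity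
  -- At least two vertices are left for the star, so that none is isolated. The sparser family has
  -- fewer cliques by a factor of at least K ≥ 4c².
  set N₁ := (n - 2) / t with hN₁
  set N₂ := N₁ / K with hN₂
  have hN₁a : t * N₁ ≤ n - 2 := Nat.mul_div_le _ _
  have hN₁b : n - 2 < t * N₁ + t := by
    have := Nat.lt_mul_div_succ (n - 2) (show 0 < t by omega)
    rw [mul_add, mul_one] at this; exact this
  have hN₂a : K * N₂ ≤ N₁ := Nat.mul_div_le _ _
  have hN₂b : N₁ < K * N₂ + K := by
    have := Nat.lt_mul_div_succ N₁ (show 0 < K by omega)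
    rw [mul_add, mul_one] at this; exact this
  have hN₂₁ : N₂ ≤ N₁ := Nat.div_le_self _ _
  have hsmall : (K + 2 : ℝ) * t + 2 ≤ n / 2 := by
    rw [← hx3]
    have h1 : (K + 2 : ℝ) * t + 2 ≤ (K + 2) * (2 * x) + 2 * x := by
      have : (t : ℝ) ≤ 2 * x := by linarith
      have := mul_le_mul_of_nonneg_left this (show (0 : ℝ) ≤ K + 2 by positivity)
      linarith
    have h2 : (100 * (K : ℝ)) * x ≤ x * x := mul_le_mul_of_nonneg_right hxK hx0
    have h3 : 100 * (x * x) ≤ x * (x * x) :=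
      mul_le_mul_of_nonneg_right (by linarith) (by positivity)
    have h4 : 4 * x ≤ K * x := mul_le_mul_of_nonneg_right hK4 hx0
    have h5 : x ^ 3 = x * (x * x) := by ring
    rw [h5]
    linarith
  have hsmall' : 2 * ((K + 2) * t + 2) ≤ n := by
    have : ((2 * ((K + 2) * t + 2) : ℕ) : ℝ) ≤ n := by push_cast; linarith
    exact_mod_cast this
  have hKN₂ : n ≤ 2 * (K * (t * N₂)) := by
    have : t * N₁ + t ≤ t * (K * N₂ + K) := by
      rw [← Nat.mul_succ]; exact Nat.mul_le_mul_left _ hN₂b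
    have e : t * (K * N₂ + K) = K * (t * N₂) + K * t := by ring
    have e2 : (K + 2) * t = K * t + 2 * t := by ring
    rw [e] at this
    omega
  have hKN₂' : (n : ℝ) ≤ 2 * (K * (t * N₂)) := by exact_mod_cast hKN₂
  have hnx : (n : ℝ) = x * x * x := by rw [← hx3]; ring
  have hxx : 100 * (K : ℝ) * x ≤ x * x := mul_le_mul_of_nonneg_right hxK hx0
  have hbK : 100 * K * (b : ℝ) ≤ x := by
    rw [le_div_iff₀ (by positivity)] at hbx; linarith
  set δ : ℝ := 20 * K / x with hδ
  have hxpos : 0 < x := by linarith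
  have hKpos : (0 : ℝ) < K := by linarith
  have hbN₂ : b < N₂ := by
    by_contra h
    push Not at h
    have h' : (N₂ : ℝ) ≤ b := by exact_mod_cast h
    have h1 : (t : ℝ) * N₂ ≤ (2 * x) * b := by
      apply mul_le_mul (by linarith) h' (by positivity) (by positivity)
    have h2 : (K : ℝ) * (t * N₂) ≤ K * (2 * x * b) := mul_le_mul_of_nonneg_left h1 hKpos.le
    have h3 : x * x * x ≤ 4 * x * (K * b) := by rw [← hnx]; linarith
    have h4 : x * (100 * K * b) ≤ x * x := mul_le_mul_of_nonneg_left hbK hxpos.le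
    have h5 : 400 * (x * x) ≤ x * (x * x) :=
      mul_le_mul_of_nonneg_right (by linarith) (by positivity)
    have h6 : 0 < x * x := by positivity
    linarith
  have hloss : ∀ N' r' : ℕ, N₂ ≤ N' → r' ≤ n →
      ((t * (t - 1) * b : ℕ) : ℝ) + (2 * (r' - 1) : ℕ) ≤ δ * (N' * (t * (t - 1)) : ℕ) := by
    intro N' r' hN' hr'
    have ht2 : (x : ℝ) / 2 ≤ ((t - 1 : ℕ) : ℝ) := by
      rw [Nat.cast_sub (by omega)]; push_cast; linarith
    have e1 : ((2 * (r' - 1) : ℕ) : ℝ) ≤ 2 * n := by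
      have : 2 * (r' - 1) ≤ 2 * n := by omega
      exact_mod_cast this
    have e2 : (N₂ : ℝ) ≤ N' := by exact_mod_cast hN'
    set T : ℝ := ((t - 1 : ℕ) : ℝ) with hT
    have hTpos : 0 < T := by linarith
    have e3 := exposure_loss_le hxpos (by linarith) hbK (Nat.cast_nonneg b) (Nat.cast_nonneg N₂) hnx
      hKN₂' (Nat.cast_nonneg t) (by linarith) ht2
    have e4 : 20 * K / x * ((N₂ : ℝ) * (t * T)) ≤ 20 * K / x * (N' * (t * T)) := by gcongr
    have e5 : ((t * (t - 1) * b : ℕ) : ℝ) = t * T * b := by push_cast [-Nat.cast_sub]; rfl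
    have e6 : ((N' * (t * (t - 1)) : ℕ) : ℝ) = N' * (t * T) := by push_cast [-Nat.cast_sub]; rfl
    rw [e5, e6, hδ]
    linarith
  have hδ1 : δ ≤ 1 := by rw [hδ, div_le_one hxpos]; linarith
  have hδ0 : 0 ≤ δ := by positivity
  let N : Bool → ℕ := fun i => cond i N₁ N₂
  let r : Bool → ℕ := fun i => n - N i * t
  have hNi : ∀ i, N₂ ≤ N i ∧ N i ≤ N₁ := by
    rintro (_ | _)
    · exact ⟨le_rfl, hN₂₁⟩
    · exact ⟨hN₂₁, le_rfl⟩
  have hNt : ∀ i, N i * t ≤ n - 2 := fun i => by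
    refine le_trans ?_ hN₁a
    rw [mul_comm]
    exact Nat.mul_le_mul_left _ (hNi i).2
  have hr : ∀ i, 2 ≤ r i := fun i => by have := hNt i; simp only [r]; omega
  have key := clique_family_bound (t := t) (N := N) (r := r) (V := V) (by omega) hr
    (fun i => by have := hNt i; simp only [r]; omega) b (fun i => hbN₂.trans_le (hNi i).1)
    (ENNReal.ofReal (1 - δ)) (ENNReal.ofReal_le_one.2 (by linarith))
    (fun i => by
      rw [Nat.mul_sub (t * (t - 1)) (N i) b, mul_comm (t * (t - 1)) (N i)]
      refine ofReal_mul_le_of_loss hδ0 hδ1 ?_ (hloss _ _ (hNi i).1 (Nat.sub_le _ _))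
      rw [mul_comm]
      exact Nat.mul_le_mul_right _ (hbN₂.le.trans (hNi i).1))
    A (fun i => {y | IsFactorApprox c (familyDegree n (N i) t (r i)) y})
    (disjoint_factorApprox_familyDegree hc (by omega) hK (by
      change N₂ * K ≤ N₁
      rw [mul_comm]; exact hN₂a) (Nat.sub_le _ _) (by
      change 4 * c ^ 2 * n ≤ (N₁ * (t * (t - 1)) : ℕ)
      have h0 : t ≤ (K + 2) * t := Nat.le_mul_of_pos_left _ (by omega)
      have h1 : n ≤ 2 * (t * N₁) := by omega
      have h1' : (n : ℝ) ≤ 2 * (t * N₁) := by exact_mod_cast h1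
      have ht2 : (x : ℝ) / 2 ≤ ((t - 1 : ℕ) : ℝ) := by
        rw [Nat.cast_sub (by omega)]; push_cast; linarith
      push_cast [-Nat.cast_sub]
      have h2 : 4 * c ^ 2 * n ≤ K * (2 * (t * N₁)) :=
        mul_le_mul hK h1' (by positivity) (by positivity)
      have h3 : (2 * K : ℝ) ≤ ((t - 1 : ℕ) : ℝ) := by linarith
      have h4 := mul_le_mul_of_nonneg_right h3 (show (0 : ℝ) ≤ t * N₁ by positivity)
      linarith))
    B hBb
    (fun i π => by
      have h1 := hA π.toGraph rfl (π.noIsolated (by omega) (hr i))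
      rw [π.avgDegree_eq (by have := hr i; omega), hV] at h1
      exact h1)
  -- The total loss is b·20K/x ≤ 1/5, because 100Kb ≤ x.
  refine absurd key (not_le.2 (two_thirds_lt_ofReal_pow ?_))
  rw [hδ, mul_div_assoc', div_lt_iff₀ hxpos]
  linarith

/-! ### Counting placements that agree with partial knowledge of the cliques. -/

namespace Placement

variable {V : Finset ℕ} {N t r : ℕ}

open Classical in
/-- The placements for which all vertices of `K` are in cliques, equally labelled vertices of `K` in
the same one, and the two vertices of each pair in `P` in different ones. -/
noncomputable def consistent (V : Finset ℕ) (N t r : ℕ) (K : Finset ℕ) (l : ℕ → ℕ)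
    (P : Finset (ℕ × ℕ)) : Finset (Placement V N t r) :=
  Finset.univ.filter fun π => (∀ x ∈ K, π.clique x ≠ none) ∧
    (∀ x ∈ K, ∀ y ∈ K, l x = l y → π.clique x = π.clique y) ∧
    ∀ p ∈ P, π.clique p.1 ≠ π.clique p.2

variable {K : Finset ℕ} {l : ℕ → ℕ} {P : Finset (ℕ × ℕ)}

theorem mem_consistent {π : Placement V N t r} :
    π ∈ consistent V N t r K l P ↔ (∀ x ∈ K, π.clique x ≠ none) ∧
      (∀ x ∈ K, ∀ y ∈ K, l x = l y → π.clique x = π.clique y) ∧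
      ∀ p ∈ P, π.clique p.1 ≠ π.clique p.2 := by
  simp [consistent]

/-- Learning a new neighbour of `x` amounts to giving it the label of `x`; the old labels are
unaffected because `y` was unknown. -/
theorem mem_consistent_neighbour {π : Placement V N t r} {x y : ℕ} (hx : x ∈ K) (hy : y ∉ K) :
    π ∈ consistent V N t r (K ∪ {y}) (Function.update l y (l x)) P ↔
      π ∈ consistent V N t r K l P ∧ π.clique y = π.clique x := by
  have hne : ∀ z ∈ K, z ≠ y := fun z hz h => hy (h ▸ hz)
  have hl : ∀ z ∈ K, Function.update l y (l x) z = l z := fun z hz =>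
    Function.update_of_ne (hne z hz) _ _
  have hly : Function.update l y (l x) y = l x := Function.update_self _ _ _
  rw [mem_consistent, mem_consistent]
  constructor
  · rintro ⟨h1, h2, h3⟩
    refine ⟨⟨fun z hz => h1 z (Finset.mem_union_left _ hz), fun z hz w hw h => ?_, h3⟩, ?_⟩
    · exact h2 z (Finset.mem_union_left _ hz) w (Finset.mem_union_left _ hw)
        (by rw [hl z hz, hl w hw, h])
    · exact h2 y (by simp) x (Finset.mem_union_left _ hx) (by rw [hly, hl x hx])
  · rintro ⟨⟨h1, h2, h3⟩, h4⟩
    refine ⟨fun z hz => ?_, fun z hz w hw h => ?_, h3⟩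
    · rcases Finset.mem_union.1 hz with hz | hz
      · exact h1 z hz
      · rw [Finset.mem_singleton.1 hz, h4]; exact h1 x hx
    · rcases Finset.mem_union.1 hz with hz | hz <;> rcases Finset.mem_union.1 hw with hw | hw
      · rw [hl z hz, hl w hw] at h
        exact h2 z hz w hw h
      · rw [Finset.mem_singleton.1 hw] at h ⊢
        rw [hl z hz, hly] at h
        rw [h4]
        exact h2 z hz x hx h
      · rw [Finset.mem_singleton.1 hz] at h ⊢
        rw [hl w hw, hly] at h
        rw [h4]
        exact h2 x hx w hw h
      · rw [Finset.mem_singleton.1 hz, Finset.mem_singleton.1 hw]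

/-- A new edge between unknown vertices opens a new group labelled by `u`. This label is fresh since
all old labels are vertices of `K`. The vertex `v` then joins as a neighbour of `u`. -/
theorem mem_consistent_edge {π : Placement V N t r} {u v : ℕ} (hl : ∀ z ∈ K, l z ∈ K)
    (hu : u ∉ K) (hv : v ∉ K) (huv : u ≠ v) :
    π ∈ consistent V N t r (K ∪ {u, v}) (Function.update (Function.update l u u) v u) P ↔
      π ∈ consistent V N t r K l P ∧ π.clique u = π.clique v ∧ π.clique u ≠ none := by
  have h0 : π ∈ consistent V N t r (K ∪ {u}) (Function.update l u u) P ↔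
      π ∈ consistent V N t r K l P ∧ π.clique u ≠ none := by
    have hne : ∀ z ∈ K, z ≠ u := fun z hz h => hu (h ▸ hz)
    have hl' : ∀ z ∈ K, Function.update l u u z = l z := fun z hz =>
      Function.update_of_ne (hne z hz) _ _
    have hlu : Function.update l u u u = u := Function.update_self _ _ _
    rw [mem_consistent, mem_consistent]
    constructor
    · rintro ⟨h1, h2, h3⟩
      refine ⟨⟨fun z hz => h1 z (Finset.mem_union_left _ hz), fun z hz w hw h => ?_, h3⟩,
        h1 u (by simp)⟩
      exact h2 z (Finset.mem_union_left _ hz) w (Finset.mem_union_left _ hw)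
        (by rw [hl' z hz, hl' w hw, h])
    · rintro ⟨⟨h1, h2, h3⟩, h4⟩
      refine ⟨fun z hz => ?_, fun z hz w hw h => ?_, h3⟩
      · rcases Finset.mem_union.1 hz with hz | hz
        · exact h1 z hz
        · rw [Finset.mem_singleton.1 hz]; exact h4
      · rcases Finset.mem_union.1 hz with hz | hz <;> rcases Finset.mem_union.1 hw with hw | hw
        · rw [hl' z hz, hl' w hw] at h
          exact h2 z hz w hw h
        · rw [Finset.mem_singleton.1 hw, hl' z hz, hlu] at h
          exact absurd (h ▸ hl z hz) hu
        · rw [Finset.mem_singleton.1 hz, hl' w hw, hlu] at h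
          exact absurd (h.symm ▸ hl w hw) hu
        · rw [Finset.mem_singleton.1 hz, Finset.mem_singleton.1 hw]
  have h1 : K ∪ {u, v} = (K ∪ {u}) ∪ {v} := by
    rw [Finset.union_assoc]; rfl
  have h2 := mem_consistent_neighbour (π := π) (l := Function.update l u u) (P := P)
    (show u ∈ K ∪ {u} by simp) (show v ∉ K ∪ {u} by simp [hv, huv.symm])
  rw [Function.update_self] at h2
  rw [h1, h2, h0, and_assoc]
  constructor
  · rintro ⟨a, b, c⟩
    exact ⟨a, c.symm, b⟩
  · rintro ⟨a, b, c⟩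
    exact ⟨a, c, b.symm⟩

theorem consistent_subset_of_subset {P' : Finset (ℕ × ℕ)} (h : P ⊆ P') :
    consistent V N t r K l P' ⊆ consistent V N t r K l P := by
  intro π
  rw [mem_consistent, mem_consistent]
  exact fun ⟨h1, h2, h3⟩ => ⟨h1, h2, fun p hp => h3 p (h hp)⟩

theorem trans_mem_consistent {τ : Equiv.Perm ↥V} (hK : K ⊆ V)
    (hτ : ∀ u : ↥V, (u : ℕ) ∈ K → τ u = u) {π : Placement V N t r}
    (hπ : π ∈ consistent V N t r K l ∅) :
    (τ.trans π : Placement V N t r) ∈ consistent V N t r K l ∅ := by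
  have h : ∀ x ∈ K, Placement.clique (τ.trans π : Placement V N t r) x = π.clique x := by
    intro x hx
    have := clique_trans π τ ⟨x, hK hx⟩
    rw [hτ ⟨x, hK hx⟩ hx] at this
    exact this
  rw [mem_consistent] at hπ ⊢
  refine ⟨fun x hx => by rw [h x hx]; exact hπ.1 x hx, fun x hx y hy hxy => ?_, by simp⟩
  rw [h x hx, h y hy]
  exact hπ.2.1 x hx y hy hxy

theorem trans_injective (τ : Equiv.Perm ↥V) :
    Function.Injective fun π : Placement V N t r => (τ.trans π : Placement V N t r) := by
  intro π π' h
  ext1 u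
  have := congrArg (fun e => e (τ.symm u)) h
  simpa using this

/-- Unknown vertices are interchangeable: swapping the names `y` and `y'` is an injection that
preserves all knowledge about `K`. -/
theorem card_consistent_neighbour_le {x y y' : ℕ} (hK : K ⊆ V) (hx : x ∈ K) (hy : y ∈ V \ K)
    (hy' : y' ∈ V \ K) :
    (consistent V N t r (K ∪ {y'}) (Function.update l y' (l x)) ∅).card ≤
      (consistent V N t r (K ∪ {y}) (Function.update l y (l x)) ∅).card := by
  obtain ⟨hyV, hyK⟩ := Finset.mem_sdiff.1 hy
  obtain ⟨hyV', hyK'⟩ := Finset.mem_sdiff.1 hy'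
  let τ : Equiv.Perm ↥V := Equiv.swap ⟨y, hyV⟩ ⟨y', hyV'⟩
  have hτ : ∀ u : ↥V, (u : ℕ) ∈ K → τ u = u := fun u hu =>
    Equiv.swap_apply_of_ne_of_ne (fun h => hyK (by rw [h] at hu; exact hu))
      (fun h => hyK' (by rw [h] at hu; exact hu))
  refine Finset.card_le_card_of_injOn (fun π => τ.trans π) ?_ (trans_injective τ).injOn
  intro π hπ
  simp only [Finset.mem_coe] at hπ ⊢
  rw [mem_consistent_neighbour hx hyK'] at hπ
  rw [mem_consistent_neighbour hx hyK]
  refine ⟨trans_mem_consistent hK hτ hπ.1, ?_⟩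
  have h1 := clique_trans π τ ⟨x, hK hx⟩
  have h2 := clique_trans π τ ⟨y, hyV⟩
  rw [hτ ⟨x, hK hx⟩ hx] at h1
  simp only [τ, Equiv.swap_apply_left] at h1 h2
  rw [h1, h2]
  exact hπ.2

/-- Again a renaming that fixes `K`. The pairs may overlap, so the image of `v` under the swap of
`u` and `u'` is tracked and then moved to `v'` by a second swap. -/
theorem card_consistent_edge_le {u v u' v' : ℕ} (hK : K ⊆ V) (hl : ∀ z ∈ K, l z ∈ K)
    (h : (u, v) ∈ (V \ K).offDiag) (h' : (u', v') ∈ (V \ K).offDiag) :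
    (consistent V N t r (K ∪ {u', v'}) (Function.update (Function.update l u' u') v' u') ∅).card ≤
      (consistent V N t r (K ∪ {u, v}) (Function.update (Function.update l u u) v u) ∅).card := by
  obtain ⟨hu, hv, huv⟩ := Finset.mem_offDiag.1 h
  obtain ⟨hu', hv', huv'⟩ := Finset.mem_offDiag.1 h'
  obtain ⟨huV, huK⟩ := Finset.mem_sdiff.1 hu
  obtain ⟨hvV, hvK⟩ := Finset.mem_sdiff.1 hv
  obtain ⟨huV', huK'⟩ := Finset.mem_sdiff.1 hu'
  obtain ⟨hvV', hvK'⟩ := Finset.mem_sdiff.1 hv'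
  simp only at *
  let U : ↥V := ⟨u, huV⟩
  let W : ↥V := ⟨v, hvV⟩
  let U' : ↥V := ⟨u', huV'⟩
  let W' : ↥V := ⟨v', hvV'⟩
  let τ₁ : Equiv.Perm ↥V := Equiv.swap U U'
  let W₁ : ↥V := τ₁ W
  let τ : Equiv.Perm ↥V := τ₁.trans (Equiv.swap W₁ W')
  have hUW : U ≠ W := fun h => huv (congrArg Subtype.val h)
  have hUW' : U' ≠ W' := fun h => huv' (congrArg Subtype.val h)
  have hτ₁ : ∀ z : ↥V, (z : ℕ) ∈ K → τ₁ z = z := fun z hz =>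
    Equiv.swap_apply_of_ne_of_ne (fun h => huK (by rw [h] at hz; exact hz))
      (fun h => huK' (by rw [h] at hz; exact hz))
  have hW₁ : (W₁ : ℕ) ∉ K := by
    intro hK
    have h1 := hτ₁ W₁ hK
    have h2 : W₁ = W := τ₁.injective h1
    rw [h2] at hK
    exact hvK hK
  have hτ : ∀ z : ↥V, (z : ℕ) ∈ K → τ z = z := by
    intro z hz
    simp only [τ, Equiv.trans_apply]
    rw [hτ₁ z hz]
    exact Equiv.swap_apply_of_ne_of_ne (fun h => hW₁ (h ▸ hz))
      (fun h => hvK' (by rw [h] at hz; exact hz))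
  have hτu : τ U = U' := by
    simp only [τ, Equiv.trans_apply]
    have : τ₁ U = U' := Equiv.swap_apply_left _ _
    rw [this]
    refine Equiv.swap_apply_of_ne_of_ne (fun h => hUW ?_) hUW'
    apply τ₁.injective
    rw [this, h]
  have hτv : τ W = W' := by
    simp only [τ, Equiv.trans_apply]
    exact Equiv.swap_apply_left _ _
  refine Finset.card_le_card_of_injOn (fun π => τ.trans π) ?_ (trans_injective τ).injOn
  intro π hπ
  simp only [Finset.mem_coe] at hπ ⊢
  rw [mem_consistent_edge hl huK' hvK' huv'] at hπ
  rw [mem_consistent_edge hl huK hvK huv]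
  refine ⟨trans_mem_consistent hK hτ hπ.1, ?_⟩
  have h1 := clique_trans π τ U
  have h2 := clique_trans π τ W
  rw [hτu] at h1
  rw [hτv] at h2
  simp only [U, W, U', W'] at h1 h2
  rw [h1, h2]
  exact hπ.2

/-- The permutation of the places that exchanges the members of the cliques `i` and `j` at the
offsets in `O`. -/
def exchange (O : Finset (Fin t)) (i j : Fin N) : Equiv.Perm (Slot N t r) :=
  Function.Involutive.toPerm
    (fun p => match p with
      | .inl (k, a) => if a ∈ O then .inl (Equiv.swap i j k, a) else .inl (k, a)
      | .inr b => .inr b)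
    (by
      rintro (⟨k, a⟩ | b)
      · by_cases h : a ∈ O <;> simp [h]
      · rfl)

theorem exchange_inl_of_mem {O : Finset (Fin t)} {i j k : Fin N} {a : Fin t} (h : a ∈ O) :
    (exchange O i j : Equiv.Perm (Slot N t r)) (.inl (k, a)) = .inl (Equiv.swap i j k, a) :=
  if_pos h

theorem exchange_inl_of_notMem {O : Finset (Fin t)} {i j k : Fin N} {a : Fin t} (h : a ∉ O) :
    (exchange O i j : Equiv.Perm (Slot N t r)) (.inl (k, a)) = .inl (k, a) :=
  if_neg h

theorem exchange_symm (O : Finset (Fin t)) (i j : Fin N) :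
    (exchange O i j : Equiv.Perm (Slot N t r)).symm = exchange O i j := rfl

open Classical in
/-- The offsets in the clique `i` of the vertices of `K` with label `m`. -/
noncomputable def offsets (π : Placement V N t r) (K : Finset ℕ) (l : ℕ → ℕ) (m : ℕ) (i : Fin N) :
    Finset (Fin t) :=
  Finset.univ.filter fun a =>
    (π.symm (.inl (i, a)) : ℕ) ∈ K ∧ l (π.symm (.inl (i, a)) : ℕ) = m

theorem mem_offsets {π : Placement V N t r} {m : ℕ} {i : Fin N} {a : Fin t} :
    a ∈ π.offsets K l m i ↔
      (π.symm (.inl (i, a)) : ℕ) ∈ K ∧ l (π.symm (.inl (i, a)) : ℕ) = m := by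
  simp [offsets]

/-- Moving the group labelled `m` from the clique `i` to the clique `j`. -/
noncomputable def move (π : Placement V N t r) (K : Finset ℕ) (l : ℕ → ℕ) (m : ℕ) (i j : Fin N) :
    Placement V N t r :=
  π.trans (exchange (π.offsets K l m i) i j)

/-- At the exchanged offsets the clique `i` holds exactly the known vertices labelled `m`, and the
clique `j` holds no known vertex. Hence no other known vertex changes its clique. -/
theorem clique_move {π : Placement V N t r} {m : ℕ} {i j : Fin N}
    (hπ : π ∈ consistent V N t r K l ∅) (hi : ∀ z ∈ K, l z = m → π.clique z = some i)
    (hj : ∀ z ∈ K, π.clique z ≠ some j) {z : ℕ} (hz : z ∈ K) :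
    (π.move K l m i j).clique z = if l z = m then some j else π.clique z := by
  rw [mem_consistent] at hπ
  obtain ⟨k, hk⟩ := Option.ne_none_iff_exists'.1 (hπ.1 z hz)
  obtain ⟨a, hzV, ha⟩ := π.clique_eq_some.1 hk
  have hsymm : ∀ h : z ∈ V, π ⟨z, h⟩ = .inl (k, a) := fun _ => ha
  have hz' : (π.symm (.inl (k, a)) : ℕ) = z := by rw [← ha]; simp
  split_ifs with h
  · have hki : k = i := by
      have := hi z hz h
      rw [hk] at this
      exact Option.some.inj this
    subst hki
    have haO : a ∈ π.offsets K l m k := mem_offsets.2 (by rw [hz']; exact ⟨hz, h⟩)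
    rw [clique_eq_some]
    refine ⟨a, hzV, ?_⟩
    simp only [move, Equiv.trans_apply, ha]
    rw [exchange_inl_of_mem haO, Equiv.swap_apply_left]
  · rw [hk, clique_eq_some]
    refine ⟨a, hzV, ?_⟩
    simp only [move, Equiv.trans_apply, ha]
    by_cases haO : a ∈ π.offsets K l m i
    · rw [exchange_inl_of_mem haO, Equiv.swap_apply_of_ne_of_ne]
      · rintro rfl
        rw [mem_offsets, hz'] at haO
        exact h haO.2
      · rintro rfl
        exact hj z hz hk
    · rw [exchange_inl_of_notMem haO]

theorem move_mem_consistent {π : Placement V N t r} {m : ℕ} {i j : Fin N}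
    (hπ : π ∈ consistent V N t r K l ∅) (hi : ∀ z ∈ K, l z = m → π.clique z = some i)
    (hj : ∀ z ∈ K, π.clique z ≠ some j) : π.move K l m i j ∈ consistent V N t r K l ∅ := by
  have h := @clique_move V N t r K l π m i j hπ hi hj
  have hπ' := mem_consistent.1 hπ
  rw [mem_consistent]
  refine ⟨fun z hz => ?_, fun z hz w hw hzw => ?_, by simp⟩
  · rw [h hz]
    split_ifs
    · simp
    · exact hπ'.1 z hz
  · rw [h hz, h hw, hzw]
    split_ifs
    · rfl
    · exact hπ'.2.1 z hz w hw hzw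

/-- The moved group keeps its offsets, so the exchanged set can be read off from the result. This is
what makes the move invertible. -/
theorem offsets_move {π : Placement V N t r} {m : ℕ} {i j : Fin N}
    (hj : ∀ z ∈ K, π.clique z ≠ some j) :
    (π.move K l m i j).offsets K l m j = π.offsets K l m i := by
  ext a
  have hs : (π.move K l m i j).symm (.inl (j, a)) =
      π.symm (exchange (π.offsets K l m i) i j (.inl (j, a))) := by
    simp only [move, Equiv.symm_trans_apply]
    rw [exchange_symm]
  rw [mem_offsets, hs]
  by_cases ha : a ∈ π.offsets K l m i
  · rw [exchange_inl_of_mem ha, Equiv.swap_apply_right]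
    exact ⟨fun _ => ha, mem_offsets.1⟩
  · rw [exchange_inl_of_notMem ha]
    refine ⟨fun h => absurd (π.clique_symm j a) (hj _ h.1), fun h => absurd h ha⟩

open Classical in
/-- Vertices of different groups are rarely in the same clique. -/
theorem card_collision_mul_le {x y : ℕ} (hx : x ∈ K) (hy : y ∈ K) (hxy : l x ≠ l y) :
    ((consistent V N t r K l ∅).filter fun π => π.clique x = π.clique y).card * (N - K.card) ≤
      (consistent V N t r K l ∅).card := by
  set Bad := (consistent V N t r K l ∅).filter fun π => π.clique x = π.clique y with hBad
  -- The cliques without known vertices; there are at least N - |K| of them.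
  let free : Placement V N t r → Finset (Fin N) := fun π =>
    Finset.univ.filter fun j => ∀ z ∈ K, π.clique z ≠ some j
  have hfree : ∀ π, N - K.card ≤ (free π).card := by
    intro π
    have h1 : (Finset.univ : Finset (Fin N)) ⊆
        free π ∪ (K.image π.clique).eraseNone := by
      intro j _
      by_cases h : j ∈ free π
      · exact Finset.mem_union_left _ h
      · refine Finset.mem_union_right _ ?_
        simp only [free, Finset.mem_filter, Finset.mem_univ, true_and, not_forall, not_not] at h
        obtain ⟨z, hz, h⟩ := h
        rw [Finset.mem_eraseNone]
        exact Finset.mem_image.2 ⟨z, hz, h⟩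
    have h2 := (Finset.card_le_card h1).trans (Finset.card_union_le _ _)
    rw [Finset.card_univ, Fintype.card_fin] at h2
    have h3 : (K.image π.clique).eraseNone.card ≤ K.card :=
      (Finset.card_eraseNone_le _).trans Finset.card_image_le
    omega
  calc Bad.card * (N - K.card) ≤ ∑ π ∈ Bad, (free π).card := by
        rw [← smul_eq_mul, ← Finset.sum_const]
        exact Finset.sum_le_sum fun π _ => hfree π
    _ = (Bad.sigma free).card := (Finset.card_sigma _ _).symm
    _ ≤ _ := by
        have hmem : ∀ s ∈ Bad.sigma free, s.1 ∈ consistent V N t r K l ∅ ∧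
            (∃ i, s.1.clique x = some i ∧ s.1.clique y = some i ∧
              ∀ z ∈ K, l z = l y → s.1.clique z = some i) ∧
            ∀ z ∈ K, s.1.clique z ≠ some s.2 := by
          rintro ⟨π, j⟩ hs
          obtain ⟨h1, h2⟩ := Finset.mem_sigma.1 hs
          simp only [hBad, Finset.mem_filter, free, Finset.mem_univ, true_and] at h1 h2
          have hc := mem_consistent.1 h1.1
          obtain ⟨i, hi⟩ := Option.ne_none_iff_exists'.1 (hc.1 y hy)
          refine ⟨h1.1, ⟨i, h1.2.trans hi, hi, fun z hz hzy => ?_⟩, h2⟩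
          exact (hc.2.1 z hz y hy hzy).trans hi
        by_cases hN : Nonempty (Fin N)
        swap
        · have : (Bad.sigma free) = ∅ := by
            rw [Finset.eq_empty_iff_forall_notMem]
            exact fun s _ => hN ⟨s.2⟩
          rw [this]; exact Nat.zero_le _
        obtain ⟨i₀⟩ := hN
        -- From a placement where `x` and `y` collide, the group of `y` is moved to any free clique,
        -- and this is injective in both data. The default `i₀` is never used, since `y` lies in a
        -- clique.
        refine Finset.card_le_card_of_injOn
          (fun s => s.1.move K l (l y) ((s.1.clique y).getD i₀) s.2) ?_ ?_
        · intro s hs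
          obtain ⟨h1, ⟨i, hix, hiy, h2⟩, h3⟩ := hmem s hs
          simp only [hiy, Option.getD_some]
          exact move_mem_consistent h1 h2 h3
        · rintro ⟨π, j⟩ hs ⟨π', j'⟩ hs' heq
          obtain ⟨h1, ⟨i, hix, hiy, h2⟩, h3⟩ := hmem _ hs
          obtain ⟨h1', ⟨i', hix', hiy', h2'⟩, h3'⟩ := hmem _ hs'
          simp only at h1 hix hiy h2 h3 h1' hix' hiy' h2' h3'
          simp only [hiy, hiy', Option.getD_some] at heq
          -- The target clique is recovered as that of `y` after the move. The source is that of
          -- `x`, which stays because its label differs. Then the offsets, and hence the placement,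
          -- are determined.
          have hjj : j = j' := by
            have e := clique_move h1 h2 h3 hy
            have e' := clique_move h1' h2' h3' hy
            rw [if_pos rfl] at e e'
            rw [heq, e'] at e
            exact (Option.some.inj e).symm
          have hii : i = i' := by
            have e := clique_move h1 h2 h3 hx
            have e' := clique_move h1' h2' h3' hx
            rw [if_neg hxy] at e e'
            rw [heq, e', hix, hix'] at e
            exact (Option.some.inj e).symm
          subst hjj hii
          have hO : π.offsets K l (l y) i = π'.offsets K l (l y) i := by
            rw [← offsets_move h3, ← offsets_move h3', heq]
          have hππ : π = π' := by
            ext1 u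
            have := congrArg (fun e => e u) heq
            simp only [move, Equiv.trans_apply, hO] at this
            exact (exchange _ i j).injective this
          rw [hππ]

end Placement

namespace Placement

variable {V : Finset ℕ} {N t r : ℕ} {K : Finset ℕ} {l : ℕ → ℕ} {P : Finset (ℕ × ℕ)}

/-- The number of ordered pairs of unknown vertices in a common clique. -/
theorem le_card_fresh_pairs (π : Placement V N t r) :
    N * (t * (t - 1)) - 2 * K.card * (t - 1) ≤
      ((V \ K).offDiag.filter fun p => π.clique p.1 = π.clique p.2 ∧ π.clique p.1 ≠ none).card := by
  classical
  set T := (Finset.univ : Finset (Fin N)).biUnion fun i => (π.block i).offDiag with hT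
  have hTcard : T.card = N * (t * (t - 1)) := by
    rw [hT, Finset.card_biUnion]
    · rw [Finset.sum_const_nat (m := t * (t - 1)), Finset.card_univ, Fintype.card_fin]
      intro i _
      rw [Finset.offDiag_card, π.card_block, Nat.mul_sub, mul_one]
    · intro i _ j _ hij
      rw [Function.onFun, Finset.disjoint_left]
      intro p hp hp'
      exact Finset.disjoint_left.1 (π.block_disjoint hij) (Finset.mem_offDiag.1 hp).1
        (Finset.mem_offDiag.1 hp').1
  let mates : ℕ → Finset ℕ := fun u => π.toGraph.nbrs u
  have hmates : ∀ u i, π.clique u = some i → (mates u).card = t - 1 := fun u i h =>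
    π.card_nbrs_of_clique h
  set K' := K.filter fun u => π.clique u ≠ none with hK'
  have hK'card : K'.card ≤ K.card := Finset.card_filter_le _ _
  set A := K'.biUnion fun u => (mates u).image fun v => (u, v) with hA
  set B := K'.biUnion fun u => (mates u).image fun v => (v, u) with hB
  have hmate : ∀ u ∈ K', (mates u).card = t - 1 := by
    intro u hu
    obtain ⟨i, hi⟩ := Option.ne_none_iff_exists'.1 (Finset.mem_filter.1 hu).2
    exact hmates u i hi
  have hAcard : A.card ≤ K.card * (t - 1) := by
    refine (Finset.card_biUnion_le).trans ?_
    refine (Finset.sum_le_card_nsmul _ _ (t - 1) fun u hu => ?_).trans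
      (Nat.mul_le_mul_right _ hK'card)
    exact Finset.card_image_le.trans (hmate u hu).le
  have hBcard : B.card ≤ K.card * (t - 1) := by
    refine (Finset.card_biUnion_le).trans ?_
    refine (Finset.sum_le_card_nsmul _ _ (t - 1) fun u hu => ?_).trans
      (Nat.mul_le_mul_right _ hK'card)
    exact Finset.card_image_le.trans (hmate u hu).le
  set X := ((V \ K).offDiag.filter fun p => π.clique p.1 = π.clique p.2 ∧ π.clique p.1 ≠ none)
    with hX
  have hsub : T ⊆ X ∪ (A ∪ B) := by
    rintro ⟨u, v⟩ hp
    obtain ⟨i, -, hp⟩ := Finset.mem_biUnion.1 hp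
    obtain ⟨hu, hv, huv⟩ := Finset.mem_offDiag.1 hp
    simp only at hu hv huv
    have hu' := π.mem_block.1 hu
    have hv' := π.mem_block.1 hv
    rw [Finset.mem_union]
    by_cases h1 : u ∈ K
    · right
      refine Finset.mem_union_left _ (Finset.mem_biUnion.2 ⟨u, ?_, ?_⟩)
      · exact Finset.mem_filter.2 ⟨h1, by rw [hu']; simp⟩
      · refine Finset.mem_image.2 ⟨v, ?_, rfl⟩
        exact (NetGraph.mem_nbrs _).2 ((π.adj_of_clique hu').2 ⟨huv, hv'⟩)
    by_cases h2 : v ∈ K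
    · right
      refine Finset.mem_union_right _ (Finset.mem_biUnion.2 ⟨v, ?_, ?_⟩)
      · exact Finset.mem_filter.2 ⟨h2, by rw [hv']; simp⟩
      · refine Finset.mem_image.2 ⟨u, ?_, rfl⟩
        exact (NetGraph.mem_nbrs _).2 ((π.adj_of_clique hv').2 ⟨huv.symm, hu'⟩)
    · left
      refine Finset.mem_filter.2 ⟨Finset.mem_offDiag.2 ⟨?_, ?_, huv⟩, ?_, ?_⟩
      · exact Finset.mem_sdiff.2 ⟨π.block_subset i hu, h1⟩
      · exact Finset.mem_sdiff.2 ⟨π.block_subset i hv, h2⟩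
      · simp only; rw [hu', hv']
      · simp only; rw [hu']; simp
  have h := Finset.card_le_card hsub
  have h' := Finset.card_union_le X (A ∪ B)
  have h'' := Finset.card_union_le A B
  rw [hTcard] at h
  have e : 2 * K.card * (t - 1) = K.card * (t - 1) + K.card * (t - 1) := by ring
  rw [e]
  omega

/-- Double counting of placements and unknown pairs in a common clique, with all pairs equally
likely by symmetry. The subtracted term bounds the arcs that meet `K`. -/
theorem card_consistent_edge (hK : K ⊆ V) (hl : ∀ z ∈ K, l z ∈ K) {u v : ℕ}
    (h : (u, v) ∈ (V \ K).offDiag) :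
    (consistent V N t r K l ∅).card * (N * (t * (t - 1)) - 2 * K.card * (t - 1)) ≤
      (consistent V N t r (K ∪ {u, v}) (Function.update (Function.update l u u) v u) ∅).card *
        (V \ K).offDiag.card := by
  classical
  calc _ ≤ ∑ π ∈ consistent V N t r K l ∅, ((V \ K).offDiag.filter
        fun p => π.clique p.1 = π.clique p.2 ∧ π.clique p.1 ≠ none).card := by
        rw [← smul_eq_mul, ← Finset.sum_const]
        exact Finset.sum_le_sum fun π _ => π.le_card_fresh_pairs
    _ = ∑ p ∈ (V \ K).offDiag, (consistent V N t r (K ∪ {p.1, p.2})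
          (Function.update (Function.update l p.1 p.1) p.2 p.1) ∅).card := by
        simp only [Finset.card_filter]
        rw [Finset.sum_comm]
        refine Finset.sum_congr rfl fun p hp => ?_
        obtain ⟨hu, hv, huv⟩ := Finset.mem_offDiag.1 hp
        rw [← Finset.card_filter]
        congr 1
        ext π
        rw [Finset.mem_filter, mem_consistent_edge hl (Finset.mem_sdiff.1 hu).2
          (Finset.mem_sdiff.1 hv).2 huv]
    _ ≤ _ := by
        rw [mul_comm, ← smul_eq_mul]
        exact Finset.sum_le_card_nsmul _ _ _ fun p hp => card_consistent_edge_le hK hl h hp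

/-- The number of vertices of `K` with the same label as `x`. -/
def groupSize (K : Finset ℕ) (l : ℕ → ℕ) (x : ℕ) : ℕ := (K.filter fun z => l z = l x).card

/-- The t members of the clique of `x` are unknown, in the group of `x`, or in other groups. The
last kind are collisions, which are rare, so about t minus the group size are unknown; these are
spread evenly by symmetry. -/
theorem card_consistent_neighbour (hK : K ⊆ V) {x y : ℕ} (hx : x ∈ K) (hy : y ∈ V \ K) :
    (consistent V N t r K l ∅).card * ((t - groupSize K l x) * (N - K.card)) ≤
      (consistent V N t r (K ∪ {y}) (Function.update l y (l x)) ∅).card * (V \ K).card *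
        (N - K.card) + K.card * (consistent V N t r K l ∅).card := by
  classical
  set Cn := consistent V N t r K l ∅ with hCn
  have hfresh : ∀ π ∈ Cn, t - groupSize K l x ≤
      ((V \ K).filter fun y => π.clique y = π.clique x).card +
        (K.filter fun z => l x ≠ l z ∧ π.clique x = π.clique z).card := by
    intro π hπ
    obtain ⟨i, hi⟩ := Option.ne_none_iff_exists'.1 ((mem_consistent.1 hπ).1 x hx)
    have hsub : π.block i ⊆ ((V \ K).filter fun y => π.clique y = π.clique x) ∪
        ((K.filter fun z => l x ≠ l z ∧ π.clique x = π.clique z) ∪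
          K.filter fun z => l z = l x) := by
      intro z hz
      have hz' := π.mem_block.1 hz
      by_cases hzK : z ∈ K
      · refine Finset.mem_union_right _ ?_
        by_cases hlz : l z = l x
        · exact Finset.mem_union_right _ (Finset.mem_filter.2 ⟨hzK, hlz⟩)
        · exact Finset.mem_union_left _
            (Finset.mem_filter.2 ⟨hzK, fun h => hlz h.symm, by rw [hi, hz']⟩)
      · exact Finset.mem_union_left _ (Finset.mem_filter.2
          ⟨Finset.mem_sdiff.2 ⟨π.block_subset i hz, hzK⟩, by rw [hi, hz']⟩)
    have h1 := (Finset.card_le_card hsub).trans (Finset.card_union_le _ _)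
    have h2 := Finset.card_union_le (K.filter fun z => l x ≠ l z ∧ π.clique x = π.clique z)
      (K.filter fun z => l z = l x)
    rw [π.card_block] at h1
    simp only [groupSize]
    omega
  have hcoll : ∑ π ∈ Cn, (K.filter fun z => l x ≠ l z ∧ π.clique x = π.clique z).card *
      (N - K.card) ≤ K.card * Cn.card := by
    rw [← Finset.sum_mul]
    simp only [Finset.card_filter]
    rw [Finset.sum_comm, Finset.sum_mul, ← smul_eq_mul (a := K.card)]
    refine Finset.sum_le_card_nsmul _ _ _ fun z hz => ?_
    by_cases hlz : l x = l z
    · simp [hlz]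
    · simp only [ne_eq, hlz, not_false_eq_true, true_and]
      rw [← Finset.card_filter]
      exact card_collision_mul_le hx hz hlz
  have hmain : ∑ π ∈ Cn, ((V \ K).filter fun y => π.clique y = π.clique x).card ≤
      (consistent V N t r (K ∪ {y}) (Function.update l y (l x)) ∅).card * (V \ K).card := by
    simp only [Finset.card_filter]
    rw [Finset.sum_comm, mul_comm, ← smul_eq_mul]
    refine Finset.sum_le_card_nsmul _ _ _ fun z hz => ?_
    refine le_trans (le_of_eq ?_) (card_consistent_neighbour_le hK hx hy hz)
    rw [← Finset.card_filter]
    congr 1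
    ext π
    rw [Finset.mem_filter, mem_consistent_neighbour hx (Finset.mem_sdiff.1 hz).2]
  calc _ = ∑ π ∈ Cn, (t - groupSize K l x) * (N - K.card) := by
        rw [Finset.sum_const, smul_eq_mul]
    _ ≤ ∑ π ∈ Cn, (((V \ K).filter fun y => π.clique y = π.clique x).card * (N - K.card) +
        (K.filter fun z => l x ≠ l z ∧ π.clique x = π.clique z).card * (N - K.card)) := by
        refine Finset.sum_le_sum fun π hπ => ?_
        rw [← add_mul]
        exact Nat.mul_le_mul_right _ (hfresh π hπ)
    _ ≤ _ := by
        rw [Finset.sum_add_distrib, ← Finset.sum_mul]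
        exact add_le_add (Nat.mul_le_mul_right _ hmain) hcoll

/-- Union bound over the pairs in `P`, each of which collides in a small fraction of the placements.
So negative answers exclude few placements altogether. -/
theorem card_consistent_mul_le (hP : ∀ p ∈ P, p.1 ∈ K ∧ p.2 ∈ K ∧ l p.1 ≠ l p.2) :
    (consistent V N t r K l ∅).card * (N - K.card) ≤
      (consistent V N t r K l P).card * (N - K.card) +
        P.card * (consistent V N t r K l ∅).card := by
  classical
  set Cn := consistent V N t r K l ∅ with hCn
  have hsub : Cn ⊆ consistent V N t r K l P ∪
      P.biUnion fun p => Cn.filter fun π => π.clique p.1 = π.clique p.2 := by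
    intro π hπ
    by_cases h : ∃ p ∈ P, π.clique p.1 = π.clique p.2
    · obtain ⟨p, hp, h⟩ := h
      exact Finset.mem_union_right _ (Finset.mem_biUnion.2 ⟨p, hp, Finset.mem_filter.2 ⟨hπ, h⟩⟩)
    · refine Finset.mem_union_left _ (mem_consistent.2 ?_)
      have := mem_consistent.1 hπ
      exact ⟨this.1, this.2.1, fun p hp h' => h ⟨p, hp, h'⟩⟩
  have h1 := (Finset.card_le_card hsub).trans (Finset.card_union_le _ _)
  have h2 : (P.biUnion fun p => Cn.filter fun π => π.clique p.1 = π.clique p.2).card *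
      (N - K.card) ≤ P.card * Cn.card := by
    calc _ ≤ (∑ p ∈ P, (Cn.filter fun π => π.clique p.1 = π.clique p.2).card) * (N - K.card) :=
          Nat.mul_le_mul_right _ Finset.card_biUnion_le
      _ ≤ _ := by
          rw [Finset.sum_mul, ← smul_eq_mul (a := P.card)]
          refine Finset.sum_le_card_nsmul _ _ _ fun p hp => ?_
          obtain ⟨hp1, hp2, hp3⟩ := hP p hp
          exact card_collision_mul_le hp1 hp2 hp3
  calc _ ≤ _ := Nat.mul_le_mul_right _ h1
    _ ≤ _ := by rw [add_mul]; exact Nat.add_le_add_left h2 _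

end Placement

/-! ### Ideal answers to random edge, random neighbour, degree and pair queries. -/

namespace Placement

/-- What is known after some queries: the known vertices, their groups (as labels) and the pairs
known to be in different groups. -/
abbrev Groups : Type := Finset ℕ × (ℕ → ℕ) × Finset (ℕ × ℕ)

/-- The placements that agree with the knowledge `σ`. -/
noncomputable def agreeing (V : Finset ℕ) (N t r : ℕ) (σ : Groups) : Finset (Placement V N t r) :=
  consistent V N t r σ.1 σ.2.1 σ.2.2

/-- The number of placements that agree with the positive part of the knowledge `σ`. -/
noncomputable def weight (V : Finset ℕ) (N t r : ℕ) (σ : Groups) : ℕ :=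
  (consistent V N t r σ.1 σ.2.1 ∅).card

/-- The invariant of the exposure process with remaining budget `b` out of `b₀`. -/
def GroupsInv (V : Finset ℕ) (t : ℕ) (N r : Bool → ℕ) (b₀ : ℕ) (σ : Groups) (κ : Finset ℕ)
    (b : ℕ) : Prop :=
  σ.1 = κ ∧ κ ⊆ V ∧ (∀ z ∈ κ, σ.2.1 z ∈ κ) ∧
    (∀ p ∈ σ.2.2, p.1 ∈ κ ∧ p.2 ∈ κ ∧ σ.2.1 p.1 ≠ σ.2.1 p.2) ∧
    κ.card + 2 * b ≤ 2 * b₀ ∧ σ.2.2.card + b ≤ b₀ ∧ ∀ i, weight V (N i) t (r i) σ ≠ 0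

/-- There is an ideal answer to the query `q` that is dominated by the true answers. -/
def HasIdealAnswer (V : Finset ℕ) (t : ℕ) (N r : Bool → ℕ) (b₀ : ℕ) (fac : ℝ≥0∞) (σ : Groups)
    (κ : Finset ℕ) (b : ℕ) (q : Query) : Prop :=
  ∃ (Ω : Type) (I : PMF Ω) (ans : Ω → q.Answer) (st : Ω → Groups),
    (∀ ω ∈ I.support, GroupsInv V t N r b₀ (st ω) (learn κ q (ans ω)) (b - q.cost) ∧
      ∀ i, agreeing V (N i) t (r i) (st ω) ⊆ agreeing V (N i) t (r i) σ ∧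
        weight V (N i) t (r i) (st ω) ≠ 0) ∧
    ∀ i, ∀ π ∈ agreeing V (N i) t (r i) σ, ∀ f : q.Answer → ℝ≥0∞,
      fac ^ q.cost * ∑' ω, I ω * ((weight V (N i) t (r i) σ : ℝ≥0∞) /
        weight V (N i) t (r i) (st ω)) *
        (if π ∈ agreeing V (N i) t (r i) (st ω) then f (ans ω) else 0) ≤
      ∑' a, respond π.toGraph κ q a * f a

variable {V : Finset ℕ} {t : ℕ} {N r : Bool → ℕ} {b₀ : ℕ} {fac : ℝ≥0∞} {σ : Groups}
  {κ : Finset ℕ} {b : ℕ}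

/-- A query with a determined answer. -/
theorem hasIdealAnswer_of_determined (hfac1 : fac ≤ 1) {q : Query} (a : q.Answer)
    (P' : Finset (ℕ × ℕ)) (hPP : σ.2.2 ⊆ P')
    (hinv : GroupsInv V t N r b₀ σ κ b) (hlearn : learn κ q a = κ)
    (hP : ∀ p ∈ P', p.1 ∈ κ ∧ p.2 ∈ κ ∧ σ.2.1 p.1 ≠ σ.2.1 p.2)
    (hcard : P'.card + (b - q.cost) ≤ b₀)
    (hans : ∀ i, ∀ π ∈ agreeing V (N i) t (r i) (σ.1, σ.2.1, P'),
      respond π.toGraph κ q = PMF.pure a) : HasIdealAnswer V t N r b₀ fac σ κ b q := by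
  classical
  obtain ⟨h1, h2, h3, h4, h5, h6, h7⟩ := hinv
  refine ⟨Unit, PMF.pure (), fun _ => a, fun _ => (σ.1, σ.2.1, P'), ?_, ?_⟩
  · intro _ _
    refine ⟨⟨by rw [hlearn, h1], by rwa [hlearn], by rwa [hlearn], by rwa [hlearn], ?_, hcard, h7⟩,
      fun i => ⟨consistent_subset_of_subset hPP, h7 i⟩⟩
    rw [hlearn]; omega
  · intro i π hπ f
    refine (mul_le_of_le_one_left zero_le (pow_le_one₀ zero_le hfac1)).trans ?_
    simp only [mul_assoc]
    rw [PMF.tsum_pure_mul]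
    have hW : (weight V (N i) t (r i) σ : ℝ≥0∞) / weight V (N i) t (r i) (σ.1, σ.2.1, P') = 1 :=
      ENNReal.div_self (by exact_mod_cast h7 i) (ENNReal.natCast_ne_top _)
    rw [hW, one_mul]
    -- The answer is only claimed for placements that also respect `P'`; the others contribute zero.
    split_ifs with h
    · rw [hans i π h, PMF.tsum_pure_mul]
    · exact zero_le

/-- The ideal answer is a uniformly random ordered pair of unknown vertices, which opens a new
group. The loss consists of arcs that meet known vertices, of which there are at most `2 * b₀`, and
of star edges. -/
theorem hasIdealAnswer_randEdge (hr : ∀ i, 2 ≤ r i)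
    (hfac : ∀ i, fac * ((N i * (t * (t - 1)) + 2 * (r i - 1) : ℕ) : ℝ≥0∞) ≤
      ((N i * (t * (t - 1)) - 4 * b₀ * (t - 1) : ℕ) : ℝ≥0∞))
    (hpos : ∀ i, 4 * b₀ * (t - 1) < N i * (t * (t - 1)))
    (hinv : GroupsInv V t N r b₀ σ κ b) (hb : Query.randEdge.cost ≤ b) :
    HasIdealAnswer V t N r b₀ fac σ κ b .randEdge := by
  classical
  obtain ⟨K, l, P⟩ := σ
  obtain ⟨h1, h2, h3, h4, h5, h6, h7⟩ := hinv
  simp only at h1 h3 h4 h6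
  subst h1
  simp only [Query.cost] at hb
  have hKb : 2 * K.card * (t - 1) ≤ 4 * b₀ * (t - 1) := Nat.mul_le_mul_right _ (by omega)
  set F := (V \ K).offDiag with hF
  let st : ℕ × ℕ → Groups := fun p =>
    (K ∪ {p.1, p.2}, Function.update (Function.update l p.1 p.1) p.2 p.1, P)
  have hW : ∀ i, ∀ p ∈ F, weight V (N i) t (r i) (K, l, P) *
      (N i * (t * (t - 1)) - 4 * b₀ * (t - 1)) ≤ weight V (N i) t (r i) (st p) * F.card := by
    intro i p hp
    exact (Nat.mul_le_mul_left _ (by omega)).trans (card_consistent_edge h2 h3 hp)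
  have hW0 : ∀ i, ∀ p ∈ F, weight V (N i) t (r i) (st p) ≠ 0 := by
    intro i p hp h0
    have := hW i p hp
    rw [h0, zero_mul, Nat.le_zero, mul_eq_zero] at this
    have := h7 i; have := hpos i
    omega
  have hFne : F.Nonempty := by
    obtain ⟨π, hπ⟩ : (consistent V (N true) t (r true) K l ∅).Nonempty :=
      Finset.card_pos.1 (Nat.pos_of_ne_zero (h7 true))
    have e1 := π.le_card_fresh_pairs (K := K)
    have e2 := Finset.card_filter_le (V \ K).offDiag
      fun p => π.clique p.1 = π.clique p.2 ∧ π.clique p.1 ≠ none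
    rw [← Finset.card_pos]
    exact (Nat.sub_pos_of_lt (hKb.trans_lt (hpos true))).trans_le (e1.trans e2)
  have hmem : ∀ (N' r' : ℕ) (π : Placement V N' t r'), ∀ p ∈ F,
      (π ∈ agreeing V N' t r' (st p) ↔ π ∈ agreeing V N' t r' (K, l, P) ∧
        π.clique p.1 = π.clique p.2 ∧ π.clique p.1 ≠ none) := by
    intro N' r' π p hp
    obtain ⟨hu, hv, huv⟩ := Finset.mem_offDiag.1 hp
    exact mem_consistent_edge h3 (Finset.mem_sdiff.1 hu).2 (Finset.mem_sdiff.1 hv).2 huv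
  refine ⟨ℕ × ℕ, PMF.uniformOfFinset F hFne, fun p => s(p.1, p.2), st, ?_, ?_⟩
  · intro p hp
    rw [PMF.mem_support_uniformOfFinset_iff] at hp
    obtain ⟨hu, hv, huv⟩ := Finset.mem_offDiag.1 hp
    obtain ⟨huV, huK⟩ := Finset.mem_sdiff.1 hu
    obtain ⟨hvV, hvK⟩ := Finset.mem_sdiff.1 hv
    have hlearn : learn K .randEdge s(p.1, p.2) = K ∪ {p.1, p.2} := by
      simp only [learn]
      congr 1
      ext x
      simp [Sym2.mem_toFinset]
    have hlK : ∀ z ∈ K, Function.update (Function.update l p.1 p.1) p.2 p.1 z = l z := by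
      intro z hz
      rw [Function.update_of_ne (fun h => hvK (by rw [← h]; exact hz)),
        Function.update_of_ne (fun h => huK (by rw [← h]; exact hz))]
    refine ⟨⟨?_, ?_, ?_, ?_, ?_, ?_, fun i => hW0 i p hp⟩, fun i => ⟨?_, hW0 i p hp⟩⟩
    · rw [hlearn]
    · rw [hlearn]
      refine Finset.union_subset h2 ?_
      intro x hx
      rcases Finset.mem_insert.1 hx with rfl | hx
      · exact huV
      · rw [Finset.mem_singleton.1 hx]; exact hvV
    · rw [hlearn]
      intro z hz
      simp only [st]
      by_cases hzv : z = p.2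
      · rw [hzv, Function.update_self]; simp
      by_cases hzu : z = p.1
      · rw [Function.update_of_ne hzv, hzu, Function.update_self]; simp
      · have hzK : z ∈ K := by simpa [hzv, hzu] using hz
        rw [hlK z hzK]
        exact Finset.mem_union_left _ (h3 z hzK)
    · rw [hlearn]
      intro q hq
      obtain ⟨a1, a2, a3⟩ := h4 q hq
      refine ⟨Finset.mem_union_left _ a1, Finset.mem_union_left _ a2, ?_⟩
      simp only [st]
      rw [hlK _ a1, hlK _ a2]
      exact a3
    · rw [hlearn]
      have e1 := Finset.card_union_le K {p.1, p.2}
      have e2 : ({p.1, p.2} : Finset ℕ).card ≤ 2 := Finset.card_le_two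
      simp only [Query.cost]
      omega
    · simp only [st, Query.cost]
      omega
    · intro π hπ
      exact ((hmem _ _ π p hp).1 hπ).1
  · intro i π hπ f
    rw [π.toGraph.tsum_respond_randEdge K (π.card_edges_pos (hr i)) f,
      π.two_mul_card_edges (by have := hr i; omega)]
    set X := N i * (t * (t - 1)) - 4 * b₀ * (t - 1) with hX
    have hX0 : 0 < X := by have := hpos i; omega
    set W := weight V (N i) t (r i) (K, l, P) with hWdef
    set Y := N i * (t * (t - 1)) + 2 * (r i - 1) with hY
    have hY0 : 0 < Y := by have := hr i; omega
    have hFc : (F.card : ℝ≥0∞) ≠ 0 := by exact_mod_cast (Finset.card_pos.2 hFne).ne'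
    -- The count of placements extending the new edge bounds the Bayes ratio by |F|/X, so |F|
    -- cancels and `hfac` compares what is left with the true probability of an arc.
    have hratio : ∀ p ∈ F, fac * (F.card : ℝ≥0∞)⁻¹ * ((W : ℝ≥0∞) / weight V (N i) t (r i) (st p)) ≤
        (Y : ℝ≥0∞)⁻¹ := by
      intro p hp
      have e0 : (weight V (N i) t (r i) (st p) : ℝ≥0∞) ≠ 0 := by exact_mod_cast hW0 i p hp
      have e1 : (W : ℝ≥0∞) / weight V (N i) t (r i) (st p) ≤ F.card / X := by
        rw [ENNReal.div_le_iff e0 (ENNReal.natCast_ne_top _), ENNReal.div_eq_inv_mul, mul_assoc,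
          ← ENNReal.div_eq_inv_mul, ENNReal.le_div_iff_mul_le
          (Or.inl (by exact_mod_cast hX0.ne')) (Or.inl (ENNReal.natCast_ne_top _)), mul_comm (F.card : ℝ≥0∞)]
        exact_mod_cast hW i p hp
      calc _ ≤ fac * (F.card : ℝ≥0∞)⁻¹ * (F.card / X) := by gcongr
        _ = fac / X := by
            rw [mul_assoc, ENNReal.div_eq_inv_mul, mul_left_comm _ (X : ℝ≥0∞)⁻¹,
              ENNReal.inv_mul_cancel hFc (ENNReal.natCast_ne_top _), mul_one, div_eq_mul_inv]
        _ ≤ _ := by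
            rw [ENNReal.div_le_iff (by exact_mod_cast hX0.ne') (ENNReal.natCast_ne_top _),
              mul_comm, ← div_eq_mul_inv, ENNReal.le_div_iff_mul_le
              (Or.inl (by exact_mod_cast hY0.ne')) (Or.inl (ENNReal.natCast_ne_top _))]
            exact hfac i
    simp only [Query.cost, pow_one, mul_assoc]
    rw [PMF.tsum_uniformOfFinset_mul, Finset.mul_sum, Finset.mul_sum, Finset.mul_sum]
    have hsub : F.filter (fun p => π.clique p.1 = π.clique p.2 ∧ π.clique p.1 ≠ none) ⊆
        π.toGraph.arcs := by
      intro p hp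
      obtain ⟨hp, h⟩ := Finset.mem_filter.1 hp
      obtain ⟨hu, hv, huv⟩ := Finset.mem_offDiag.1 hp
      obtain ⟨j, hj⟩ := Option.ne_none_iff_exists'.1 h.2
      rw [NetGraph.mem_arcs, π.adj_of_clique hj]
      exact ⟨huv, by rw [← h.1, hj]⟩
    calc _ ≤ ∑ p ∈ F, if π.clique p.1 = π.clique p.2 ∧ π.clique p.1 ≠ none then
          (Y : ℝ≥0∞)⁻¹ * f s(p.1, p.2) else 0 := by
          refine Finset.sum_le_sum fun p hp => ?_
          have := hmem _ _ π p hp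
          by_cases h : π.clique p.1 = π.clique p.2 ∧ π.clique p.1 ≠ none
          · rw [if_pos (this.2 ⟨hπ, h⟩), if_pos h, ← mul_assoc, ← mul_assoc]
            exact mul_le_mul_left (hratio p hp) _
          · rw [if_neg (fun h' => h (this.1 h').2), if_neg h]
            simp
      _ ≤ _ := by
          rw [← Finset.sum_filter]
          exact Finset.sum_le_sum_of_subset hsub

end Placement

namespace Placement

variable {V : Finset ℕ} {t : ℕ} {N r : Bool → ℕ} {b₀ : ℕ} {σ : Groups}
  {κ : Finset ℕ} {b : ℕ}

/-- The ideal answer is each other member of the known group of `x` with probability 1/(t-1), and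
otherwise a uniformly random unknown vertex. The only loss comes from a second known group in the
clique of `x`. -/
theorem hasIdealAnswer_randNbr {δ : ℝ} (hδ : δ ≤ 1) (hδ0 : 0 ≤ δ) (ht : 2 ≤ t)
    (hbt : 2 * b₀ < t) (hbN : ∀ i, 4 * b₀ < N i)
    (hloss : ∀ i, 2 * (b₀ : ℝ) ≤ δ * ((t - 2 * b₀ : ℕ) * (N i - 2 * b₀ : ℕ)))
    (x : ℕ) (hinv : GroupsInv V t N r b₀ σ κ b) (hb : (Query.randNbr x).cost ≤ b) :
    HasIdealAnswer V t N r b₀ (ENNReal.ofReal (1 - δ)) σ κ b (.randNbr x) := by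
  classical
  have hfac1 : ENNReal.ofReal (1 - δ) ≤ 1 := ENNReal.ofReal_le_one.2 (by linarith)
  by_cases hx : x ∈ κ
  swap
  · obtain ⟨h1, h2, h3, h4, h5, h6, h7⟩ := hinv
    refine hasIdealAnswer_of_determined hfac1 (q := .randNbr x) x σ.2.2 subset_rfl
      ⟨h1, h2, h3, h4, h5, h6, h7⟩ (by simp [learn, hx]) h4 (by omega) fun i π _ => ?_
    simp only [respond, hx, false_and, dif_neg, not_false_eq_true]
  obtain ⟨K, l, P⟩ := σ
  obtain ⟨h1, h2, h3, h4, h5, h6, h7⟩ := hinv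
  simp only at h1 h3 h4 h6
  subst h1
  simp only [Query.cost] at hb
  set g := groupSize K l x with hg
  set gx := (K.filter fun z => l z = l x).erase x with hgx
  have hxg : x ∈ K.filter fun z => l z = l x := Finset.mem_filter.2 ⟨hx, rfl⟩
  have hgxcard : gx.card = g - 1 := Finset.card_erase_of_mem hxg
  have hg1 : 1 ≤ g := Finset.card_pos.2 ⟨x, hxg⟩
  have hgK : g ≤ K.card := Finset.card_filter_le _ _
  have hKb : K.card ≤ 2 * b₀ := by omega
  have hgt : g < t := by omega
  set F := V \ K with hF
  have hclique : ∀ i, ∀ π ∈ agreeing V (N i) t (r i) (K, l, P), ∃ j, π.clique x = some j :=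
    fun i π hπ => Option.ne_none_iff_exists'.1 ((mem_consistent.1 hπ).1 x hx)
  have hFpos : 0 < F.card := by
    obtain ⟨π, hπ⟩ : (consistent V (N true) t (r true) K l ∅).Nonempty :=
      Finset.card_pos.1 (Nat.pos_of_ne_zero (h7 true))
    obtain ⟨j, hj⟩ := Option.ne_none_iff_exists'.1 ((mem_consistent.1 hπ).1 x hx)
    have e1 := Finset.card_le_card (π.block_subset j)
    rw [π.card_block] at e1
    have e2 := Finset.le_card_sdiff K V
    rw [← hF] at e2
    omega
  -- An answer that was already known leaves the state unchanged.
  let st : ℕ → Groups := fun z =>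
    (K ∪ {z}, if z ∈ K then l else Function.update l z (l x), P)
  have hstK : ∀ z ∈ K, st z = (K, l, P) := by
    intro z hz
    simp only [st, if_pos hz, Finset.union_eq_left.2 (Finset.singleton_subset_iff.2 hz)]
  have hstF : ∀ z ∈ F, st z = (K ∪ {z}, Function.update l z (l x), P) := by
    intro z hz
    simp only [st, if_neg (Finset.mem_sdiff.1 hz).2]
  have hW : ∀ i, ∀ z ∈ F, weight V (N i) t (r i) (K, l, P) * ((t - g) * (N i - K.card)) ≤
      weight V (N i) t (r i) (st z) * F.card * (N i - K.card) +
        K.card * weight V (N i) t (r i) (K, l, P) := by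
    intro i z hz
    rw [hstF z hz]
    exact card_consistent_neighbour h2 hx hz
  have hW0 : ∀ i, ∀ z ∈ F, weight V (N i) t (r i) (st z) ≠ 0 := by
    intro i z hz h0
    have := hW i z hz
    rw [h0, zero_mul, zero_mul, zero_add, mul_comm (K.card)] at this
    have h8 := Nat.le_of_mul_le_mul_left this (Nat.pos_of_ne_zero (h7 i))
    have h9 : N i - K.card ≤ (t - g) * (N i - K.card) := Nat.le_mul_of_pos_left _ (by omega)
    have := hbN i
    omega
  -- the law of the ideal answer
  let w : ℕ → ℝ≥0∞ := fun z => if z ∈ gx then ((t - 1 : ℕ) : ℝ≥0∞)⁻¹ else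
    if z ∈ F then ((t - g : ℕ) : ℝ≥0∞) * ((t - 1 : ℕ) : ℝ≥0∞)⁻¹ * (F.card : ℝ≥0∞)⁻¹ else 0
  have hgxK : ∀ z ∈ gx, z ∈ K := fun z hz =>
    (Finset.mem_filter.1 (Finset.mem_of_mem_erase hz)).1
  have hdisj : Disjoint gx F := by
    rw [Finset.disjoint_left]
    exact fun z hz hz' => (Finset.mem_sdiff.1 hz').2 (hgxK z hz)
  have ht0 : ((t - 1 : ℕ) : ℝ≥0∞) ≠ 0 := by
    have : t - 1 ≠ 0 := by omega
    exact_mod_cast this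
  have hF0 : (F.card : ℝ≥0∞) ≠ 0 := by exact_mod_cast hFpos.ne'
  have hw1 : ∀ z ∈ gx, w z = ((t - 1 : ℕ) : ℝ≥0∞)⁻¹ := fun z hz => if_pos hz
  have hw2 : ∀ z ∈ F, w z = ((t - g : ℕ) : ℝ≥0∞) * ((t - 1 : ℕ) : ℝ≥0∞)⁻¹ * (F.card : ℝ≥0∞)⁻¹ :=
    fun z hz => (if_neg (fun h => Finset.disjoint_left.1 hdisj h hz)).trans (if_pos hz)
  have hw3 : ∀ z ∉ gx ∪ F, w z = 0 := by
    intro z hz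
    rw [Finset.mem_union, not_or] at hz
    exact (if_neg hz.1).trans (if_neg hz.2)
  have hsum : ∑ z ∈ gx ∪ F, w z = 1 := by
    rw [Finset.sum_union hdisj, Finset.sum_congr rfl hw1, Finset.sum_congr rfl hw2,
      Finset.sum_const, Finset.sum_const, nsmul_eq_mul, nsmul_eq_mul, mul_comm (F.card : ℝ≥0∞),
      mul_assoc, ENNReal.inv_mul_cancel hF0 (ENNReal.natCast_ne_top _), mul_one, ← add_mul,
      ← Nat.cast_add, hgxcard, show g - 1 + (t - g) = t - 1 by omega]
    exact ENNReal.mul_inv_cancel ht0 (ENNReal.natCast_ne_top _)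
  let I : PMF ℕ := PMF.ofFinset w (gx ∪ F) hsum hw3
  have hmemF : ∀ (N' r' : ℕ) (π : Placement V N' t r'), ∀ z ∈ F,
      (π ∈ agreeing V N' t r' (st z) ↔ π ∈ agreeing V N' t r' (K, l, P) ∧
        π.clique z = π.clique x) := by
    intro N' r' π z hz
    rw [hstF z hz]
    exact mem_consistent_neighbour hx (Finset.mem_sdiff.1 hz).2
  refine ⟨ℕ, I, fun z => z, st, ?_, ?_⟩
  · intro z hz
    have hz' : z ∈ gx ∪ F := ((PMF.mem_support_ofFinset_iff _ _ _).1 hz).1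
    have hlearn : learn K (.randNbr x) z = K ∪ {z} := if_pos hx
    rcases Finset.mem_union.1 hz' with hzg | hzF
    · have hzK := hgxK z hzg
      have hKz : K ∪ {z} = K := Finset.union_eq_left.2 (Finset.singleton_subset_iff.2 hzK)
      rw [hlearn, hKz, hstK z hzK]
      refine ⟨⟨rfl, h2, h3, h4, ?_, ?_, h7⟩, fun i => ⟨subset_rfl, h7 i⟩⟩
      · omega
      · simp only; omega
    · obtain ⟨hzV, hzK⟩ := Finset.mem_sdiff.1 hzF
      have hlK : ∀ y ∈ K, Function.update l z (l x) y = l y := fun y hy =>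
        Function.update_of_ne (fun h => hzK (by rw [← h]; exact hy)) _ _
      rw [hlearn]
      refine ⟨⟨rfl, ?_, ?_, ?_, ?_, ?_, fun i => hW0 i z hzF⟩, fun i => ⟨?_, hW0 i z hzF⟩⟩
      · exact Finset.union_subset h2 (Finset.singleton_subset_iff.2 hzV)
      · rw [hstF z hzF]
        intro y hy
        simp only
        rcases Finset.mem_union.1 hy with hy | hy
        · rw [hlK y hy]; exact Finset.mem_union_left _ (h3 y hy)
        · rw [Finset.mem_singleton.1 hy, Function.update_self]
          exact Finset.mem_union_left _ (h3 x hx)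
      · rw [hstF z hzF]
        intro q hq
        obtain ⟨a1, a2, a3⟩ := h4 q hq
        refine ⟨Finset.mem_union_left _ a1, Finset.mem_union_left _ a2, ?_⟩
        simp only
        rw [hlK _ a1, hlK _ a2]
        exact a3
      · have := Finset.card_union_le K {z}
        rw [Finset.card_singleton] at this
        simp only [Query.cost]
        omega
      · simp only [st, Query.cost]
        omega
      · intro π hπ
        exact ((hmemF _ _ π z hzF).1 hπ).1
  · intro i π hπ f
    obtain ⟨j, hj⟩ := hclique i π hπ
    have hnbrs := π.nbrs_of_clique hj
    have hne : (π.toGraph.nbrs x).Nonempty := by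
      rw [← Finset.card_pos, π.card_nbrs_of_clique hj]; omega
    have hresp : ∑' a, respond π.toGraph K (.randNbr x) a * f a =
        ∑ z ∈ π.toGraph.nbrs x, ((t - 1 : ℕ) : ℝ≥0∞)⁻¹ * f z := by
      have h : x ∈ K ∧ (π.toGraph.nbrs x).Nonempty := ⟨hx, hne⟩
      simp only [respond, h, dif_pos, and_self]
      rw [← π.card_nbrs_of_clique hj]
      exact (PMF.tsum_uniformOfFinset_mul (π.toGraph.nbrs x) hne f).trans (Finset.mul_sum _ _ _)
    refine le_trans ?_ hresp.ge
    simp only [Query.cost, pow_one]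
    rw [tsum_eq_sum (s := gx ∪ F) (fun z hz => by
      rw [show I z = 0 from hw3 z hz, zero_mul, zero_mul]), Finset.mul_sum]
    set W := weight V (N i) t (r i) (K, l, P) with hWd
    have hterm : ∀ z ∈ gx ∪ F, ENNReal.ofReal (1 - δ) * (I z * ((W : ℝ≥0∞) /
        weight V (N i) t (r i) (st z)) * (if π ∈ agreeing V (N i) t (r i) (st z) then f z else 0)) ≤
        if z ∈ π.toGraph.nbrs x then ((t - 1 : ℕ) : ℝ≥0∞)⁻¹ * f z else 0 := by
      intro z hz
      rcases Finset.mem_union.1 hz with hzg | hzF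
      · have hzK := hgxK z hzg
        have hzx : z ≠ x := Finset.ne_of_mem_erase hzg
        have hzl : l z = l x := (Finset.mem_filter.1 (Finset.mem_of_mem_erase hzg)).2
        have hzn : z ∈ π.toGraph.nbrs x := by
          rw [hnbrs, Finset.mem_erase, π.mem_block, ← hj]
          exact ⟨hzx, (mem_consistent.1 hπ).2.1 z hzK x hx hzl⟩
        rw [show I z = _ from hw1 z hzg, hstK z hzK, if_pos hπ, if_pos hzn,
          ENNReal.div_self (by exact_mod_cast h7 i) (ENNReal.natCast_ne_top _), mul_one]
        exact mul_le_of_le_one_left zero_le hfac1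
      · by_cases hπz : π.clique z = π.clique x
        swap
        · rw [if_neg (fun h => hπz ((hmemF _ _ π z hzF).1 h).2)]
          simp
        have hzn : z ∈ π.toGraph.nbrs x := by
          rw [hnbrs, Finset.mem_erase, π.mem_block, ← hj]
          exact ⟨fun h => (Finset.mem_sdiff.1 hzF).2 (h ▸ hx), hπz⟩
        rw [if_pos ((hmemF _ _ π z hzF).2 ⟨hπ, hπz⟩), if_pos hzn, show I z = _ from hw2 z hzF,
          ← mul_assoc]
        refine mul_le_mul_left ?_ _
        set W' := weight V (N i) t (r i) (st z) with hW'
        have hW'0 : (W' : ℝ≥0∞) ≠ 0 := by exact_mod_cast hW0 i z hzF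
        have hmainN := hW i z hzF
        have hNK : K.card < N i := by have := hbN i; omega
        -- The correction for collisions in the counting bound is at most the fraction δ of the main
        -- term.
        have hreal : (1 - δ) * ((t - g : ℕ) * W : ℝ) ≤ F.card * W' := by
          have hm : (W : ℝ) * ((t - g : ℕ) * (N i - K.card : ℕ)) ≤
              W' * F.card * (N i - K.card : ℕ) + K.card * W := by exact_mod_cast hmainN
          have hnk : (0 : ℝ) < (N i - K.card : ℕ) := by
            have : 0 < N i - K.card := by omega
            exact_mod_cast this
          have hl1 : (K.card : ℝ) ≤ δ * ((t - g : ℕ) * (N i - K.card : ℕ)) := by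
            calc (K.card : ℝ) ≤ 2 * b₀ := by exact_mod_cast hKb
              _ ≤ _ := hloss i
              _ ≤ _ := by
                refine mul_le_mul_of_nonneg_left ?_ hδ0
                exact_mod_cast Nat.mul_le_mul (show t - 2 * b₀ ≤ t - g by omega)
                  (show N i - 2 * b₀ ≤ N i - K.card by omega)
          have hl2 := mul_le_mul_of_nonneg_right hl1 (Nat.cast_nonneg (α := ℝ) W)
          refine le_of_mul_le_mul_right ?_ hnk
          calc (1 - δ) * ((t - g : ℕ) * W : ℝ) * (N i - K.card : ℕ)
              = W * ((t - g : ℕ) * (N i - K.card : ℕ)) -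
                δ * ((t - g : ℕ) * (N i - K.card : ℕ)) * W := by ring
            _ ≤ W * ((t - g : ℕ) * (N i - K.card : ℕ)) - K.card * W := by linarith
            _ ≤ _ := by linarith
        have henn : ENNReal.ofReal (1 - δ) * (((t - g : ℕ) : ℝ≥0∞) * W) ≤ F.card * W' := by
          have := ENNReal.ofReal_le_ofReal hreal
          rw [ENNReal.ofReal_mul (by linarith), ENNReal.ofReal_mul (by positivity),
            ENNReal.ofReal_mul (by positivity)] at this
          simpa only [ENNReal.ofReal_natCast] using this
        have e1 : ENNReal.ofReal (1 - δ) * (((t - g : ℕ) : ℝ≥0∞) * ((t - 1 : ℕ) : ℝ≥0∞)⁻¹ *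
            (F.card : ℝ≥0∞)⁻¹ * ((W : ℝ≥0∞) / W')) =
            (ENNReal.ofReal (1 - δ) * (((t - g : ℕ) : ℝ≥0∞) * W)) *
              ((F.card : ℝ≥0∞)⁻¹ * (W' : ℝ≥0∞)⁻¹) * ((t - 1 : ℕ) : ℝ≥0∞)⁻¹ := by
          rw [div_eq_mul_inv]; ring
        rw [e1]
        refine mul_le_of_le_one_left zero_le ?_
        calc _ ≤ (F.card * W' : ℝ≥0∞) * ((F.card : ℝ≥0∞)⁻¹ * (W' : ℝ≥0∞)⁻¹) :=
              mul_le_mul_left henn _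
          _ = 1 := by
            rw [mul_mul_mul_comm, ENNReal.mul_inv_cancel hF0 (ENNReal.natCast_ne_top _),
              ENNReal.mul_inv_cancel hW'0 (ENNReal.natCast_ne_top _), one_mul]
    refine (Finset.sum_le_sum hterm).trans ?_
    rw [← Finset.sum_filter]
    refine Finset.sum_le_sum_of_subset fun z hz => (Finset.mem_filter.1 hz).2

/-- Compatible placements put all known vertices into cliques, never into the star, so their degrees
carry no information. -/
theorem hasIdealAnswer_degree {fac : ℝ≥0∞} (hfac1 : fac ≤ 1) (x : ℕ)
    (hinv : GroupsInv V t N r b₀ σ κ b) : HasIdealAnswer V t N r b₀ fac σ κ b (.degree x) := by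
  obtain ⟨h1, h2, h3, h4, h5, h6, h7⟩ := hinv
  by_cases hx : x ∈ κ
  · refine hasIdealAnswer_of_determined hfac1 (q := .degree x) (t - 1 : ℕ) σ.2.2 subset_rfl
      ⟨h1, h2, h3, h4, h5, h6, h7⟩ rfl h4 (by omega) fun i π hπ => ?_
    obtain ⟨j, hj⟩ := Option.ne_none_iff_exists'.1 ((mem_consistent.1 hπ).1 x (h1 ▸ hx))
    exact congrArg PMF.pure ((if_pos hx).trans (π.card_nbrs_of_clique hj))
  · refine hasIdealAnswer_of_determined hfac1 (q := .degree x) (0 : ℕ) σ.2.2 subset_rfl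
      ⟨h1, h2, h3, h4, h5, h6, h7⟩ rfl h4 (by omega) fun i π hπ => ?_
    exact congrArg PMF.pure (if_neg hx)

/-- Vertices of different groups are declared nonadjacent and the pair is recorded. The weight
ignores recorded pairs, so nothing is paid here; the price is paid once, when the algorithm stops.
-/
theorem hasIdealAnswer_pair {fac : ℝ≥0∞} (hfac1 : fac ≤ 1) (x y : ℕ)
    (hinv : GroupsInv V t N r b₀ σ κ b) (hb : (Query.pair x y).cost ≤ b) :
    HasIdealAnswer V t N r b₀ fac σ κ b (.pair x y) := by
  classical
  obtain ⟨h1, h2, h3, h4, h5, h6, h7⟩ := hinv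
  simp only [Query.cost] at hb
  by_cases hxy : x ∈ κ ∧ y ∈ κ ∧ x ≠ y
  swap
  · refine hasIdealAnswer_of_determined hfac1 (q := .pair x y) false σ.2.2 subset_rfl
      ⟨h1, h2, h3, h4, h5, h6, h7⟩ rfl h4 (by omega) fun i π hπ => ?_
    have : ¬ (x ∈ κ ∧ y ∈ κ ∧ π.toGraph.graph.Adj x y) := fun h => hxy ⟨h.1, h.2.1, h.2.2.ne⟩
    simp only [respond, this, decide_false]
  obtain ⟨hx, hy, hne⟩ := hxy
  have hadj : ∀ {P' : Finset (ℕ × ℕ)} i, ∀ π ∈ agreeing V (N i) t (r i) (σ.1, σ.2.1, P'),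
      (π.toGraph.graph.Adj x y ↔ π.clique x = π.clique y) := by
    intro P' i π hπ
    obtain ⟨j, hj⟩ := Option.ne_none_iff_exists'.1 ((mem_consistent.1 hπ).1 x (h1 ▸ hx))
    rw [π.adj_of_clique hj, hj, eq_comm (a := some j)]
    exact ⟨fun h => h.2, fun h => ⟨hne, h⟩⟩
  by_cases hl : σ.2.1 x = σ.2.1 y
  · refine hasIdealAnswer_of_determined hfac1 (q := .pair x y) true σ.2.2 subset_rfl
      ⟨h1, h2, h3, h4, h5, h6, h7⟩ rfl h4 (by omega) fun i π hπ => ?_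
    have : x ∈ κ ∧ y ∈ κ ∧ π.toGraph.graph.Adj x y :=
      ⟨hx, hy, (hadj i π hπ).2 ((mem_consistent.1 hπ).2.1 x (h1 ▸ hx) y (h1 ▸ hy) hl)⟩
    simp only [respond, this, and_self, decide_true]
  · refine hasIdealAnswer_of_determined hfac1 (q := .pair x y) false (insert (x, y) σ.2.2)
      (Finset.subset_insert _ _) ⟨h1, h2, h3, h4, h5, h6, h7⟩ rfl ?_ ?_ fun i π hπ => ?_
    · intro p hp
      rcases Finset.mem_insert.1 hp with rfl | hp
      · exact ⟨hx, hy, hl⟩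
      · exact h4 p hp
    · have := Finset.card_insert_le (x, y) σ.2.2
      simp only [Query.cost]
      omega
    · have : ¬ (x ∈ κ ∧ y ∈ κ ∧ π.toGraph.graph.Adj x y) := fun h =>
        (mem_consistent.1 hπ).2.2 (x, y) (Finset.mem_insert_self _ _) ((hadj i π hπ).1 h.2.2)
      simp only [respond, this, decide_false]

/-- The three losses belong to random edges, random neighbours and negative pair answers. The first
two are paid per query through `δ`, the third only once through the leaf factor `1 - δ'`. -/
theorem group_family_bound {V : Finset ℕ} {t : ℕ} (ht : 2 ≤ t) {N r : Bool → ℕ}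
    (hr : ∀ i, 2 ≤ r i) (hV : ∀ i, V.card = N i * t + r i) (b : ℕ) (hbt : 2 * b < t)
    (hbN : ∀ i, 4 * b < N i) {δ δ' : ℝ} (hδ0 : 0 ≤ δ) (hδ : δ ≤ 1) (hδ' : δ' ≤ 1)
    (hloss₁ : ∀ i, ((4 * b * (t - 1) : ℕ) : ℝ) + (2 * (r i - 1) : ℕ) ≤
      δ * (N i * (t * (t - 1)) : ℕ))
    (hloss₂ : ∀ i, 2 * (b : ℝ) ≤ δ * ((t - 2 * b : ℕ) * (N i - 2 * b : ℕ)))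
    (hloss₃ : ∀ i, (b : ℝ) ≤ δ' * (N i - 2 * b : ℕ))
    (A : Algorithm pairModel) (good : Bool → Set ℝ) (hdisj : Disjoint (good true) (good false))
    (B : ℝ) (hB : B < b + 1)
    (hA : ∀ i, ∀ π : Placement V (N i) t (r i),
      2 / 3 ≤ A.successProb π.toGraph (fun r => r ∈ good i) B) :
    ENNReal.ofReal (1 - δ) ^ b * ENNReal.ofReal (1 - δ') ≤ 2 / 3 := by
  classical
  have hfac1 : ENNReal.ofReal (1 - δ) ≤ 1 := ENNReal.ofReal_le_one.2 (by linarith)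
  have : ∀ i, Nonempty (Placement V (N i) t (r i)) := by
    intro i
    refine ⟨Fintype.equivOfCardEq ?_⟩
    simp [hV i]
  have hall : ∀ i, consistent V (N i) t (r i) ∅ id ∅ = Finset.univ := by
    intro i
    ext π
    simp [mem_consistent]
  have hpos : ∀ i, 4 * b * (t - 1) < N i * (t * (t - 1)) := by
    intro i
    rw [← mul_assoc]
    refine Nat.mul_lt_mul_of_pos_right ((hbN i).trans_le ?_) (by omega)
    exact Nat.le_mul_of_pos_right _ (by omega)
  have h := exists_common_law (M := pairModel) (ι := Bool)
    (Idx := fun i => Placement V (N i) t (r i))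
    (fun i π => π.toGraph) (State := Groups) (fun i => agreeing V (N i) t (r i))
    (fun i => weight V (N i) t (r i)) (ENNReal.ofReal (1 - δ)) (ENNReal.ofReal (1 - δ'))
    (GroupsInv V t N r b)
    (by
      rintro ⟨K, l, P⟩ κ b' ⟨h1, h2, h3, h4, h5, h6, h7⟩ i
      simp only at h1 h4 h6
      subst h1
      have e1 : (weight V (N i) t (r i) (K, l, P) : ℝ) * (N i - K.card : ℕ) ≤
          (agreeing V (N i) t (r i) (K, l, P)).card * (N i - K.card : ℕ) +
            P.card * weight V (N i) t (r i) (K, l, P) := by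
        exact_mod_cast card_consistent_mul_le (N := N i) (t := t) (r := r i) (V := V) h4
      set W := weight V (N i) t (r i) (K, l, P)
      have hNK : (0 : ℝ) < (N i - K.card : ℕ) := by
        have := hbN i
        have : 0 < N i - K.card := by omega
        exact_mod_cast this
      have e2 : (P.card : ℝ) ≤ δ' * (N i - K.card : ℕ) := by
        have hb2 : (0 : ℝ) < (N i - 2 * b : ℕ) := by
          have := hbN i
          have : 0 < N i - 2 * b := by omega
          exact_mod_cast this
        have hδ'0 : 0 ≤ δ' := by
          by_contra hneg
          push Not at hneg
          have := hloss₃ i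
          have := mul_neg_of_neg_of_pos hneg hb2
          have : (0 : ℝ) ≤ b := Nat.cast_nonneg b
          linarith
        calc (P.card : ℝ) ≤ b := by
              have : P.card ≤ b := by omega
              exact_mod_cast this
          _ ≤ _ := hloss₃ i
          _ ≤ _ := by
            refine mul_le_mul_of_nonneg_left ?_ hδ'0
            exact_mod_cast (show N i - 2 * b ≤ N i - K.card by omega)
      have e3 := mul_le_mul_of_nonneg_right e2 (Nat.cast_nonneg (α := ℝ) W)
      have e4 : (1 - δ') * (W : ℝ) ≤ (agreeing V (N i) t (r i) (K, l, P)).card := by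
        refine le_of_mul_le_mul_right ?_ hNK
        linarith
      have := ENNReal.ofReal_le_ofReal e4
      rw [ENNReal.ofReal_mul (by linarith)] at this
      simpa only [ENNReal.ofReal_natCast] using this)
    hfac1
    (by
      intro σ κ b' q hq hinv hqb
      cases q with
      | randEdge =>
        refine hasIdealAnswer_randEdge hr (fun i => ?_) hpos hinv hqb
        exact ofReal_mul_le_of_loss hδ0 hδ (hpos i).le (hloss₁ i)
      | randNbr x => exact hasIdealAnswer_randNbr hδ hδ0 ht hbt hbN hloss₂ x hinv hqb
      | degree x => exact hasIdealAnswer_degree hfac1 x hinv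
      | pair x y => exact hasIdealAnswer_pair hfac1 x y hinv hqb
      | additive S => exact hq.elim
      | fullNbr x => exact hq.elim)
    A (∅, id, ∅) ∅ b ⟨rfl, by simp, by simp, by simp, by simp, by simp, fun i => by
      simp only [weight]
      rw [hall, Finset.card_univ]; exact Fintype.card_ne_zero⟩
  refine survival_le_of_disjoint_goals (fun i (π : Placement V (N i) t (r i)) => π.toGraph)
    _ _ b A ?_ good hdisj B hB hA
  simpa only [agreeing, weight, hall, Finset.card_univ] using h

end Placement

/-! ### Choice of parameters for the lower bound with pair queries. -/

theorem ofReal_one_sub_mul_le_pow {δ : ℝ} (h : δ ≤ 1) (b : ℕ) :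
    ENNReal.ofReal (1 - b * δ) ≤ ENNReal.ofReal (1 - δ) ^ b := by
  rw [← ENNReal.ofReal_pow (by linarith)]
  apply ENNReal.ofReal_le_ofReal
  have h2 := one_add_mul_le_pow (a := -δ) (by linarith) b
  rw [← sub_eq_add_neg] at h2
  linarith

/-- In the loss per query the term 24Kb/n accounts for arcs at known vertices and for collisions,
and 1600K²/D for the star. With b far below y = n/D ≤ D, the sum over b queries is at most 1/10. -/
theorem pair_losses {K D y n t N b : ℝ} (hK : 4 ≤ K) (hD : 10000 * K ^ 2 ≤ D) (hy : 1 ≤ y)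
    (hyD : y ≤ D) (hn : n = D * y) (ht : D / (200 * K) ≤ t) (ht' : t ≤ D / (100 * K))
    (hb0 : 0 ≤ b) (hb : 100000 * K ^ 2 * b ≤ y) (hN : n ≤ 2 * (K * (N * t))) :
    50 * y ≤ N ∧ 2 * b ≤ t / 2 ∧ 4 * b ≤ N / 2 ∧
    4 * b * (t - 1) + 2 * n ≤ (24 * K * b / n + 1600 * K ^ 2 / D) * (N * (t * (t - 1))) ∧
    2 * b ≤ (24 * K * b / n + 1600 * K ^ 2 / D) * ((t - 2 * b) * (N - 2 * b)) ∧
    b ≤ 1 / 1000 * (N - 2 * b) ∧ 24 * K * b / n + 1600 * K ^ 2 / D ≤ 1 ∧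
    b * (24 * K * b / n + 1600 * K ^ 2 / D) ≤ 1 / 10 := by
  have hKpos : 0 < K := by linarith
  have hK2 : 16 ≤ K ^ 2 := by nlinarith
  have hDpos : 0 < D := by linarith
  have hypos : 0 < y := by linarith
  have hnpos : 0 < n := by rw [hn]; positivity
  have htpos : 0 < t := lt_of_lt_of_le (by positivity) ht
  rw [div_le_iff₀ (by positivity)] at ht
  rw [le_div_iff₀ (by positivity)] at ht'
  have hb1 : 1600000 * b ≤ y := by
    have := mul_le_mul_of_nonneg_right hK2 hb0
    linarith
  have hKb : 100000 * K * b ≤ y := by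
    have : K * b ≤ K ^ 2 * b := mul_le_mul_of_nonneg_right (by nlinarith) hb0
    linarith
  have h1 : 50 * y ≤ N := by
    have e : D * (100 * y) ≤ D * (2 * N) := by
      have hN0 : 0 ≤ N := by
        by_contra hneg
        push Not at hneg
        have : K * (N * t) < 0 := mul_neg_of_pos_of_neg hKpos (mul_neg_of_neg_of_pos hneg htpos)
        linarith
      have e2 : N * (t * (100 * K)) ≤ N * D := mul_le_mul_of_nonneg_left ht' hN0
      have e3 : n ≤ 2 * (K * (N * t)) := hN
      rw [hn] at e3
      linarith
    have := le_of_mul_le_mul_left e hDpos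
    linarith
  have hNpos : 0 < N := by linarith
  have h2 : 2 * b ≤ t / 2 := by
    have e : 200 * K * (4 * b) ≤ 200 * K * t := by linarith
    have := le_of_mul_le_mul_left e (by positivity)
    linarith
  have h3 : 4 * b ≤ N / 2 := by linarith
  have hA0 : 0 ≤ 24 * K * b / n := by positivity
  have hB0 : 0 ≤ 1600 * K ^ 2 / D := by positivity
  have ht1 : 2 * D ≤ 800 * K * (t - 1) := by
    have e : 800 * K ≤ 2 * D := by nlinarith
    linarith
  have ht1pos : 0 < t - 1 := by
    by_contra hneg
    push Not at hneg
    have : 800 * K * (t - 1) ≤ 0 := mul_nonpos_of_nonneg_of_nonpos (by positivity) hneg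
    linarith
  refine ⟨h1, h2, h3, ?_, ?_, by linarith, ?_, ?_⟩
  · have e1 : 12 * b * (t - 1) ≤ 24 * K * b / n * (N * (t * (t - 1))) := by
      rw [div_mul_eq_mul_div, le_div_iff₀ hnpos]
      have := mul_le_mul_of_nonneg_left hN (show 0 ≤ 12 * b * (t - 1) by positivity)
      linarith
    have e2 : 2 * n ≤ 1600 * K ^ 2 / D * (N * (t * (t - 1))) := by
      rw [div_mul_eq_mul_div, le_div_iff₀ hDpos]
      have e3 := mul_le_mul_of_nonneg_left ht1 hnpos.le
      have e4 := mul_le_mul_of_nonneg_right hN (show 0 ≤ 800 * K * (t - 1) by positivity)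
      linarith
    have e3 : 0 ≤ b * (t - 1) := by positivity
    rw [add_mul]
    linarith
  · have e1 : t / 2 * (N / 2) ≤ (t - 2 * b) * (N - 2 * b) :=
      mul_le_mul (by linarith) (by linarith) (by positivity) (by linarith)
    calc 2 * b ≤ 24 * K * b / n * (t / 2 * (N / 2)) := by
          rw [div_mul_eq_mul_div, le_div_iff₀ hnpos]
          have := mul_le_mul_of_nonneg_left hN hb0
          have h4 : 0 ≤ K * b * (t * N) := by positivity
          linarith
      _ ≤ (24 * K * b / n + 1600 * K ^ 2 / D) * (t / 2 * (N / 2)) := by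
          apply mul_le_mul_of_nonneg_right (by linarith) (by positivity)
      _ ≤ _ := by apply mul_le_mul_of_nonneg_left e1 (by positivity)
  · have e1 : 24 * K * b / n ≤ 1 / 10 := by
      rw [div_le_iff₀ hnpos, hn]
      have : 1 * y ≤ D * y := mul_le_mul_of_nonneg_right (by linarith) hypos.le
      linarith
    have e2 : 1600 * K ^ 2 / D ≤ 1 / 2 := by
      rw [div_le_iff₀ hDpos]; linarith
    linarith
  · have e1 : 24 * K * b / n * b ≤ 1 / 100 := by
      rw [div_mul_eq_mul_div, div_le_iff₀ hnpos, hn]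
      have a1 : K * b * b ≤ y * y := by
        have : b ≤ y := by linarith
        exact mul_le_mul (by linarith) this hb0 hypos.le
      have a2 : y * y ≤ D * y := mul_le_mul_of_nonneg_right hyD hypos.le
      have a3 : 100000 * K * b * b ≤ y * y := mul_le_mul hKb (by linarith) hb0 hypos.le
      linarith
    have e2 : 1600 * K ^ 2 / D * b ≤ 2 / 100 := by
      rw [div_mul_eq_mul_div, div_le_iff₀ hDpos]
      linarith
    linarith

-- Cliques of size about D/(100K) give average degrees within a constant factor of D. There are at
-- least 50n/D of them, so few pair queries rarely hit a collision.
open Placement in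
theorem pair_lower_bound (c : ℝ) (hc : 1 ≤ c) : ∃ (c₀ c₁ : ℝ) (N : ℕ), 0 < c₀ ∧ 0 < c₁ ∧
    ∀ (n : ℕ), N ≤ n → ∀ V : Finset ℕ, V.card = n →
      ∀ D : ℝ, Real.sqrt n ≤ D → D ≤ n →
        ∀ (A : Algorithm pairModel) (B : ℝ),
          (∀ G : NetGraph, G.verts = V → G.NoIsolated →
            c₁ * D ≤ G.avgDegree → G.avgDegree ≤ D →
            2 / 3 ≤ A.successProb G (IsFactorApprox c G.avgDegree) B) →
          c₀ * min (Real.sqrt n) ((n : ℝ) / D) ≤ B := by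
  obtain ⟨K, hK⟩ := exists_nat_ge (4 * c ^ 2)
  have hK4 : (4 : ℝ) ≤ K := by nlinarith
  have hK4' : 4 ≤ K := by exact_mod_cast hK4
  refine ⟨1 / (100000 * K ^ 2), 1 / (800 * K ^ 2), (10000 * K ^ 2) ^ 2, by positivity,
    by positivity, ?_⟩
  intro n hn V hV D hD hDn A B hA
  by_contra hlt
  push Not at hlt
  have hKpos : (0 : ℝ) < K := by linarith
  have hK2 : (16 : ℝ) ≤ K ^ 2 := by nlinarith
  have hKK : 4 * (K : ℝ) ≤ K ^ 2 := by nlinarith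
  have hDK : 10000 * (K : ℝ) ^ 2 ≤ D := by
    refine le_trans ?_ hD
    apply Real.le_sqrt_of_sq_le
    exact_mod_cast hn
  have hDpos : 0 < D := by linarith
  have hn0 : (0 : ℝ) < n := by linarith
  set y : ℝ := n / D with hy
  have hnD : (n : ℝ) = D * y := by rw [hy]; field_simp
  have hy1 : 1 ≤ y := by rw [hy, le_div_iff₀ hDpos]; linarith
  -- This is where D ≥ √n enters; it bounds the quadratic loss b²/n by way of y² ≤ n.
  have hyD : y ≤ D := by
    rw [hy, div_le_iff₀ hDpos]
    have := Real.sq_sqrt hn0.le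
    have h2 := mul_le_mul hD hD (Real.sqrt_nonneg _) hDpos.le
    rw [Real.mul_self_sqrt hn0.le] at h2
    exact h2
  set b := ⌊B⌋₊ with hb
  have hBb : B < b + 1 := Nat.lt_floor_add_one B
  have hby : 100000 * (K : ℝ) ^ 2 * b ≤ y := by
    rcases le_or_gt 0 B with h | h
    · have h1 : (b : ℝ) ≤ B := Nat.floor_le h
      have h2 : B ≤ 1 / (100000 * K ^ 2) * y :=
        hlt.le.trans (mul_le_mul_of_nonneg_left (min_le_right _ _) (by positivity))
      have h3 : (b : ℝ) ≤ y / (100000 * K ^ 2) := by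
        rw [div_eq_inv_mul, inv_eq_one_div]; linarith
      rw [le_div_iff₀ (by positivity)] at h3
      linarith
    · rw [hb, Nat.floor_of_nonpos h.le]; push_cast; linarith
  -- Small enough that the cliques and the star together have average degree at most D.
  set t := ⌊D / (100 * K)⌋₊ with ht
  have htD : (t : ℝ) ≤ D / (100 * K) := Nat.floor_le (by positivity)
  have hbig : 400 ≤ D / (100 * K) := by
    rw [le_div_iff₀ (by positivity)]
    linarith
  have htD' : D / (200 * K) ≤ t := by
    have h1 := Nat.lt_floor_add_one (D / (100 * K))
    have h2 : D / (200 * K) = D / (100 * K) / 2 := by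
      rw [div_div]; congr 1; ring
    rw [← ht] at h1
    rw [h2]
    linarith
  have ht200 : 200 ≤ t := by
    have h1 := Nat.lt_floor_add_one (D / (100 * K))
    rw [← ht] at h1
    have : ((199 : ℕ) : ℝ) < t := by push_cast; linarith
    exact_mod_cast this
  have htpos : (0 : ℝ) < t := by
    have : 0 < t := by omega
    exact_mod_cast this
  set N₁ := (n - 2) / t with hN₁
  set N₂ := N₁ / K with hN₂
  have hN₁a : t * N₁ ≤ n - 2 := Nat.mul_div_le _ _
  have hN₁b : n - 2 < t * N₁ + t := by
    have := Nat.lt_mul_div_succ (n - 2) (show 0 < t by omega)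
    rw [mul_add, mul_one] at this; exact this
  have hN₂a : K * N₂ ≤ N₁ := Nat.mul_div_le _ _
  have hN₂b : N₁ < K * N₂ + K := by
    have := Nat.lt_mul_div_succ N₁ (show 0 < K by omega)
    rw [mul_add, mul_one] at this; exact this
  have hN₂₁ : N₂ ≤ N₁ := Nat.div_le_self _ _
  have hsmall' : 2 * ((K + 2) * t + 2) ≤ n := by
    have h1 : (t : ℝ) * (100 * K) ≤ n := by
      rw [le_div_iff₀ (by positivity)] at htD
      linarith
    have h2 : 4 * (t : ℝ) ≤ K * t := mul_le_mul_of_nonneg_right hK4 htpos.le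
    have h3 : (200 : ℝ) ≤ t := by exact_mod_cast ht200
    have : ((2 * ((K + 2) * t + 2) : ℕ) : ℝ) ≤ n := by push_cast; linarith
    exact_mod_cast this
  have hn2 : 2 ≤ n := by omega
  have hKN₂ : n ≤ 2 * (K * (N₂ * t)) := by
    have : t * N₁ + t ≤ t * (K * N₂ + K) := by
      rw [← Nat.mul_succ]; exact Nat.mul_le_mul_left _ hN₂b
    have e : t * (K * N₂ + K) = K * (N₂ * t) + K * t := by ring
    have e2 : (K + 2) * t = K * t + 2 * t := by ring
    rw [e] at this
    omega
  have hKN₂' : (n : ℝ) ≤ 2 * (K * (N₂ * t)) := by exact_mod_cast hKN₂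
  have hNfull : ∀ N' : ℕ, N₂ ≤ N' → (n : ℝ) ≤ 2 * (K * (N' * t)) := by
    intro N' hN'
    refine hKN₂'.trans ?_
    have : (N₂ : ℝ) ≤ N' := by exact_mod_cast hN'
    gcongr
  have hall := fun (N' : ℕ) (hN' : N₂ ≤ N') => pair_losses hK4 hDK hy1 hyD hnD htD' htD
    (Nat.cast_nonneg b) hby (hNfull N' hN')
  set δ : ℝ := 24 * K * b / n + 1600 * K ^ 2 / D with hδ
  have hδ0 : 0 ≤ δ := by positivity
  obtain ⟨hl1, hl2, hl3, -, -, -, hδ1, hbδ⟩ := hall N₂ le_rfl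
  have hbt : 2 * b < t := by
    have : (2 * b : ℝ) < t := by linarith
    exact_mod_cast this
  have hbN₂ : 4 * b < N₂ := by
    have : (4 * b : ℝ) < N₂ := by linarith
    exact_mod_cast this
  have ht1c : ((t - 1 : ℕ) : ℝ) = t - 1 := by rw [Nat.cast_sub (by omega)]; push_cast; rfl
  have ht2c : ((t - 2 * b : ℕ) : ℝ) = t - 2 * b := by rw [Nat.cast_sub hbt.le]; push_cast; rfl
  let N : Bool → ℕ := fun i => cond i N₁ N₂
  let r : Bool → ℕ := fun i => n - N i * t
  have hNi : ∀ i, N₂ ≤ N i ∧ N i ≤ N₁ := by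
    rintro (_ | _)
    · exact ⟨le_rfl, hN₂₁⟩
    · exact ⟨hN₂₁, le_rfl⟩
  have hNt : ∀ i, N i * t ≤ n - 2 := fun i => by
    refine le_trans ?_ hN₁a
    rw [mul_comm]
    exact Nat.mul_le_mul_left _ (hNi i).2
  have hr : ∀ i, 2 ≤ r i := fun i => by have := hNt i; simp only [r]; omega
  have hN2c : ∀ i, ((N i - 2 * b : ℕ) : ℝ) = N i - 2 * b := by
    intro i
    have := (hNi i).1
    rw [Nat.cast_sub (by omega)]; push_cast; rfl
  have ht1pos : D / (400 * K) ≤ (t : ℝ) - 1 := by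
    have h2 : D / (400 * K) = D / (100 * K) / 4 := by
      rw [div_div]; congr 1; ring
    have h3 : D / (200 * K) = D / (100 * K) / 2 := by
      rw [div_div]; congr 1; ring
    linarith
  have hdeg : ∀ i, 1 / (800 * (K : ℝ) ^ 2) * D ≤ familyDegree n (N i) t (r i) ∧
      familyDegree n (N i) t (r i) ≤ D := by
    intro i
    have e1 : ((2 * (r i - 1) : ℕ) : ℝ) ≤ 2 * n := by
      have : 2 * (r i - 1) ≤ 2 * n := by simp only [r]; omega
      exact_mod_cast this
    have e2 : ((N i * (t * (t - 1)) : ℕ) : ℝ) = N i * t * (t - 1) := by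
      push_cast [-Nat.cast_sub]; rw [ht1c]; ring
    have e3 : (0 : ℝ) ≤ t - 1 := le_trans (by positivity) ht1pos
    rw [familyDegree, Nat.cast_add, e2]
    constructor
    · rw [le_div_iff₀ hn0]
      have h1 := mul_le_mul_of_nonneg_right (hNfull (N i) (hNi i).1) e3
      have h2 : (n : ℝ) * (D / (400 * K)) ≤ n * (t - 1) :=
        mul_le_mul_of_nonneg_left ht1pos hn0.le
      have h3 : 1 / (800 * (K : ℝ) ^ 2) * D * n = n * (D / (400 * K)) / (2 * K) := by
        field_simp; ring
      have h4 : (0 : ℝ) ≤ (2 * (r i - 1) : ℕ) := Nat.cast_nonneg _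
      rw [h3, div_le_iff₀ (by positivity)]
      have h5 := mul_nonneg h4 (show (0 : ℝ) ≤ 2 * K by positivity)
      linarith
    · rw [div_le_iff₀ hn0]
      have h1 : ((N i * t : ℕ) : ℝ) ≤ n := by
        have := hNt i
        exact_mod_cast (by omega : N i * t ≤ n)
      push_cast at h1
      have h2 := mul_le_mul_of_nonneg_right h1 e3
      have h3 : (t : ℝ) + 1 ≤ D := by
        have : D / (100 * K) ≤ D / 2 := by
          apply div_le_div_of_nonneg_left hDpos.le (by norm_num) (by linarith)
        linarith
      have h4 := mul_le_mul_of_nonneg_right h3 hn0.le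
      linarith
  have key := group_family_bound (t := t) (N := N) (r := r) (V := V) (by omega) hr
    (fun i => by have := hNt i; simp only [r]; omega) b hbt
    (fun i => hbN₂.trans_le (hNi i).1) hδ0 hδ1 (δ' := 1 / 1000) (by norm_num)
    (fun i => by
      have h := (hall (N i) (hNi i).1).2.2.2.1
      have e1 : ((2 * (r i - 1) : ℕ) : ℝ) ≤ 2 * n := by
        have : 2 * (r i - 1) ≤ 2 * n := by simp only [r]; omega
        exact_mod_cast this
      push_cast [-Nat.cast_sub] at e1 ⊢
      rw [ht1c]
      linarith)
    (fun i => by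
      have h := (hall (N i) (hNi i).1).2.2.2.2.1
      rw [ht2c, hN2c i]
      exact h)
    (fun i => by
      have h := (hall (N i) (hNi i).1).2.2.2.2.2.1
      rw [hN2c i]
      exact h)
    A (fun i => {y | IsFactorApprox c (familyDegree n (N i) t (r i)) y})
    (disjoint_factorApprox_familyDegree hc (by omega) hK (by
      change N₂ * K ≤ N₁
      rw [mul_comm]; exact hN₂a) (Nat.sub_le _ _) (by
      change 4 * c ^ 2 * n ≤ (N₁ * (t * (t - 1)) : ℕ)
      have h0 : t ≤ (K + 2) * t := Nat.le_mul_of_pos_left _ (by omega)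
      have h1 : n ≤ 2 * (t * N₁) := by omega
      have h1' : (n : ℝ) ≤ 2 * (t * N₁) := by exact_mod_cast h1
      push_cast [-Nat.cast_sub]
      rw [ht1c]
      have h2 : 4 * c ^ 2 * n ≤ K * (2 * (t * N₁)) :=
        mul_le_mul hK h1' (by positivity) (by positivity)
      have h3 : (2 * K : ℝ) ≤ t - 1 := by
        refine le_trans ?_ ht1pos
        rw [le_div_iff₀ (by positivity)]
        linarith
      have h4 := mul_le_mul_of_nonneg_right h3 (show (0 : ℝ) ≤ t * N₁ by positivity)
      linarith))
    B hBb
    (fun i π => by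
      have hd : π.toGraph.avgDegree = familyDegree n (N i) t (r i) := by
        rw [π.avgDegree_eq (by have := hr i; omega), hV]; rfl
      have h1 := hA π.toGraph rfl (π.noIsolated (by omega) (hr i))
        (by rw [hd]; exact (hdeg i).1) (by rw [hd]; exact (hdeg i).2)
      rw [hd] at h1
      exact h1)
  refine absurd key (not_le.2 ?_)
  -- The surviving mass is at least (9/10)(999/1000).
  calc (2 : ℝ≥0∞) / 3 = ENNReal.ofReal (2 / 3) := by
        rw [ENNReal.ofReal_div_of_pos (by norm_num)]; norm_num
    _ < ENNReal.ofReal ((1 - b * δ) * (1 - 1 / 1000)) :=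
        (ENNReal.ofReal_lt_ofReal_iff_of_nonneg (by norm_num)).2 (by linarith)
    _ = ENNReal.ofReal (1 - b * δ) * ENNReal.ofReal (1 - 1 / 1000) :=
        ENNReal.ofReal_mul (by linarith)
    _ ≤ _ := mul_le_mul_left (ofReal_one_sub_mul_le_pow hδ1 b) _

/-! ### Averages over independent random edges. -/

open Classical in
/-- The indicator of a proposition, as a real number. -/
noncomputable def indicator (p : Prop) : ℝ := if p then 1 else 0

theorem indicator_pos {p : Prop} (h : p) : indicator p = 1 := if_pos h

theorem indicator_neg {p : Prop} (h : ¬p) : indicator p = 0 := if_neg h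

theorem indicator_nonneg (p : Prop) : 0 ≤ indicator p := by
  rw [indicator]; split_ifs <;> norm_num

theorem indicator_le_one (p : Prop) : indicator p ≤ 1 := by
  rw [indicator]; split_ifs <;> norm_num

namespace NetGraph

variable (G : NetGraph)

/-- The average over a uniformly random edge. -/
noncomputable def avg (f : Sym2 ℕ → ℝ) : ℝ := (G.edges.card : ℝ)⁻¹ * ∑ e ∈ G.edges, f e

/-- The average over a list of `k` independent uniformly random edges. -/
noncomputable def tupleAvg : ℕ → (List (Sym2 ℕ) → ℝ) → ℝ
  | 0, F => F []
  | k + 1, F => G.avg fun e => tupleAvg k fun l => F (e :: l)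

variable {G}

theorem avg_mono {f g : Sym2 ℕ → ℝ} (h : ∀ e ∈ G.edges, f e ≤ g e) : G.avg f ≤ G.avg g :=
  mul_le_mul_of_nonneg_left (Finset.sum_le_sum h) (by positivity)

theorem avg_congr {f g : Sym2 ℕ → ℝ} (h : ∀ e ∈ G.edges, f e = g e) : G.avg f = G.avg g := by
  rw [avg, avg, Finset.sum_congr rfl h]

theorem avg_add (f g : Sym2 ℕ → ℝ) : G.avg (fun e => f e + g e) = G.avg f + G.avg g := by
  simp only [avg, Finset.sum_add_distrib, mul_add]

theorem avg_mul_left (a : ℝ) (f : Sym2 ℕ → ℝ) : G.avg (fun e => a * f e) = a * G.avg f := by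
  simp only [avg, ← Finset.mul_sum]
  ring

theorem avg_const (hG : G.edges.Nonempty) (a : ℝ) : G.avg (fun _ => a) = a := by
  have : (G.edges.card : ℝ) ≠ 0 := by exact_mod_cast (Finset.card_pos.2 hG).ne'
  rw [avg, Finset.sum_const, nsmul_eq_mul, inv_mul_cancel_left₀ this]

theorem avg_sum {ι : Type*} (s : Finset ι) (f : ι → Sym2 ℕ → ℝ) :
    G.avg (fun e => ∑ i ∈ s, f i e) = ∑ i ∈ s, G.avg (f i) := by
  simp only [avg]
  rw [Finset.sum_comm, Finset.mul_sum]

theorem tupleAvg_mono {k : ℕ} {F H : List (Sym2 ℕ) → ℝ}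
    (h : ∀ l, l.length = k → (∀ e ∈ l, e ∈ G.edges) → F l ≤ H l) :
    G.tupleAvg k F ≤ G.tupleAvg k H := by
  induction k generalizing F H with
  | zero => exact h [] rfl (by simp)
  | succ k ih =>
    refine avg_mono fun e he => ih fun l hl hle => h (e :: l) (by simp [hl]) ?_
    simpa [he] using hle

theorem tupleAvg_add {k : ℕ} (F H : List (Sym2 ℕ) → ℝ) :
    G.tupleAvg k (fun l => F l + H l) = G.tupleAvg k F + G.tupleAvg k H := by
  induction k generalizing F H with
  | zero => rfl
  | succ k ih => simp only [tupleAvg, ih, avg_add]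

theorem tupleAvg_mul_left {k : ℕ} (a : ℝ) (F : List (Sym2 ℕ) → ℝ) :
    G.tupleAvg k (fun l => a * F l) = a * G.tupleAvg k F := by
  induction k generalizing F with
  | zero => rfl
  | succ k ih => simp only [tupleAvg, ih, avg_mul_left]

theorem tupleAvg_const (hG : G.edges.Nonempty) {k : ℕ} (a : ℝ) :
    G.tupleAvg k (fun _ => a) = a := by
  induction k with
  | zero => rfl
  | succ k ih => simp only [tupleAvg, ih, avg_const hG]

theorem tupleAvg_nonneg {k : ℕ} {F : List (Sym2 ℕ) → ℝ} (hG : G.edges.Nonempty)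
    (h : ∀ l, 0 ≤ F l) : 0 ≤ G.tupleAvg k F := by
  rw [← tupleAvg_const (k := k) hG 0]
  exact tupleAvg_mono fun l _ _ => h l

/-- The draws that are not looked at average out. -/
theorem tupleAvg_take (hG : G.edges.Nonempty) {k m : ℕ} (F : List (Sym2 ℕ) → ℝ) :
    G.tupleAvg k (fun l => F (l.take m)) = G.tupleAvg (min m k) F := by
  induction k generalizing F m with
  | zero => simp [tupleAvg]
  | succ k ih =>
    cases m with
    | zero =>
      simp only [List.take_zero, Nat.zero_min]
      exact tupleAvg_const hG _
    | succ m =>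
      rw [Nat.succ_min_succ]
      simp only [tupleAvg, List.take_succ_cons]
      exact avg_congr fun e _ => ih fun l => F (e :: l)

theorem tupleAvg_avg_comm {k : ℕ} (F : List (Sym2 ℕ) → Sym2 ℕ → ℝ) :
    G.tupleAvg k (fun l => G.avg (F l)) = G.avg fun e => G.tupleAvg k fun l => F l e := by
  induction k generalizing F with
  | zero => rfl
  | succ k ih =>
    simp only [tupleAvg]
    rw [avg_congr fun e _ => ih fun l => F (e :: l)]
    simp only [avg, Finset.mul_sum]
    rw [Finset.sum_comm]

/-- The second moment of a sum of independent terms about an arbitrary point. -/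
theorem tupleAvg_sum_sub_sq (hG : G.edges.Nonempty) (k : ℕ) (φ : Sym2 ℕ → ℝ) (a : ℝ) :
    G.tupleAvg k (fun l => ((l.map φ).sum - a) ^ 2) =
      k * (G.avg (fun e => φ e ^ 2) - G.avg φ ^ 2) + (k * G.avg φ - a) ^ 2 := by
  induction k generalizing a with
  | zero => simp [tupleAvg]
  | succ k ih =>
    simp only [tupleAvg, List.map_cons, List.sum_cons]
    have h1 : ∀ e, (G.tupleAvg k fun l => (φ e + (l.map φ).sum - a) ^ 2) =
        (k * (G.avg (fun e => φ e ^ 2) - G.avg φ ^ 2) + (k * G.avg φ - a) ^ 2) +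
          (2 * (k * G.avg φ - a) * φ e + φ e ^ 2) := by
      intro e
      -- The centre is arbitrary in the induction so that it can absorb the first draw.
      have := ih (a - φ e)
      rw [show (fun l : List (Sym2 ℕ) => (φ e + (l.map φ).sum - a) ^ 2) =
        fun l => ((l.map φ).sum - (a - φ e)) ^ 2 from funext fun l => by ring, this]
      ring
    rw [avg_congr fun e _ => h1 e, avg_add, avg_const hG, avg_add, avg_mul_left]
    push_cast
    ring

/-- Markov's inequality. -/
theorem tupleAvg_indicator_le {k : ℕ} (P : List (Sym2 ℕ) → Prop)
    (F : List (Sym2 ℕ) → ℝ) {b : ℝ} (hb : 0 < b) (hF : ∀ l, 0 ≤ F l)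
    (h : ∀ l, l.length = k → (∀ e ∈ l, e ∈ G.edges) → P l → b ≤ F l) :
    G.tupleAvg k (fun l => indicator (P l)) ≤ G.tupleAvg k F / b := by
  rw [div_eq_inv_mul, ← tupleAvg_mul_left]
  refine tupleAvg_mono fun l hl hle => ?_
  by_cases hP : P l
  · rw [indicator_pos hP, ← div_eq_inv_mul, one_le_div hb]
    exact h l hl hle hP
  · rw [indicator_neg hP]
    exact mul_nonneg (by positivity) (hF l)

end NetGraph

/-! ### Failure probabilities and the building blocks of the estimator. -/

namespace Algorithm

variable {M : Set Query}

/-- The probability that the output and the cost, increased by `c`, do not satisfy `R`. -/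
noncomputable def failProb (A : Algorithm M) (G : NetGraph) (R : ℝ → ℕ → Prop) (κ : Finset ℕ)
    (c : ℕ) : ℝ :=
  ((A.runFrom G κ).toOuterMeasure {p | ¬ R p.1 (p.2 + c)}).toReal

theorem toOuterMeasure_le_one {α : Type*} (p : PMF α) (s : Set α) : p.toOuterMeasure s ≤ 1 := by
  have : p.toOuterMeasure Set.univ = 1 := by
    rw [PMF.toOuterMeasure_apply_eq_one_iff]; exact Set.subset_univ _
  rw [← this]
  exact MeasureTheory.measure_mono (Set.subset_univ _)

variable (G : NetGraph) (R : ℝ → ℕ → Prop) (κ : Finset ℕ) (c : ℕ)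

theorem failProb_nonneg (A : Algorithm M) : 0 ≤ A.failProb G R κ c := ENNReal.toReal_nonneg

theorem failProb_le_one (A : Algorithm M) : A.failProb G R κ c ≤ 1 :=
  ENNReal.toReal_le_of_le_ofReal zero_le_one (by
    rw [ENNReal.ofReal_one]; exact toOuterMeasure_le_one _ _)

open Classical in
theorem failProb_output (r : ℝ) :
    (output r : Algorithm M).failProb G R κ c = if R r c then 0 else 1 := by
  simp only [failProb, runFrom]
  rw [PMF.toOuterMeasure_pure_apply]
  simp only [Set.mem_ofPred_eq, zero_add]
  split_ifs <;> simp_all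

theorem failProb_query_of_pure {q : Query} (hq : q ∈ M) (next : q.Answer → Algorithm M)
    {a : q.Answer} (h : respond G κ q = PMF.pure a) :
    (query q hq next).failProb G R κ c =
      (next a).failProb G R (learn κ q a) (c + q.cost) := by
  simp only [failProb, runFrom]
  rw [h, PMF.pure_bind, PMF.toOuterMeasure_map_apply]
  congr 2
  ext p
  simp only [Set.mem_preimage, Set.mem_ofPred_eq]
  rw [add_assoc, add_comm q.cost]

theorem failProb_randEdge (hG : G.edges.Nonempty) (hq : Query.randEdge ∈ M)
    (next : Sym2 ℕ → Algorithm M) :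
    (query .randEdge hq next).failProb G R κ c =
      G.avg fun e => (next e).failProb G R (κ ∪ e.toFinset) (c + 1) := by
  have hresp : respond G κ .randEdge = PMF.uniformOfFinset G.edges hG := dif_pos hG
  have hle : ∀ e : Sym2 ℕ, (((next e).runFrom G (κ ∪ e.toFinset)).map
      fun p => (p.1, p.2 + 1)).toOuterMeasure {p | ¬ R p.1 (p.2 + c)} ≠ ⊤ := fun e =>
    ne_top_of_le_ne_top ENNReal.one_ne_top (toOuterMeasure_le_one _ _)
  have hrun : (query .randEdge hq next).runFrom G κ = (PMF.uniformOfFinset G.edges hG).bind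
      fun e : Sym2 ℕ => ((next e).runFrom G (κ ∪ e.toFinset)).map fun p => (p.1, p.2 + 1) := by
    rw [← hresp]
    rfl
  rw [failProb, hrun, PMF.toOuterMeasure_bind_apply, PMF.tsum_uniformOfFinset_mul,
    ENNReal.toReal_mul, ENNReal.toReal_inv, ENNReal.toReal_natCast,
    ENNReal.toReal_sum fun e _ => hle e, NetGraph.avg]
  congr 1
  refine Finset.sum_congr rfl fun e _ => ?_
  rw [PMF.toOuterMeasure_map_apply, failProb]
  congr 2
  ext p
  simp only [Set.mem_preimage, Set.mem_ofPred_eq]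
  rw [add_assoc, add_comm 1 c]

/-- A bound on the failure probability gives a lower bound on the success probability. -/
theorem lt_successProb (A : Algorithm M) (good : ℝ → Prop) (B : ℝ)
    (h : A.failProb G (fun r c => good r ∧ (c : ℝ) ≤ B) ∅ 0 < 1 / 100) :
    99 / 100 < A.successProb G good B := by
  have h1 : (A.run G).toOuterMeasure {p | good p.1 ∧ (p.2 : ℝ) ≤ B} +
      (A.run G).toOuterMeasure {p | ¬ (good p.1 ∧ (p.2 : ℝ) ≤ B)} = 1 := by
    simp only [PMF.toOuterMeasure_apply]
    rw [← ENNReal.tsum_add, ← PMF.tsum_coe (A.run G)]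
    congr 1
    funext p
    by_cases hp : good p.1 ∧ (p.2 : ℝ) ≤ B
    · rw [Set.indicator_of_mem (show p ∈ {p : ℝ × ℕ | good p.1 ∧ (p.2 : ℝ) ≤ B} from hp),
        Set.indicator_of_notMem (show p ∉ {p : ℝ × ℕ | ¬ (good p.1 ∧ (p.2 : ℝ) ≤ B)} from
          fun h => h hp), add_zero]
    · rw [Set.indicator_of_notMem (show p ∉ {p : ℝ × ℕ | good p.1 ∧ (p.2 : ℝ) ≤ B} from hp),
        Set.indicator_of_mem (show p ∈ {p : ℝ × ℕ | ¬ (good p.1 ∧ (p.2 : ℝ) ≤ B)} from hp),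
        zero_add]
  simp only [failProb, add_zero] at h
  change ((A.run G).toOuterMeasure {p | ¬ (good p.1 ∧ (p.2 : ℝ) ≤ B)}).toReal < 1 / 100 at h
  have hne : ∀ s, (A.run G).toOuterMeasure s ≠ ⊤ := fun s =>
    ne_top_of_le_ne_top ENNReal.one_ne_top (toOuterMeasure_le_one _ _)
  have h2 := congrArg ENNReal.toReal h1
  rw [ENNReal.toReal_add (hne _) (hne _), ENNReal.toReal_one] at h2
  rw [successProb, ← ENNReal.toReal_lt_toReal (ENNReal.div_ne_top (by norm_num) (by norm_num))
    (hne _)]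
  rw [ENNReal.toReal_div]
  norm_num
  linarith

end Algorithm

/-- An edge with its end points and their degrees. -/
abbrev EdgeRecord : Type := (ℕ × ℕ) × (ℕ × ℕ)

/-- The end points of the edge `e` and their degrees. -/
noncomputable def NetGraph.record (G : NetGraph) (e : Sym2 ℕ) : EdgeRecord :=
  (((Quot.out e).1, (G.nbrs (Quot.out e).1).card), ((Quot.out e).2, (G.nbrs (Quot.out e).2).card))

theorem Sym2.mk_out (e : Sym2 ℕ) : s((Quot.out e).1, (Quot.out e).2) = e := Quot.out_eq e

namespace Algorithm

theorem randEdge_mem : Query.randEdge ∈ additiveModel := trivial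

theorem degree_mem (x : ℕ) : Query.degree x ∈ additiveModel := trivial

theorem additive_mem (S : Finset ℕ) : Query.additive S ∈ additiveModel := trivial

/-- Draw a random edge and ask for the degrees of its end points. -/
noncomputable def observe (next : EdgeRecord → Algorithm additiveModel) : Algorithm additiveModel :=
  .query .randEdge randEdge_mem fun e : Sym2 ℕ =>
    .query (.degree (Quot.out e).1) (degree_mem _) fun du : ℕ =>
      .query (.degree (Quot.out e).2) (degree_mem _) fun dv : ℕ =>
        next (((Quot.out e).1, du), ((Quot.out e).2, dv))

/-- Draw `k` random edges and ask for the degrees of their end points. -/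
noncomputable def collect :
    ℕ → (List EdgeRecord → Algorithm additiveModel) → Algorithm additiveModel
  | 0, next => next []
  | k + 1, next => observe fun o => collect k fun L => next (o :: L)

/-- Ask for the numbers of edges inside the sets of a list, and form a linear combination. -/
noncomputable def askSum :
    List (ℝ × Finset ℕ) → ℝ → (ℝ → Algorithm additiveModel) → Algorithm additiveModel
  | [], acc, next => next acc
  | (a, S) :: L, acc, next =>
      .query (.additive S) (additive_mem S) fun k : ℕ => askSum L (acc + a * k) next

/-- The sum of the reciprocal degrees of the end points. -/
noncomputable def recip (o : EdgeRecord) : ℝ := 1 / (o.1.2 : ℝ) + 1 / (o.2.2 : ℝ)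

open Classical in
/-- Draw random edges until the sum of the reciprocal degrees of their end points reaches `T`, and
output a function of their number; after `fuel` edges continue with `K`. -/
noncomputable def untilSum (T : ℝ) (fin : ℕ → ℝ) (K : Algorithm additiveModel) :
    ℕ → ℝ → ℕ → Algorithm additiveModel
  | 0, _, _ => K
  | fuel + 1, acc, cnt => observe fun o =>
      if T ≤ acc + recip o then .output (fin (cnt + 1))
      else untilSum T fin K fuel (acc + recip o) (cnt + 1)

variable (G : NetGraph) (R : ℝ → ℕ → Prop)

theorem failProb_degree {x : ℕ} {κ : Finset ℕ} (hx : x ∈ κ) (c : ℕ)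
    (next : ℕ → Algorithm additiveModel) :
    (query (.degree x) (degree_mem x) next : Algorithm additiveModel).failProb G R κ c =
      (next (G.nbrs x).card).failProb G R κ (c + 1) :=
  failProb_query_of_pure G R κ c (q := .degree x) (degree_mem x) next
    (congrArg PMF.pure (if_pos hx))

theorem failProb_additive {S : Finset ℕ} {κ : Finset ℕ} (hS : S ⊆ κ) (c : ℕ)
    (next : ℕ → Algorithm additiveModel) :
    (query (.additive S) (additive_mem S) next : Algorithm additiveModel).failProb G R κ c =
      (next (G.edgesWithin S).card).failProb G R κ (c + S.card) :=
  failProb_query_of_pure G R κ c (q := .additive S) (additive_mem S) next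
    (congrArg PMF.pure (if_pos hS))

theorem failProb_observe (hG : G.edges.Nonempty) (κ : Finset ℕ) (c : ℕ)
    (next : EdgeRecord → Algorithm additiveModel) :
    (observe next).failProb G R κ c =
      G.avg fun e => (next (G.record e)).failProb G R (κ ∪ e.toFinset) (c + 3) := by
  refine (failProb_randEdge G R κ c hG _ _).trans ?_
  refine NetGraph.avg_congr fun e _ => ?_
  have h1 : (Quot.out e).1 ∈ κ ∪ e.toFinset := by
    refine Finset.mem_union_right _ (Sym2.mem_toFinset.2 ?_)
    exact Sym2.out_fst_mem e
  have h2 : (Quot.out e).2 ∈ κ ∪ e.toFinset := by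
    refine Finset.mem_union_right _ (Sym2.mem_toFinset.2 ?_)
    exact Sym2.out_snd_mem e
  exact (failProb_degree G R h1 _ _).trans (failProb_degree G R h2 _ _)

/-- The vertices known after drawing the edges of a list. -/
def knownAfter (κ : Finset ℕ) : List (Sym2 ℕ) → Finset ℕ
  | [] => κ
  | e :: l => knownAfter (κ ∪ e.toFinset) l

theorem subset_knownAfter (κ : Finset ℕ) (l : List (Sym2 ℕ)) : κ ⊆ knownAfter κ l := by
  induction l generalizing κ with
  | nil => exact subset_rfl
  | cons e l ih => exact Finset.subset_union_left.trans (ih _)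

theorem mem_knownAfter {κ : Finset ℕ} {l : List (Sym2 ℕ)} {e : Sym2 ℕ} (he : e ∈ l) {x : ℕ}
    (hx : x ∈ e) : x ∈ knownAfter κ l := by
  induction l generalizing κ with
  | nil => simp at he
  | cons f l ih =>
    rcases List.mem_cons.1 he with rfl | he
    · exact subset_knownAfter (κ ∪ Sym2.toFinset _) l
        (Finset.mem_union_right _ (Sym2.mem_toFinset.2 hx))
    · exact ih he

theorem failProb_collect (hG : G.edges.Nonempty) (k : ℕ) (κ : Finset ℕ) (c : ℕ)
    (next : List EdgeRecord → Algorithm additiveModel) :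
    (collect k next).failProb G R κ c =
      G.tupleAvg k fun l => (next (l.map G.record)).failProb G R (knownAfter κ l) (c + 3 * k) := by
  induction k generalizing κ c next with
  | zero => rfl
  | succ k ih =>
    rw [collect, failProb_observe G R hG]
    simp only [NetGraph.tupleAvg]
    refine NetGraph.avg_congr fun e _ => ?_
    rw [ih]
    simp only [List.map_cons, knownAfter]
    congr 1
    funext l
    congr 1
    ring

theorem failProb_askSum (L : List (ℝ × Finset ℕ)) (κ : Finset ℕ) (hL : ∀ p ∈ L, p.2 ⊆ κ) (acc : ℝ)
    (c : ℕ) (next : ℝ → Algorithm additiveModel) :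
    (askSum L acc next).failProb G R κ c =
      (next (acc + (L.map fun p => p.1 * ((G.edgesWithin p.2).card : ℝ)).sum)).failProb G R κ
        (c + (L.map fun p => p.2.card).sum) := by
  induction L generalizing acc c with
  | nil => simp [askSum]
  | cons p L ih =>
    obtain ⟨a, S⟩ := p
    refine (failProb_additive G R (hL (a, S) (by simp)) _ _).trans ?_
    rw [ih (fun p hp => hL p (List.mem_cons_of_mem _ hp))]
    simp only [List.map_cons, List.sum_cons, add_assoc]

theorem recip_nonneg (o : EdgeRecord) : 0 ≤ recip o := by
  rw [recip]; positivity

/-- Stopping is bad only if the first `k₁` draws already reach `T`, or the first `k₂` do not. If the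
fuel ends before `k₂`, the second event is replaced by failure of the continuation `K`. -/
theorem failProb_untilSum_le (hG : G.edges.Nonempty) {T : ℝ} {fin : ℕ → ℝ}
    {K : Algorithm additiveModel} {c₀ F k₁ k₂ : ℕ} {η : ℝ} (hη1 : η ≤ 1)
    (hK : ∀ κ, K.failProb G R κ (c₀ + 3 * F) ≤ η)
    (hgood : ∀ k, k₁ < k → k ≤ k₂ → k ≤ F → R (fin k) (c₀ + 3 * k))
    (f cnt : ℕ) (acc : ℝ) (κ : Finset ℕ) (hF : cnt + f = F) (hacc : acc < T) :
    (untilSum T fin K f acc cnt).failProb G R κ (c₀ + 3 * cnt) ≤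
      G.tupleAvg f fun l =>
        indicator (T ≤ acc + ((l.take (k₁ - cnt)).map fun e => recip (G.record e)).sum) +
        (if k₂ ≤ F then
          indicator (acc + ((l.take (k₂ - cnt)).map fun e => recip (G.record e)).sum < T)
        else η) := by
  have hηnn : 0 ≤ η := le_trans (failProb_nonneg G R ∅ _ K) (hK ∅)
  have hnn : ∀ l : List (Sym2 ℕ), 0 ≤ (l.map fun e => recip (G.record e)).sum := fun l =>
    List.sum_nonneg (by
      intro x hx
      obtain ⟨e, -, rfl⟩ := List.mem_map.1 hx
      exact recip_nonneg _)
  have hsnd : ∀ p : Prop, 0 ≤ if k₂ ≤ F then indicator p else η := fun p => by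
    split_ifs
    · exact indicator_nonneg p
    · exact hηnn
  induction f generalizing cnt acc κ with
  | zero =>
    rw [untilSum]
    simp only [NetGraph.tupleAvg, List.take_nil, List.map_nil, List.sum_nil, add_zero]
    rw [indicator_neg (not_le.2 hacc), indicator_pos hacc, zero_add]
    have := hK κ
    rw [add_zero] at hF
    rw [hF]
    split_ifs
    · exact this.trans hη1
    · exact this
  | succ f ih =>
    rw [untilSum, failProb_observe G R hG]
    refine NetGraph.avg_mono fun e he => ?_
    by_cases hT : T ≤ acc + recip (G.record e)
    · rw [if_pos hT, failProb_output]
      by_cases hR : R (fin (cnt + 1)) (c₀ + 3 * cnt + 3)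
      · rw [if_pos hR]
        exact NetGraph.tupleAvg_nonneg hG fun l => add_nonneg (indicator_nonneg _) (hsnd _)
      · rw [if_neg hR]
        refine (NetGraph.tupleAvg_const (k := f) hG 1).ge.trans
          (NetGraph.tupleAvg_mono fun l _ _ => ?_)
        by_cases h1 : cnt < k₁
        · obtain ⟨j, hj⟩ : ∃ j, k₁ - cnt = j + 1 := ⟨k₁ - cnt - 1, by omega⟩
          beta_reduce
          rw [indicator_pos (by
            rw [hj, List.take_succ_cons, List.map_cons, List.sum_cons]
            have := hnn (l.take j)
            linarith)]
          exact le_add_of_nonneg_right (hsnd _)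
        -- A bad stop that is not too early comes after more than `k₂` draws. The sum was still
        -- below `T` before the present draw, so the second indicator is 1.
        · have h2 : k₂ ≤ cnt := by
            by_contra h2
            apply hR
            have := hgood (cnt + 1) (by omega) (by omega) (by omega)
            rw [show c₀ + 3 * cnt + 3 = c₀ + 3 * (cnt + 1) by ring]
            exact this
          have h3 : k₂ ≤ F := by omega
          simp only [if_pos h3, Nat.sub_eq_zero_of_le h2, List.take_zero, List.map_nil,
            List.sum_nil, add_zero, indicator_pos hacc]
          exact le_add_of_nonneg_left (indicator_nonneg _)
    · rw [if_neg hT]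
      push Not at hT
      have h0 := ih (cnt + 1) _ (κ ∪ e.toFinset) (by omega) hT
      rw [show c₀ + 3 * (cnt + 1) = c₀ + 3 * cnt + 3 by ring] at h0
      refine h0.trans (NetGraph.tupleAvg_mono fun l _ _ => ?_)
      have hshift : ∀ k, cnt < k → (((e :: l).take (k - cnt)).map fun e => recip (G.record e)).sum =
          recip (G.record e) + ((l.take (k - (cnt + 1))).map fun e => recip (G.record e)).sum := by
        intro k hk
        obtain ⟨j, hj⟩ : ∃ j, k - cnt = j + 1 := ⟨k - cnt - 1, by omega⟩
        rw [hj, List.take_succ_cons, List.map_cons, List.sum_cons, show k - (cnt + 1) = j by omega]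
      refine add_le_add ?_ ?_
      · by_cases h1 : cnt < k₁
        · rw [hshift k₁ h1, add_assoc]
        · rw [show k₁ - (cnt + 1) = 0 by omega]
          simp only [List.take_zero, List.map_nil, List.sum_nil, add_zero]
          rw [indicator_neg (not_le.2 hT)]
          exact indicator_nonneg _
      · by_cases h2 : k₂ ≤ F
        · rw [if_pos h2, if_pos h2]
          by_cases h1 : cnt < k₂
          · rw [hshift k₂ h1, add_assoc]
          · rw [show k₂ - cnt = 0 by omega]
            simp only [List.take_zero, List.map_nil, List.sum_nil, add_zero]
            rw [indicator_pos hacc]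
            exact indicator_le_one _
        · rw [if_neg h2, if_neg h2]

end Algorithm

/-! ### Second moments of bilinear sums, and heavy edges. -/

/-- The sum of a function over the end points of an edge. -/
noncomputable def endSum (ψ : ℕ → ℝ) (e : Sym2 ℕ) : ℝ := ψ (Quot.out e).1 + ψ (Quot.out e).2

theorem endSum_mk (ψ : ℕ → ℝ) (u v : ℕ) : endSum ψ s(u, v) = ψ u + ψ v := by
  have h := Sym2.mk_out s(u, v)
  rcases Sym2.eq_iff.1 h with ⟨h1, h2⟩ | ⟨h1, h2⟩
  · rw [endSum, h1, h2]
  · rw [endSum, h1, h2, add_comm]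

namespace NetGraph

variable {G : NetGraph}

theorem out_fst_mem_verts {e : Sym2 ℕ} (he : e ∈ G.edges) : (Quot.out e).1 ∈ G.verts := by
  rw [← Sym2.mk_out e] at he
  exact G.mem_verts_left (G.mk_mem_edges.1 he)

theorem out_snd_mem_verts {e : Sym2 ℕ} (he : e ∈ G.edges) : (Quot.out e).2 ∈ G.verts := by
  rw [← Sym2.mk_out e] at he
  exact G.mem_verts_right (G.mk_mem_edges.1 he)

theorem endSum_mono {φ ψ : ℕ → ℝ} {e : Sym2 ℕ} (he : e ∈ G.edges)
    (h : ∀ x ∈ G.verts, φ x ≤ ψ x) : endSum φ e ≤ endSum ψ e :=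
  add_le_add (h _ (out_fst_mem_verts he)) (h _ (out_snd_mem_verts he))

theorem endSum_le {ψ : ℕ → ℝ} {b : ℝ} {e : Sym2 ℕ} (he : e ∈ G.edges)
    (h : ∀ x ∈ G.verts, ψ x ≤ b) : endSum ψ e ≤ 2 * b := by
  have := endSum_mono (ψ := fun _ => b) he h
  rw [two_mul]
  exact this

/-- Double counting of the incidences between vertices and edges. -/
theorem sum_endSum (ψ : ℕ → ℝ) :
    ∑ e ∈ G.edges, endSum ψ e = ∑ x ∈ G.verts, ((G.nbrs x).card : ℝ) * ψ x := by
  have h1 := G.sum_arcs (fun e => endSum ψ e)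
  have h2 := G.sum_arcs_eq_sum_nbrs (fun x _ => ψ x)
  have h3 : ∑ p ∈ G.arcs, ψ p.2 = ∑ p ∈ G.arcs, ψ p.1 :=
    Finset.sum_equiv (Equiv.prodComm ℕ ℕ)
      (fun p => by simp only [mem_arcs, Equiv.prodComm_apply, Prod.fst_swap, Prod.snd_swap,
        G.graph.adj_comm]) (fun p _ => rfl)
  simp only [endSum_mk, Finset.sum_add_distrib, h3, h2, Finset.sum_const, nsmul_eq_mul] at h1
  push_cast at h1
  linarith

theorem avg_endSum (ψ : ℕ → ℝ) :
    G.avg (endSum ψ) = (G.edges.card : ℝ)⁻¹ * ∑ x ∈ G.verts, ((G.nbrs x).card : ℝ) * ψ x := by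
  rw [avg, sum_endSum]

theorem avg_nonneg {f : Sym2 ℕ → ℝ} (h : ∀ e ∈ G.edges, 0 ≤ f e) : 0 ≤ G.avg f :=
  mul_nonneg (by positivity) (Finset.sum_nonneg h)

theorem avg_sq_le {f : Sym2 ℕ → ℝ} {b : ℝ} (h0 : ∀ e ∈ G.edges, 0 ≤ f e)
    (h : ∀ e ∈ G.edges, f e ≤ b) : G.avg (fun e => f e ^ 2) ≤ b * G.avg f := by
  rw [← avg_mul_left]
  refine avg_mono fun e he => ?_
  rw [pow_two]
  exact mul_le_mul_of_nonneg_right (h e he) (h0 e he)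

theorem avg_list_sum (l : List (Sym2 ℕ)) (z : Sym2 ℕ → Sym2 ℕ → ℝ) :
    G.avg (fun f => (l.map fun e => z e f).sum) = (l.map fun e => G.avg (z e)).sum := by
  induction l with
  | nil => simp [avg]
  | cons e l ih => simp only [List.map_cons, List.sum_cons, avg_add, ih]

/-- The second moment of a symmetric bilinear sum over two independent lists of edges. -/
theorem tupleAvg_bilinear_le (hG : G.edges.Nonempty) (s : ℕ) (z : Sym2 ℕ → Sym2 ℕ → ℝ) {b c μ : ℝ}
    (hsymm : ∀ e f, z e f = z f e) (h0 : ∀ e f, 0 ≤ z e f)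
    (hb : ∀ e ∈ G.edges, ∀ f ∈ G.edges, z e f ≤ b) (hc : ∀ e ∈ G.edges, G.avg (z e) ≤ c)
    (hμ : μ = G.avg fun e => G.avg (z e)) :
    G.tupleAvg s (fun l => G.tupleAvg s fun l' =>
      ((l'.map fun f => (l.map fun e => z e f).sum).sum - (s : ℝ) ^ 2 * μ) ^ 2) ≤
      s ^ 2 * (b * μ) + 2 * (s ^ 3 * (c * μ)) := by
  have hh0 : ∀ e ∈ G.edges, 0 ≤ G.avg (z e) := fun e _ => avg_nonneg fun f _ => h0 e f
  -- Given the first sample, the second moment over the second sample is variance plus squared bias;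
  -- the negative part of the variance is dropped.
  have h1 : ∀ l : List (Sym2 ℕ), G.tupleAvg s (fun l' =>
      ((l'.map fun f => (l.map fun e => z e f).sum).sum - (s : ℝ) ^ 2 * μ) ^ 2) ≤
      s * G.avg (fun f => (l.map fun e => z e f).sum ^ 2) +
        s ^ 2 * ((l.map fun e => G.avg (z e)).sum - s * μ) ^ 2 := by
    intro l
    rw [tupleAvg_sum_sub_sq hG s (fun f => (l.map fun e => z e f).sum), avg_list_sum]
    have : (0 : ℝ) ≤ s * (l.map fun e => G.avg (z e)).sum ^ 2 := by positivity
    nlinarith [this]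
  -- With the averages exchanged, the first sample is random for a fixed edge `f`. Symmetry of `z`
  -- lets the bound `c` on its row averages apply.
  have h2 : G.avg (fun f => G.tupleAvg s fun l => (l.map fun e => z e f).sum ^ 2) ≤
      s * (b * μ) + s ^ 2 * (c * μ) := by
    have : ∀ f ∈ G.edges, (G.tupleAvg s fun l => (l.map fun e => z e f).sum ^ 2) ≤
        (s * b + s ^ 2 * c) * G.avg (z f) := by
      intro f hf
      have e1 := tupleAvg_sum_sub_sq hG s (fun e => z e f) 0
      have e2 : (fun e => z e f) = z f := funext fun e => hsymm e f
      simp only [sub_zero, e2] at e1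
      rw [e2, e1]
      have e3 : G.avg (fun e => z e f ^ 2) ≤ b * G.avg (z f) := by
        have := avg_sq_le (fun e _ => h0 e f) fun e he => hb e he f hf
        rwa [e2] at this
      have e4 : G.avg (z f) ^ 2 ≤ c * G.avg (z f) := by
        rw [pow_two]
        exact mul_le_mul_of_nonneg_right (hc f hf) (hh0 f hf)
      have e5 : (0 : ℝ) ≤ s * G.avg (z f) ^ 2 := by positivity
      have e6 := mul_le_mul_of_nonneg_left e3 (Nat.cast_nonneg (α := ℝ) s)
      have e7 := mul_le_mul_of_nonneg_left e4 (sq_nonneg (s : ℝ))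
      nlinarith
    refine (avg_mono this).trans ?_
    rw [avg_mul_left, ← hμ]
    exact le_of_eq (by ring)
  -- The bias is itself a centred sum of independent row averages.
  have h3 : G.tupleAvg s (fun l => ((l.map fun e => G.avg (z e)).sum - s * μ) ^ 2) ≤
      s * (c * μ) := by
    rw [tupleAvg_sum_sub_sq hG, ← hμ, sub_self, zero_pow two_ne_zero, add_zero]
    have e1 := avg_sq_le hh0 hc
    rw [← hμ] at e1
    exact mul_le_mul_of_nonneg_left (by nlinarith [sq_nonneg μ]) (Nat.cast_nonneg s)
  refine (tupleAvg_mono fun l _ _ => h1 l).trans ?_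
  rw [tupleAvg_add, tupleAvg_mul_left, tupleAvg_mul_left, tupleAvg_avg_comm]
  have e1 := mul_le_mul_of_nonneg_left h2 (Nat.cast_nonneg (α := ℝ) s)
  have e2 := mul_le_mul_of_nonneg_left h3 (sq_nonneg (s : ℝ))
  nlinarith

open Classical in
/-- The edges with both end points of degree at least `τ`. -/
noncomputable def heavy (G : NetGraph) (τ : ℕ) : Finset (Sym2 ℕ) :=
  G.edges.filter fun e => τ ≤ (G.nbrs (Quot.out e).1).card ∧ τ ≤ (G.nbrs (Quot.out e).2).card

/-- The smaller of the degrees of the end points of an edge. -/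
noncomputable def minDeg (G : NetGraph) (e : Sym2 ℕ) : ℕ :=
  min (G.nbrs (Quot.out e).1).card (G.nbrs (Quot.out e).2).card

theorem mem_heavy {τ : ℕ} {e : Sym2 ℕ} : e ∈ G.heavy τ ↔ e ∈ G.edges ∧ τ ≤ G.minDeg e := by
  classical
  simp only [heavy, Finset.mem_filter, minDeg, le_min_iff]

/-- Few edges have an end point of small degree. -/
theorem avg_minDeg_lt_le {θ : ℝ} :
    G.avg (fun e => indicator ((G.minDeg e : ℝ) < θ)) ≤
      (G.edges.card : ℝ)⁻¹ * (G.verts.card * max θ 0) := by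
  have h1 : ∀ e ∈ G.edges, indicator ((G.minDeg e : ℝ) < θ) ≤
      endSum (fun x => indicator (((G.nbrs x).card : ℝ) < θ)) e := by
    intro e _
    by_cases h : (G.minDeg e : ℝ) < θ
    · rw [minDeg, Nat.cast_min, min_lt_iff] at h
      refine (indicator_le_one _).trans ?_
      rw [endSum]
      rcases h with h | h
      · rw [indicator_pos h]
        exact le_add_of_nonneg_right (indicator_nonneg _)
      · rw [indicator_pos h]
        exact le_add_of_nonneg_left (indicator_nonneg _)
    · rw [indicator_neg h]
      exact add_nonneg (indicator_nonneg _) (indicator_nonneg _)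
  refine (avg_mono h1).trans ?_
  rw [avg_endSum]
  refine mul_le_mul_of_nonneg_left ?_ (by positivity)
  rw [← nsmul_eq_mul]
  refine Finset.sum_le_card_nsmul _ _ _ fun x _ => ?_
  by_cases h : ((G.nbrs x).card : ℝ) < θ
  · rw [indicator_pos h, mul_one]
    exact h.le.trans (le_max_left _ _)
  · rw [indicator_neg h, mul_zero]
    exact le_max_right _ _

/-- Few edges are among the few edges of largest minimum degree. -/
theorem avg_heavy_lt_le {θ : ℝ} (hθ : 0 ≤ θ) :
    G.avg (fun e => indicator (((G.heavy (G.minDeg e)).card : ℝ) < θ)) ≤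
      (G.edges.card : ℝ)⁻¹ * θ := by
  classical
  refine mul_le_mul_of_nonneg_left ?_ (by positivity)
  set P := G.edges.filter fun e => ((G.heavy (G.minDeg e)).card : ℝ) < θ with hP
  have h1 : ∑ e ∈ G.edges, indicator (((G.heavy (G.minDeg e)).card : ℝ) < θ) = P.card := by
    rw [hP, Finset.card_filter, Nat.cast_sum]
    refine Finset.sum_congr rfl fun e _ => ?_
    rw [indicator]
    split_ifs <;> simp
  rw [h1]
  rcases P.eq_empty_or_nonempty with h | h
  · rw [h, Finset.card_empty, Nat.cast_zero]
    exact hθ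
  -- For the edge of smallest minimum degree in `P`, all of `P` is heavy at its level, while that
  -- level has fewer than θ heavy edges.
  · obtain ⟨e, he, hmin⟩ := P.exists_min_image G.minDeg h
    refine le_trans ?_ (Finset.mem_filter.1 he).2.le
    exact_mod_cast Finset.card_le_card fun f hf =>
      mem_heavy.2 ⟨(Finset.mem_filter.1 hf).1, hmin f hf⟩

end NetGraph

/-! ### Weighted adjacency counts from additive queries. -/

theorem sum_testBit {J w : ℕ} (hw : w < 2 ^ J) :
    ∑ j ∈ Finset.range J, (2 : ℝ) ^ j * indicator (w.testBit j = true) = w := by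
  induction J generalizing w with
  | zero =>
    have : w = 0 := by simpa using hw
    simp [this]
  | succ J ih =>
    rw [Finset.sum_range_succ']
    have h1 : ∀ j ∈ Finset.range J, (2 : ℝ) ^ (j + 1) * indicator (w.testBit (j + 1) = true) =
        2 * ((2 : ℝ) ^ j * indicator ((w / 2).testBit j = true)) := fun j _ => by
      rw [Nat.testBit_succ, pow_succ]
      ring
    rw [Finset.sum_congr rfl h1, ← Finset.mul_sum, ih (by rw [pow_succ] at hw; omega), pow_zero,
      one_mul, Nat.testBit_zero]
    have h2 : indicator (decide (w % 2 = 1) = true) = ((w % 2 : ℕ) : ℝ) := by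
      rcases Nat.mod_two_eq_zero_or_one w with h | h
      · rw [indicator_neg (by simp [h]), h, Nat.cast_zero]
      · rw [indicator_pos (by simp [h]), h, Nat.cast_one]
    rw [h2]
    exact_mod_cast Nat.div_add_mod w 2

theorem sum_eq_sum_indicator {S V : Finset ℕ} (h : S ⊆ V) (f : ℕ → ℝ) :
    ∑ x ∈ S, f x = ∑ x ∈ V, indicator (x ∈ S) * f x := by
  classical
  rw [← Finset.sum_subset h fun x _ hx => by rw [indicator_neg hx, zero_mul]]
  exact Finset.sum_congr rfl fun x hx => by rw [indicator_pos hx, one_mul]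

namespace NetGraph

variable (G : NetGraph)

/-- The entries of the adjacency matrix. -/
noncomputable def adj (x y : ℕ) : ℝ := indicator (G.graph.Adj x y)

theorem adj_comm (x y : ℕ) : G.adj x y = G.adj y x := by
  rw [adj, adj, G.graph.adj_comm]

theorem adj_nonneg (x y : ℕ) : 0 ≤ G.adj x y := indicator_nonneg _

theorem adj_le_one (x y : ℕ) : G.adj x y ≤ 1 := indicator_le_one _

theorem sum_adj (S : Finset ℕ) [DecidablePred fun y => y ∈ S] (x : ℕ) :
    ∑ y ∈ S, G.adj x y = ((G.nbrs x).filter fun y => y ∈ S).card := by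
  classical
  have : (G.nbrs x).filter (fun y => y ∈ S) = S.filter fun y => G.graph.Adj x y := by
    ext y
    simp only [Finset.mem_filter, mem_nbrs, and_comm]
  rw [this, Finset.card_filter, Nat.cast_sum]
  refine Finset.sum_congr rfl fun y _ => ?_
  rw [adj, indicator]
  split_ifs <;> simp

theorem sum_verts_adj (x : ℕ) : ∑ y ∈ G.verts, G.adj x y = (G.nbrs x).card := by
  classical
  rw [sum_adj, Finset.filter_true_of_mem fun y hy =>
    G.mem_verts_right (G.mem_nbrs.1 hy)]

/-- The subgraph induced on a set. -/
def restrict (S : Finset ℕ) : NetGraph where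
  verts := S
  graph :=
    { Adj := fun u v => u ∈ S ∧ v ∈ S ∧ G.graph.Adj u v
      symm := ⟨fun _ _ h => ⟨h.2.1, h.1, h.2.2.symm⟩⟩
      loopless := ⟨fun _ h => h.2.2.ne rfl⟩ }
  mem_of_adj := fun _ _ h => h.1

/-- The handshake identity in the induced subgraph. -/
theorem two_mul_card_edgesWithin (S : Finset ℕ) :
    2 * ((G.edgesWithin S).card : ℝ) = ∑ x ∈ S, ∑ y ∈ S, G.adj x y := by
  classical
  have h1 : (G.restrict S).edges = G.edgesWithin S := by
    ext e
    induction e using Sym2.ind with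
    | _ u v => rw [mk_mem_edges, mk_mem_edgesWithin, restrict]
  have h2 := (G.restrict S).two_mul_card_edges
  rw [h1] at h2
  have h3 : 2 * ((G.edgesWithin S).card : ℝ) =
      ∑ x ∈ S, (((G.restrict S).nbrs x).card : ℝ) := by exact_mod_cast h2
  rw [h3]
  refine Finset.sum_congr rfl fun x hx => ?_
  rw [sum_adj]
  congr 2
  ext y
  rw [mem_nbrs, Finset.mem_filter, mem_nbrs, restrict]
  exact ⟨fun h => ⟨h.2.2, h.2.1⟩, fun h => ⟨hx, h.2, h.1⟩⟩

/-- The number of adjacent pairs in `S × T` in terms of additive queries. -/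
theorem sum_sum_adj (S T : Finset ℕ) :
    ∑ x ∈ S, ∑ y ∈ T, G.adj x y = (G.edgesWithin (S ∪ T)).card + (G.edgesWithin (S ∩ T)).card -
      (G.edgesWithin (S \ T)).card - (G.edgesWithin (T \ S)).card := by
  classical
  set V := S ∪ T with hV
  have key : ∀ A B : Finset ℕ, A ⊆ V → B ⊆ V → ∑ x ∈ A, ∑ y ∈ B, G.adj x y =
      ∑ x ∈ V, ∑ y ∈ V, indicator (x ∈ A) * indicator (y ∈ B) * G.adj x y := by
    intro A B hA hB
    rw [sum_eq_sum_indicator hA]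
    refine Finset.sum_congr rfl fun x _ => ?_
    rw [sum_eq_sum_indicator hB, Finset.mul_sum]
    exact Finset.sum_congr rfl fun y _ => by ring
  have hS : S ⊆ V := Finset.subset_union_left
  have hT : T ⊆ V := Finset.subset_union_right
  have e0 := key S T hS hT
  have e0' : ∑ x ∈ S, ∑ y ∈ T, G.adj x y = ∑ x ∈ T, ∑ y ∈ S, G.adj x y := by
    rw [Finset.sum_comm]
    exact Finset.sum_congr rfl fun x _ => Finset.sum_congr rfl fun y _ => G.adj_comm y x
  rw [key T S hT hS] at e0'
  have e1 := G.two_mul_card_edgesWithin V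
  have e2 := G.two_mul_card_edgesWithin (S ∩ T)
  have e3 := G.two_mul_card_edgesWithin (S \ T)
  have e4 := G.two_mul_card_edgesWithin (T \ S)
  rw [key _ _ subset_rfl subset_rfl] at e1
  rw [key _ _ (Finset.inter_subset_left.trans hS) (Finset.inter_subset_left.trans hS)] at e2
  rw [key _ _ (Finset.sdiff_subset.trans hS) (Finset.sdiff_subset.trans hS)] at e3
  rw [key _ _ (Finset.sdiff_subset.trans hT) (Finset.sdiff_subset.trans hT)] at e4
  -- As multisets of ordered pairs, (S∪T)² and (S∩T)² together equal S×T, T×S, (S\T)² and (T\S)²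
  -- together.
  have hpt : ∀ x ∈ V, ∀ y ∈ V,
      indicator (x ∈ V) * indicator (y ∈ V) * G.adj x y +
        indicator (x ∈ S ∩ T) * indicator (y ∈ S ∩ T) * G.adj x y =
      indicator (x ∈ S) * indicator (y ∈ T) * G.adj x y +
        indicator (x ∈ T) * indicator (y ∈ S) * G.adj x y +
        indicator (x ∈ S \ T) * indicator (y ∈ S \ T) * G.adj x y +
        indicator (x ∈ T \ S) * indicator (y ∈ T \ S) * G.adj x y := by
    intro x hx y hy
    rw [indicator_pos hx, indicator_pos hy]
    rw [hV, Finset.mem_union] at hx hy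
    simp only [Finset.mem_inter, Finset.mem_sdiff]
    by_cases h1 : x ∈ S <;> by_cases h2 : x ∈ T <;> by_cases h3 : y ∈ S <;>
      by_cases h4 : y ∈ T <;> simp_all [indicator]
  have hsum := Finset.sum_congr rfl fun x hx => Finset.sum_congr rfl fun y hy => hpt x hx y hy
  simp only [Finset.sum_add_distrib] at hsum
  linarith

end NetGraph

/-- Additive queries which give the number of adjacent pairs in `S × T`. -/
noncomputable def crossQueries (a : ℝ) (S T : Finset ℕ) : List (ℝ × Finset ℕ) :=
  [(a, S ∪ T), (a, S ∩ T), (-a, S \ T), (-a, T \ S)]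

/-- Additive queries which give the bilinear form of the adjacency matrix at two weights with the
binary digits `S` and `T`. -/
noncomputable def bilinearQueries (J : ℕ) (S T : ℕ → Finset ℕ) : List (ℝ × Finset ℕ) :=
  (List.range J).flatMap fun i => (List.range J).flatMap fun j =>
    crossQueries (2 ^ (i + j)) (S i) (T j)

theorem mem_bilinearQueries {J : ℕ} {S T : ℕ → Finset ℕ} {p : ℝ × Finset ℕ}
    (hp : p ∈ bilinearQueries J S T) : ∃ i j, p.2 ⊆ S i ∪ T j := by
  simp only [bilinearQueries, List.mem_flatMap] at hp
  obtain ⟨i, -, j, -, hp⟩ := hp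
  refine ⟨i, j, ?_⟩
  simp only [crossQueries, List.mem_cons, List.not_mem_nil, or_false] at hp
  rcases hp with rfl | rfl | rfl | rfl
  · exact subset_rfl
  · exact Finset.inter_subset_left.trans Finset.subset_union_left
  · exact Finset.sdiff_subset.trans Finset.subset_union_left
  · exact Finset.sdiff_subset.trans Finset.subset_union_right

theorem length_bilinearQueries (J : ℕ) (S T : ℕ → Finset ℕ) :
    (bilinearQueries J S T).length = J * (J * 4) := by
  simp [bilinearQueries, crossQueries, List.length_flatMap]

theorem cost_bilinearQueries_le {J b : ℕ} {S T : ℕ → Finset ℕ} (hS : ∀ i, (S i).card ≤ b)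
    (hT : ∀ i, (T i).card ≤ b) :
    ((bilinearQueries J S T).map fun p => p.2.card).sum ≤ 8 * b * J ^ 2 := by
  have h : ∀ c ∈ (bilinearQueries J S T).map fun p => p.2.card, c ≤ 2 * b := by
    intro c hc
    obtain ⟨p, hp, rfl⟩ := List.mem_map.1 hc
    obtain ⟨i, j, hij⟩ := mem_bilinearQueries hp
    have h1 := Finset.card_le_card hij
    have h2 := Finset.card_union_le (S i) (T j)
    have h3 := hS i
    have h4 := hT j
    omega
  refine (List.sum_le_card_nsmul _ _ h).trans (le_of_eq ?_)
  rw [List.length_map, length_bilinearQueries, smul_eq_mul]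
  ring

theorem List.sum_map_flatMap_range {α : Type*} (J : ℕ) (f : ℕ → List α) (g : α → ℝ) :
    (((List.range J).flatMap f).map g).sum = ∑ i ∈ Finset.range J, ((f i).map g).sum := by
  induction J with
  | zero => simp
  | succ J ih => simp [List.range_succ, Finset.sum_range_succ, ih]

/-- The binary digits of a weight. -/
def digitSet (V : Finset ℕ) (w : ℕ → ℕ) (j : ℕ) : Finset ℕ := V.filter fun x => (w x).testBit j

theorem sum_digitSet {J : ℕ} (V : Finset ℕ) {w : ℕ → ℕ} (hw : ∀ x, w x < 2 ^ J) (φ : ℕ → ℝ) :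
    ∑ j ∈ Finset.range J, (2 : ℝ) ^ j * ∑ x ∈ digitSet V w j, φ x = ∑ x ∈ V, (w x : ℝ) * φ x := by
  have h : ∀ j, ∑ x ∈ digitSet V w j, φ x =
      ∑ x ∈ V, indicator ((w x).testBit j = true) * φ x := by
    intro j
    rw [digitSet, Finset.sum_filter]
    refine Finset.sum_congr rfl fun x _ => ?_
    rw [indicator]
    split_ifs <;> simp
  simp only [h, Finset.mul_sum]
  rw [Finset.sum_comm]
  refine Finset.sum_congr rfl fun x _ => ?_
  rw [← sum_testBit (hw x), Finset.sum_mul]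
  exact Finset.sum_congr rfl fun j _ => by ring

/-- Expanding both weights in binary turns the form into a combination of J² unweighted counts
between digit sets. -/
theorem sum_bilinearQueries (G : NetGraph) {J : ℕ} (V₁ V₂ : Finset ℕ) {w₁ w₂ : ℕ → ℕ}
    (h₁ : ∀ x, w₁ x < 2 ^ J) (h₂ : ∀ x, w₂ x < 2 ^ J) :
    ((bilinearQueries J (digitSet V₁ w₁) (digitSet V₂ w₂)).map
      fun p => p.1 * ((G.edgesWithin p.2).card : ℝ)).sum =
      ∑ y ∈ V₂, (w₂ y : ℝ) * ∑ x ∈ V₁, (w₁ x : ℝ) * G.adj x y := by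
  have h : ∀ i j, ((crossQueries (2 ^ (i + j)) (digitSet V₁ w₁ i) (digitSet V₂ w₂ j)).map
      fun p => p.1 * ((G.edgesWithin p.2).card : ℝ)).sum =
      2 ^ i * (2 ^ j * ∑ x ∈ digitSet V₁ w₁ i, ∑ y ∈ digitSet V₂ w₂ j, G.adj x y) := by
    intro i j
    rw [G.sum_sum_adj]
    simp only [crossQueries, List.map_cons, List.map_nil, List.sum_cons, List.sum_nil]
    ring
  rw [bilinearQueries, List.sum_map_flatMap_range]
  simp only [List.sum_map_flatMap_range, h]
  rw [Finset.sum_comm]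
  rw [← sum_digitSet V₂ h₂]
  refine Finset.sum_congr rfl fun j _ => ?_
  rw [Finset.sum_congr rfl fun y _ => (sum_digitSet V₁ h₁ fun x => G.adj x y).symm,
    Finset.sum_comm, Finset.mul_sum]
  refine Finset.sum_congr rfl fun i _ => ?_
  rw [Finset.sum_comm, Finset.mul_sum, Finset.mul_sum, Finset.mul_sum]
  exact Finset.sum_congr rfl fun y _ => by ring

/-- The reciprocal of a degree that is at least `τ`, multiplied by `Q` and rounded down. -/
def roundedRecip (Q τ d : ℕ) : ℕ := if τ ≤ d then Q / d else 0

theorem roundedRecip_le (Q : ℕ) {τ d : ℕ} (hτ : 0 < τ) : (roundedRecip Q τ d : ℝ) ≤ Q / τ := by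
  rw [roundedRecip]
  split_ifs with h
  · refine Nat.cast_div_le.trans ?_
    have : (0 : ℝ) < τ := by exact_mod_cast hτ
    gcongr
  · rw [Nat.cast_zero]
    positivity

theorem mul_roundedRecip_le (Q τ d : ℕ) :
    (d : ℝ) * roundedRecip Q τ d ≤ Q * indicator (τ ≤ d) := by
  rw [roundedRecip]
  split_ifs with h
  · rw [indicator_pos h, mul_one]
    exact_mod_cast Nat.mul_div_le Q d
  · rw [indicator_neg h]
    simp

theorem le_mul_roundedRecip (Q τ d : ℕ) (hd : 0 < d) :
    ((Q : ℝ) - d) * indicator (τ ≤ d) ≤ d * roundedRecip Q τ d := by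
  rw [roundedRecip]
  split_ifs with h
  · rw [indicator_pos h, mul_one, sub_le_iff_le_add]
    have h1 := Nat.div_add_mod Q d
    have h2 := Nat.mod_lt Q hd
    exact_mod_cast (show Q ≤ d * (Q / d) + d by omega)
  · rw [indicator_neg h]
    simp

/-- The sum of a function over the end points of an edge, weighted by rounded reciprocals of the
degrees. -/
noncomputable def recordSum (Q τ : ℕ) (o : EdgeRecord) (φ : ℕ → ℝ) : ℝ :=
  roundedRecip Q τ o.1.2 * φ o.1.1 + roundedRecip Q τ o.2.2 * φ o.2.1

/-- The total rounded reciprocal degree collected by a vertex. -/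
def recordWeight (Q τ : ℕ) (L : List EdgeRecord) (x : ℕ) : ℕ :=
  (L.map fun o => (if o.1.1 = x then roundedRecip Q τ o.1.2 else 0) +
    (if o.2.1 = x then roundedRecip Q τ o.2.2 else 0)).sum

/-- The end points of the edges of a list. -/
def endPoints (L : List EdgeRecord) : Finset ℕ := (L.flatMap fun o => [o.1.1, o.2.1]).toFinset

theorem mem_endPoints {L : List EdgeRecord} {x : ℕ} :
    x ∈ endPoints L ↔ ∃ o ∈ L, x = o.1.1 ∨ x = o.2.1 := by
  simp [endPoints]

theorem card_endPoints_le (L : List EdgeRecord) : (endPoints L).card ≤ 2 * L.length := by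
  refine (List.toFinset_card_le _).trans (le_of_eq ?_)
  simp [List.length_flatMap, mul_comm]

theorem recordWeight_le (Q τ : ℕ) (L : List EdgeRecord) (x : ℕ) :
    recordWeight Q τ L x ≤ L.length * (2 * Q) := by
  have h : ∀ d, roundedRecip Q τ d ≤ Q := fun d => by
    rw [roundedRecip]
    split_ifs
    · exact Nat.div_le_self _ _
    · exact Nat.zero_le _
  refine (List.sum_le_card_nsmul _ (2 * Q) ?_).trans (by simp)
  intro c hc
  obtain ⟨o, -, rfl⟩ := List.mem_map.1 hc
  have h1 := h o.1.2
  have h2 := h o.2.2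
  split_ifs <;> omega

theorem sum_recordWeight (Q τ : ℕ) {V : Finset ℕ} (L : List EdgeRecord)
    (hV : ∀ o ∈ L, o.1.1 ∈ V ∧ o.2.1 ∈ V) (φ : ℕ → ℝ) :
    ∑ x ∈ V, (recordWeight Q τ L x : ℝ) * φ x = (L.map fun o => recordSum Q τ o φ).sum := by
  induction L with
  | nil => simp [recordWeight]
  | cons o L ih =>
    have h1 := hV o (by simp)
    rw [List.map_cons, List.sum_cons, ← ih fun o ho => hV o (List.mem_cons_of_mem _ ho)]
    have h2 : ∀ x, (recordWeight Q τ (o :: L) x : ℝ) * φ x =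
        (if o.1.1 = x then (roundedRecip Q τ o.1.2 : ℝ) * φ x else 0) +
          (if o.2.1 = x then (roundedRecip Q τ o.2.2 : ℝ) * φ x else 0) +
          recordWeight Q τ L x * φ x := by
      intro x
      simp only [recordWeight, List.map_cons, List.sum_cons]
      push_cast
      split_ifs <;> ring
    simp only [h2, Finset.sum_add_distrib, Finset.sum_ite_eq, if_pos h1.1, if_pos h1.2, recordSum]

theorem recordSum_list_sum {α : Type*} (Q τ : ℕ) (o : EdgeRecord) (L : List α)
    (φ : α → ℕ → ℝ) :
    recordSum Q τ o (fun y => (L.map fun o' => φ o' y).sum) =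
      (L.map fun o' => recordSum Q τ o (φ o')).sum := by
  simp only [recordSum, List.sum_map_add, List.sum_map_mul_left]

/-! ### Moments of the weighted adjacency between two random edges. -/

namespace NetGraph

variable (G : NetGraph)

/-- The contribution of a pair of edges to the bilinear form of the adjacency matrix. -/
noncomputable def pairing (Q τ : ℕ) (e f : Sym2 ℕ) : ℝ :=
  recordSum Q τ (G.record f) fun y => recordSum Q τ (G.record e) fun x => G.adj x y

/-- The rounded reciprocal degree of a vertex. -/
noncomputable def weight (Q τ x : ℕ) : ℝ := roundedRecip Q τ (G.nbrs x).card

theorem weight_nonneg (Q τ x : ℕ) : 0 ≤ G.weight Q τ x := Nat.cast_nonneg _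

theorem pairing_eq (Q τ : ℕ) (e f : Sym2 ℕ) :
    G.pairing Q τ e f = endSum (fun y => G.weight Q τ y *
      endSum (fun x => G.weight Q τ x * G.adj x y) e) f := rfl

theorem pairing_comm (Q τ : ℕ) (e f : Sym2 ℕ) : G.pairing Q τ e f = G.pairing Q τ f e := by
  simp only [pairing_eq, endSum]
  rw [G.adj_comm (Quot.out f).1, G.adj_comm (Quot.out f).1, G.adj_comm (Quot.out f).2,
    G.adj_comm (Quot.out f).2]
  ring

theorem pairing_nonneg (Q τ : ℕ) (e f : Sym2 ℕ) : 0 ≤ G.pairing Q τ e f := by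
  have h : ∀ x y, 0 ≤ G.weight Q τ x * G.adj x y := fun x y =>
    mul_nonneg (G.weight_nonneg Q τ x) (G.adj_nonneg x y)
  have h' : ∀ y, 0 ≤ G.weight Q τ y * endSum (fun x => G.weight Q τ x * G.adj x y) e := fun y =>
    mul_nonneg (G.weight_nonneg Q τ y) (add_nonneg (h _ _) (h _ _))
  exact add_nonneg (h' _) (h' _)

variable {G}

theorem pairing_le {Q τ : ℕ} (hτ : 0 < τ) {e f : Sym2 ℕ} (he : e ∈ G.edges) (hf : f ∈ G.edges) :
    G.pairing Q τ e f ≤ 4 * ((Q : ℝ) / τ) ^ 2 := by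
  have hw : ∀ x, G.weight Q τ x ≤ (Q : ℝ) / τ := fun x => roundedRecip_le Q hτ
  have h1 : ∀ y, endSum (fun x => G.weight Q τ x * G.adj x y) e ≤ 2 * ((Q : ℝ) / τ) := fun y =>
    endSum_le he fun x _ => (mul_le_of_le_one_right (G.weight_nonneg Q τ x)
      (G.adj_le_one x y)).trans (hw x)
  rw [pairing_eq]
  have h2 : ∀ y ∈ G.verts, G.weight Q τ y * endSum (fun x => G.weight Q τ x * G.adj x y) e ≤
      (Q : ℝ) / τ * (2 * ((Q : ℝ) / τ)) := fun y _ =>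
    (mul_le_mul_of_nonneg_left (h1 y) (G.weight_nonneg Q τ y)).trans
      (mul_le_mul_of_nonneg_right (hw y) (by positivity))
  exact (endSum_le hf h2).trans (le_of_eq (by ring))

/-- Degree times weight is at most `Q`. This cancels the degree bias of the random edge; then
summing the adjacencies of an end point of `e` gives its degree, which is cancelled the same way.
The factor 2 is for the two end points. -/
theorem avg_pairing_le (Q τ : ℕ) {e : Sym2 ℕ} (he : e ∈ G.edges) :
    G.avg (G.pairing Q τ e) ≤ 2 * (Q : ℝ) ^ 2 / G.edges.card := by
  have hQ : ∀ x, ((G.nbrs x).card : ℝ) * G.weight Q τ x ≤ Q := fun x =>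
    (mul_roundedRecip_le Q τ _).trans (mul_le_of_le_one_right (Nat.cast_nonneg _)
      (indicator_le_one _))
  have h0 : ∀ y, 0 ≤ endSum (fun x => G.weight Q τ x * G.adj x y) e := fun y =>
    add_nonneg (mul_nonneg (G.weight_nonneg _ _ _) (G.adj_nonneg _ _))
      (mul_nonneg (G.weight_nonneg _ _ _) (G.adj_nonneg _ _))
  have h1 : G.pairing Q τ e = endSum (fun y => G.weight Q τ y *
      endSum (fun x => G.weight Q τ x * G.adj x y) e) := funext fun f => G.pairing_eq Q τ e f
  have h2 : ∑ y ∈ G.verts, endSum (fun x => G.weight Q τ x * G.adj x y) e =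
      endSum (fun x => ((G.nbrs x).card : ℝ) * G.weight Q τ x) e := by
    simp only [endSum, Finset.sum_add_distrib, ← Finset.mul_sum, sum_verts_adj]
    ring
  rw [h1, avg_endSum, div_eq_inv_mul]
  refine mul_le_mul_of_nonneg_left ?_ (by positivity)
  calc ∑ y ∈ G.verts, ((G.nbrs y).card : ℝ) * (G.weight Q τ y *
        endSum (fun x => G.weight Q τ x * G.adj x y) e)
      ≤ ∑ y ∈ G.verts, Q * endSum (fun x => G.weight Q τ x * G.adj x y) e := by
        refine Finset.sum_le_sum fun y _ => ?_
        rw [← mul_assoc]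
        exact mul_le_mul_of_nonneg_right (hQ y) (h0 y)
    _ = Q * endSum (fun x => ((G.nbrs x).card : ℝ) * G.weight Q τ x) e := by
        rw [← Finset.mul_sum, h2]
    _ ≤ Q * (2 * Q) :=
        mul_le_mul_of_nonneg_left (endSum_le he fun x _ => hQ x) (Nat.cast_nonneg _)
    _ = 2 * (Q : ℝ) ^ 2 := by ring

/-- The mean number of occurrences of x as an end point of a random edge is deg(x)/m, independently
for the two edges. -/
theorem avg_avg_pairing (Q τ : ℕ) : (G.avg fun e => G.avg (G.pairing Q τ e)) =
    ((G.edges.card : ℝ)⁻¹) ^ 2 * ∑ y ∈ G.verts, ∑ x ∈ G.verts,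
      (((G.nbrs y).card : ℝ) * G.weight Q τ y) * (((G.nbrs x).card : ℝ) * G.weight Q τ x) *
        G.adj x y := by
  have h1 : ∀ e, G.avg (G.pairing Q τ e) = (G.edges.card : ℝ)⁻¹ *
      ∑ y ∈ G.verts, ((G.nbrs y).card : ℝ) * (G.weight Q τ y *
        endSum (fun x => G.weight Q τ x * G.adj x y) e) := fun e => by
    rw [← avg_endSum]
    rfl
  simp only [h1]
  rw [avg_mul_left, avg_sum, pow_two, mul_assoc]
  congr 1
  rw [Finset.mul_sum]
  refine Finset.sum_congr rfl fun y _ => ?_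
  simp only [← mul_assoc]
  rw [avg_mul_left, avg_endSum, Finset.mul_sum, Finset.mul_sum, Finset.mul_sum]
  exact Finset.sum_congr rfl fun x _ => by ring

theorem sum_heavy (τ : ℕ) : ∑ y ∈ G.verts, ∑ x ∈ G.verts,
    indicator (τ ≤ (G.nbrs y).card) * indicator (τ ≤ (G.nbrs x).card) * G.adj x y =
      2 * ((G.heavy τ).card : ℝ) := by
  classical
  set S := G.verts.filter fun x => τ ≤ (G.nbrs x).card with hS
  have h1 : G.heavy τ = G.edgesWithin S := by
    ext e
    rw [heavy, Finset.mem_filter, ← Sym2.mk_out e, mk_mem_edges, mk_mem_edgesWithin,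
      Sym2.mk_out]
    rw [hS, Finset.mem_filter, Finset.mem_filter]
    exact ⟨fun h => ⟨⟨G.mem_verts_left h.1, h.2.1⟩, ⟨G.mem_verts_right h.1, h.2.2⟩, h.1⟩,
      fun h => ⟨h.2.2, h.1.2, h.2.1.2⟩⟩
  have h2 : ∀ x ∈ G.verts, indicator (x ∈ S) = indicator (τ ≤ (G.nbrs x).card) := by
    intro x hx
    rw [hS, Finset.mem_filter]
    simp [hx]
  rw [h1, two_mul_card_edgesWithin, sum_eq_sum_indicator (Finset.filter_subset _ G.verts)]
  refine Finset.sum_congr rfl fun y hy => ?_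
  rw [sum_eq_sum_indicator (Finset.filter_subset _ G.verts), Finset.mul_sum, ← hS, h2 y hy]
  refine Finset.sum_congr rfl fun x hx => ?_
  rw [h2 x hx, G.adj_comm]
  ring

/-- Without rounding, each degree times weight would be `Q` on vertices of degree at least τ and 0
elsewhere, so the form counts every heavy edge twice. Rounding down only decreases it. -/
theorem avg_avg_pairing_le (Q τ : ℕ) : (G.avg fun e => G.avg (G.pairing Q τ e)) ≤
    ((G.edges.card : ℝ)⁻¹) ^ 2 * (2 * (Q : ℝ) ^ 2 * (G.heavy τ).card) := by
  rw [avg_avg_pairing]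
  refine mul_le_mul_of_nonneg_left ?_ (by positivity)
  rw [show 2 * (Q : ℝ) ^ 2 * (G.heavy τ).card = Q ^ 2 * (2 * (G.heavy τ).card) by ring,
    ← sum_heavy, Finset.mul_sum]
  refine Finset.sum_le_sum fun y _ => ?_
  rw [Finset.mul_sum]
  refine Finset.sum_le_sum fun x _ => ?_
  rw [← mul_assoc ((Q : ℝ) ^ 2)]
  refine mul_le_mul_of_nonneg_right ?_ (G.adj_nonneg x y)
  refine (mul_le_mul (mul_roundedRecip_le Q τ (G.nbrs y).card)
    (mul_roundedRecip_le Q τ (G.nbrs x).card)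
    (mul_nonneg (Nat.cast_nonneg _) (Nat.cast_nonneg _))
    (mul_nonneg (Nat.cast_nonneg _) (indicator_nonneg _))).trans (le_of_eq ?_)
  ring

/-- Rounding costs less than one unit of weight, that is less than deg ≤ (1 - a)Q after
multiplication by the degree. -/
theorem le_avg_avg_pairing {Q : ℕ} (τ : ℕ) {a : ℝ} (ha : 0 ≤ a)
    (hQ : ∀ x ∈ G.verts, 0 < (G.nbrs x).card ∧ a * Q ≤ Q - (G.nbrs x).card) :
    ((G.edges.card : ℝ)⁻¹) ^ 2 * (2 * (Q : ℝ) ^ 2 * (G.heavy τ).card) * a ^ 2 ≤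
      G.avg fun e => G.avg (G.pairing Q τ e) := by
  rw [avg_avg_pairing, mul_assoc]
  refine mul_le_mul_of_nonneg_left ?_ (by positivity)
  rw [show 2 * (Q : ℝ) ^ 2 * (G.heavy τ).card * a ^ 2 = (a * Q) ^ 2 * (2 * (G.heavy τ).card) by
    ring, ← sum_heavy, Finset.mul_sum]
  refine Finset.sum_le_sum fun y hy => ?_
  rw [Finset.mul_sum]
  refine Finset.sum_le_sum fun x hx => ?_
  rw [← mul_assoc]
  refine mul_le_mul_of_nonneg_right ?_ (G.adj_nonneg x y)
  have h : ∀ x ∈ G.verts, a * Q * indicator (τ ≤ (G.nbrs x).card) ≤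
      ((G.nbrs x).card : ℝ) * G.weight Q τ x := fun x hx =>
    (mul_le_mul_of_nonneg_right (hQ x hx).2 (indicator_nonneg _)).trans
      (le_mul_roundedRecip Q τ _ (hQ x hx).1)
  refine le_trans (le_of_eq ?_) (mul_le_mul (h y hy) (h x hx)
    (mul_nonneg (mul_nonneg ha (Nat.cast_nonneg _)) (indicator_nonneg _))
    (mul_nonneg (Nat.cast_nonneg _) (Nat.cast_nonneg _)))
  ring

end NetGraph

/-! ### Concentration of the reciprocal degree sums and of the heavy edge count. -/

namespace NetGraph

variable {G : NetGraph}

/-- Each vertex is counted deg(x) times with weight 1/deg(x), so the total is the number of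
vertices. This is 2 divided by the average degree. -/
theorem avg_recip (h : ∀ x ∈ G.verts, 0 < (G.nbrs x).card) :
    G.avg (fun e => Algorithm.recip (G.record e)) = (G.edges.card : ℝ)⁻¹ * G.verts.card := by
  have h1 : (fun e => Algorithm.recip (G.record e)) =
      endSum fun x => 1 / ((G.nbrs x).card : ℝ) := rfl
  rw [h1, avg_endSum, Finset.sum_congr rfl fun x hx => mul_one_div_cancel
    (Nat.cast_ne_zero.2 (h x hx).ne'), Finset.sum_const, nsmul_eq_mul, mul_one]

/-- Degrees are at least 1, so each term is at most 2. -/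
theorem avg_recip_sq_le (h : ∀ x ∈ G.verts, 0 < (G.nbrs x).card) :
    G.avg (fun e => Algorithm.recip (G.record e) ^ 2) ≤
      2 * ((G.edges.card : ℝ)⁻¹ * G.verts.card) := by
  rw [← avg_recip h]
  refine avg_sq_le (fun e _ => Algorithm.recip_nonneg _) fun e he => ?_
  have h1 : Algorithm.recip (G.record e) = endSum (fun x => 1 / ((G.nbrs x).card : ℝ)) e := rfl
  rw [h1, ← mul_one (2 : ℝ)]
  refine endSum_le he fun x hx => ?_
  rw [div_le_one (Nat.cast_pos.2 (h x hx))]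
  exact_mod_cast h x hx

/-- Chebyshev's inequality for a sum over independent random edges. -/
theorem tupleAvg_chebyshev (hG : G.edges.Nonempty) (k : ℕ) (φ : Sym2 ℕ → ℝ) {a v : ℝ}
    (ha : 0 < a) (hv : G.avg (fun e => φ e ^ 2) ≤ v) (P : List (Sym2 ℕ) → Prop)
    (h : ∀ l, P l → a ≤ |(l.map φ).sum - k * G.avg φ|) :
    G.tupleAvg k (fun l => indicator (P l)) ≤ k * v / a ^ 2 := by
  refine (tupleAvg_indicator_le P (fun l => ((l.map φ).sum - k * G.avg φ) ^ 2) (pow_pos ha 2)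
    (fun l => sq_nonneg _) fun l _ _ hl => ?_).trans ?_
  · rw [← sq_abs ((l.map φ).sum - k * G.avg φ)]
    exact pow_le_pow_left₀ ha.le (h l hl) 2
  · rw [tupleAvg_sum_sub_sq hG, sub_self, zero_pow two_ne_zero, add_zero]
    refine div_le_div_of_nonneg_right ?_ (by positivity)
    exact mul_le_mul_of_nonneg_left (by nlinarith [sq_nonneg (G.avg φ)]) (Nat.cast_nonneg k)

theorem tupleAvg_le_recip_sum (hG : G.edges.Nonempty) (h : ∀ x ∈ G.verts, 0 < (G.nbrs x).card)
    (k : ℕ) {a T : ℝ} (ha : 0 < a) (hT : k * ((G.edges.card : ℝ)⁻¹ * G.verts.card) + a ≤ T) :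
    G.tupleAvg k (fun l => indicator (T ≤
      (l.map fun e => Algorithm.recip (G.record e)).sum)) ≤
      2 * (k * ((G.edges.card : ℝ)⁻¹ * G.verts.card)) / a ^ 2 := by
  refine (tupleAvg_chebyshev hG k _ ha (avg_recip_sq_le h) _ fun l hl => ?_).trans
    (le_of_eq (by ring))
  rw [avg_recip h]
  exact le_trans (by linarith) (le_abs_self _)

theorem tupleAvg_recip_sum_lt (hG : G.edges.Nonempty) (h : ∀ x ∈ G.verts, 0 < (G.nbrs x).card)
    (k : ℕ) {a T : ℝ} (ha : 0 < a) (hT : T + a ≤ k * ((G.edges.card : ℝ)⁻¹ * G.verts.card)) :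
    G.tupleAvg k (fun l => indicator
      ((l.map fun e => Algorithm.recip (G.record e)).sum < T)) ≤
      2 * (k * ((G.edges.card : ℝ)⁻¹ * G.verts.card)) / a ^ 2 := by
  refine (tupleAvg_chebyshev hG k _ ha (avg_recip_sq_le h) _ fun l hl => ?_).trans
    (le_of_eq (by ring))
  rw [avg_recip h]
  exact le_trans (by linarith) (neg_le_abs _)

/-- The indicator of the edges whose recorded degrees are at least `τ`. -/
noncomputable def heavyIndicator (τ : ℕ) (o : EdgeRecord) : ℝ := indicator (τ ≤ o.1.2 ∧ τ ≤ o.2.2)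

theorem avg_heavyIndicator (τ : ℕ) :
    G.avg (fun e => heavyIndicator τ (G.record e)) =
      (G.edges.card : ℝ)⁻¹ * (G.heavy τ).card := by
  classical
  rw [avg, heavy, Finset.card_filter, Nat.cast_sum]
  congr 1
  refine Finset.sum_congr rfl fun e _ => ?_
  rw [heavyIndicator, indicator, record]
  split_ifs <;> simp

theorem avg_heavyIndicator_sq (τ : ℕ) :
    G.avg (fun e => heavyIndicator τ (G.record e) ^ 2) =
      (G.edges.card : ℝ)⁻¹ * (G.heavy τ).card := by
  rw [← avg_heavyIndicator]
  refine avg_congr fun e _ => ?_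
  rw [heavyIndicator, indicator]
  split_ifs <;> simp

end NetGraph

theorem digitSet_subset (V : Finset ℕ) (w : ℕ → ℕ) (j : ℕ) : digitSet V w j ⊆ V :=
  Finset.filter_subset _ _

/-! ### The estimate from two samples. -/

namespace Algorithm

/-- Collect two samples of `s` edges, and apply `fin` to the number of edges with large degrees in
the first sample and to the weighted number of edges between the two samples. -/
noncomputable def sampleEstimate (fin : ℝ → ℝ → ℝ) (Q τ s J : ℕ) : Algorithm additiveModel :=
  collect s fun L => collect s fun L' =>
    askSum (bilinearQueries J (digitSet (endPoints L) (recordWeight Q τ L))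
      (digitSet (endPoints L') (recordWeight Q τ L'))) 0
      fun Z => .output (fin ((L.map (NetGraph.heavyIndicator τ)).sum) Z)

variable {G : NetGraph}

theorem endPoints_record_subset {κ : Finset ℕ} (l : List (Sym2 ℕ)) :
    endPoints (l.map G.record) ⊆ knownAfter κ l := by
  intro x hx
  obtain ⟨o, ho, hx⟩ := mem_endPoints.1 hx
  obtain ⟨e, he, rfl⟩ := List.mem_map.1 ho
  rcases hx with rfl | rfl
  · exact mem_knownAfter he (Sym2.out_fst_mem e)
  · exact mem_knownAfter he (Sym2.out_snd_mem e)

/-- The weight of a vertex adds up over its repeated occurrences, so the form over distinct vertices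
equals the sum over all pairs of draws. -/
theorem bilinear_value (Q τ J : ℕ) {l l' : List (Sym2 ℕ)} (hl : l.length * (2 * Q) < 2 ^ J)
    (hl' : l'.length * (2 * Q) < 2 ^ J) :
    ((bilinearQueries J (digitSet (endPoints (l.map G.record)) (recordWeight Q τ (l.map G.record)))
      (digitSet (endPoints (l'.map G.record)) (recordWeight Q τ (l'.map G.record)))).map
        fun p => p.1 * ((G.edgesWithin p.2).card : ℝ)).sum =
      (l'.map fun f => (l.map fun e => G.pairing Q τ e f).sum).sum := by
  have hw : ∀ l : List (Sym2 ℕ), l.length * (2 * Q) < 2 ^ J →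
      ∀ x, recordWeight Q τ (l.map G.record) x < 2 ^ J := fun l hl x =>
    (recordWeight_le Q τ _ x).trans_lt (by rwa [List.length_map])
  have hV : ∀ L : List EdgeRecord, ∀ o ∈ L, o.1.1 ∈ endPoints L ∧ o.2.1 ∈ endPoints L :=
    fun L o ho => ⟨mem_endPoints.2 ⟨o, ho, Or.inl rfl⟩, mem_endPoints.2 ⟨o, ho, Or.inr rfl⟩⟩
  rw [sum_bilinearQueries G _ _ (hw l hl) (hw l' hl')]
  simp only [fun y => sum_recordWeight Q τ (l.map G.record) (hV _) fun x => G.adj x y]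
  rw [sum_recordWeight Q τ (l'.map G.record) (hV _), List.map_map]
  simp only [Function.comp_def, List.map_map]
  congr 2
  funext f
  exact recordSum_list_sum Q τ _ l _

/-- Chebyshev's inequality for both counts. The first term belongs to the heavy edges; the other two
are the two parts of the second moment of the bilinear sum. -/
theorem failProb_sampleEstimate_le (hG : G.edges.Nonempty) (R : ℝ → ℕ → Prop)
    {fin : ℝ → ℝ → ℝ} {Q τ s J c : ℕ} {t p μ : ℝ} (hτ : 0 < τ) (ht : 0 < t) (hs : 0 < s)
    (hp : 0 < p) (hμ : 0 < μ) (hJ : s * (2 * Q) < 2 ^ J)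
    (hp' : p = (G.edges.card : ℝ)⁻¹ * (G.heavy τ).card)
    (hμ' : μ = G.avg fun e => G.avg (G.pairing Q τ e))
    (hR : ∀ H Z c', |H - s * p| ≤ t * (s * p) → |Z - s ^ 2 * μ| ≤ t * (s ^ 2 * μ) →
      c' ≤ c + 6 * s + 16 * s * J ^ 2 → R (fin H Z) c') (κ : Finset ℕ) :
    (sampleEstimate fin Q τ s J).failProb G R κ c ≤
      1 / (t ^ 2 * (s * p)) + (4 * ((Q : ℝ) / τ) ^ 2 / (t ^ 2 * (s ^ 2 * μ)) +
        4 * (Q : ℝ) ^ 2 / (G.edges.card * (t ^ 2 * (s * μ)))) := by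
  have hs' : (0 : ℝ) < s := by exact_mod_cast hs
  have hm : (0 : ℝ) < G.edges.card := by exact_mod_cast Finset.card_pos.2 hG
  have hτ' : (0 : ℝ) < τ := by exact_mod_cast hτ
  set H : List (Sym2 ℕ) → ℝ := fun l => (l.map fun e => NetGraph.heavyIndicator τ (G.record e)).sum
    with hH
  set Z : List (Sym2 ℕ) → List (Sym2 ℕ) → ℝ := fun l l' =>
    (l'.map fun f => (l.map fun e => G.pairing Q τ e f).sum).sum with hZ
  have h1 : (sampleEstimate fin Q τ s J).failProb G R κ c ≤
      G.tupleAvg s (fun l => indicator (t * (s * p) < |H l - s * p|) +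
        G.tupleAvg s fun l' => indicator (t * (s ^ 2 * μ) < |Z l l' - s ^ 2 * μ|)) := by
    rw [sampleEstimate, failProb_collect G R hG]
    refine NetGraph.tupleAvg_mono fun l hl _ => ?_
    rw [failProb_collect G R hG, ← NetGraph.tupleAvg_const (k := s) hG
      (indicator (t * (s * p) < |H l - s * p|)), ← NetGraph.tupleAvg_add]
    refine NetGraph.tupleAvg_mono fun l' hl' _ => ?_
    rw [failProb_askSum, failProb_output, bilinear_value Q τ J (by rwa [hl]) (by rwa [hl']),
      zero_add, List.map_map]
    · by_cases hg : |H l - s * p| ≤ t * (s * p) ∧ |Z l l' - s ^ 2 * μ| ≤ t * (s ^ 2 * μ)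
      · rw [if_pos]
        · exact add_nonneg (indicator_nonneg _) (indicator_nonneg _)
        · refine hR _ _ _ hg.1 hg.2 ?_
          have hcard : ∀ l : List (Sym2 ℕ), l.length = s → ∀ i,
              (digitSet (endPoints (l.map G.record)) (recordWeight Q τ (l.map G.record)) i).card ≤
                2 * s := fun l hl i =>
            (Finset.card_le_card (digitSet_subset _ _ _)).trans ((card_endPoints_le _).trans
              (by rw [List.length_map, hl]))
          have := cost_bilinearQueries_le (J := J) (hcard l hl) (hcard l' hl')
          nlinarith
      · refine le_trans (by split_ifs <;> norm_num : _ ≤ (1 : ℝ)) ?_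
        rw [not_and_or, not_le, not_le] at hg
        rcases hg with hg | hg
        · rw [indicator_pos hg]
          exact le_add_of_nonneg_right (indicator_nonneg _)
        · rw [indicator_pos hg]
          exact le_add_of_nonneg_left (indicator_nonneg _)
    · intro q hq
      obtain ⟨i, j, hij⟩ := mem_bilinearQueries hq
      refine hij.trans (Finset.union_subset ?_ ?_)
      · exact (digitSet_subset _ _ _).trans ((endPoints_record_subset l).trans
          (subset_knownAfter _ _))
      · exact (digitSet_subset _ _ _).trans (endPoints_record_subset l')
  rw [NetGraph.tupleAvg_add] at h1
  refine h1.trans (add_le_add ?_ ?_)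
  · refine (NetGraph.tupleAvg_chebyshev hG s
      (fun e => NetGraph.heavyIndicator τ (G.record e)) (a := t * (s * p)) (by positivity)
      (NetGraph.avg_heavyIndicator_sq τ).le _ fun l hl => ?_).trans (le_of_eq ?_)
    · rw [NetGraph.avg_heavyIndicator, ← hp']
      exact hl.le
    · rw [← hp']
      field_simp
  · have h2 := NetGraph.tupleAvg_bilinear_le hG s (G.pairing Q τ) (G.pairing_comm Q τ)
      (G.pairing_nonneg Q τ) (fun e he f hf => NetGraph.pairing_le hτ he hf)
      (fun e he => NetGraph.avg_pairing_le Q τ he) hμ'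
    have h3 : (0 : ℝ) < (t * (s ^ 2 * μ)) ^ 2 := by positivity
    refine (NetGraph.tupleAvg_mono fun l _ _ => NetGraph.tupleAvg_indicator_le
      (fun l' => t * (s ^ 2 * μ) < |Z l l' - s ^ 2 * μ|)
      (fun l' => (Z l l' - s ^ 2 * μ) ^ 2) h3 (fun l' => sq_nonneg _)
      fun l' _ _ hl' => ?_).trans ?_
    · rw [← sq_abs (Z l l' - s ^ 2 * μ)]
      exact pow_le_pow_left₀ (by positivity) hl'.le 2
    · simp only [div_eq_inv_mul]
      rw [NetGraph.tupleAvg_mul_left]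
      refine (mul_le_mul_of_nonneg_left h2 (by positivity)).trans (le_of_eq ?_)
      field_simp
      ring

end Algorithm

/-! ### Numerical estimates: accuracy, rounding, sample size and failure. -/

/-- The increasing and the decreasing term cross at d = n^(1/3). -/
theorem min_sqrt_div_le_rpow {n d : ℝ} (hn : 0 < n) :
    min d (Real.sqrt (n / d)) ≤ n ^ (1 / 3 : ℝ) := by
  have h3 : 0 < n ^ (1 / 3 : ℝ) := Real.rpow_pos_of_pos hn _
  rcases le_total d (n ^ (1 / 3 : ℝ)) with h | h
  · exact (min_le_left _ _).trans h
  · refine (min_le_right _ _).trans (Real.sqrt_le_iff.2 ⟨h3.le, ?_⟩)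
    rw [div_le_iff₀ (h3.trans_le h)]
    have : n = (n ^ (1 / 3 : ℝ)) ^ 2 * n ^ (1 / 3 : ℝ) := by
      rw [← pow_succ, ← Real.rpow_natCast, ← Real.rpow_mul hn.le]
      norm_num
    calc n = (n ^ (1 / 3 : ℝ)) ^ 2 * n ^ (1 / 3 : ℝ) := this
      _ ≤ _ := mul_le_mul_of_nonneg_left h (by positivity)

/-- `N` is the ideal mean of the denominator without rounding and `M` the true one. Rounding costs
(1-t)², sampling one more factor 1 ± t on each side, and 16t absorbs them all. -/
theorem isRelApprox_div {t d c H Z A M N : ℝ} (ht : 0 < t) (ht' : 16 * t ≤ 1)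
    (hN : 0 < N) (hc : 0 < c) (hd : 0 < d) (hcd : c * A = d * N) (hM : (1 - t) ^ 2 * N ≤ M)
    (hM' : M ≤ N) (hH : |H - A| ≤ t * A) (hZ : |Z - M| ≤ t * M) :
    IsRelApprox (16 * t) d (c * H / Z) := by
  rw [abs_le] at hH hZ
  have hdN : 0 < d * N := mul_pos hd hN
  have h1t : 0 < 1 - t := by linarith
  have hM0 : 0 < M := lt_of_lt_of_le (by positivity) hM
  have hZl : (1 - t) ^ 3 * N ≤ Z := by
    have : (1 - t) * ((1 - t) ^ 2 * N) ≤ (1 - t) * M := mul_le_mul_of_nonneg_left hM h1t.le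
    nlinarith
  have hZu : Z ≤ (1 + t) * N := by nlinarith
  have hZ0 : 0 < Z := lt_of_lt_of_le (by positivity) hZl
  have hHl : c * ((1 - t) * A) ≤ c * H := mul_le_mul_of_nonneg_left (by linarith) hc.le
  have hHu : c * H ≤ c * ((1 + t) * A) := mul_le_mul_of_nonneg_left (by linarith) hc.le
  constructor
  · rw [le_div_iff₀ hZ0]
    have h1 : (1 - 16 * t) * d * Z ≤ (1 - 16 * t) * d * ((1 + t) * N) :=
      mul_le_mul_of_nonneg_left hZu (mul_nonneg (by linarith) hd.le)
    have h2 : (1 - 16 * t) * (1 + t) * (d * N) ≤ (1 - t) * (d * N) :=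
      mul_le_mul_of_nonneg_right (by nlinarith) hdN.le
    nlinarith
  · rw [div_le_iff₀ hZ0]
    have h1 : (1 + 16 * t) * d * ((1 - t) ^ 3 * N) ≤ (1 + 16 * t) * d * Z :=
      mul_le_mul_of_nonneg_left hZl (by positivity)
    have h2 : (1 + t) * (d * N) ≤ (1 + 16 * t) * (1 - t) ^ 3 * (d * N) := by
      refine mul_le_mul_of_nonneg_right ?_ hdN.le
      have h3 : 1 - 3 * t ≤ (1 - t) ^ 3 := by nlinarith [mul_pos ht ht]
      have h4 := mul_le_mul_of_nonneg_left h3 (by positivity : 0 ≤ 1 + 16 * t)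
      nlinarith
    nlinarith

/-- Rounding to a multiple of `2 / n`. -/
noncomputable def roundDegree (n : ℕ) (r : ℝ) : ℝ := 2 * (round (n * r / 2) : ℝ) / n

/-- At this accuracy n·r/2 is within m/(2n²) ≤ 1/4 of the integer m, so rounding recovers the
average degree exactly. -/
theorem roundDegree_eq {n m : ℕ} (hn : 0 < n) (hm : 2 * m ≤ n ^ 2) {r : ℝ}
    (hr : IsRelApprox (1 / (2 * (n : ℝ) ^ 2)) (2 * (m : ℝ) / n) r) :
    roundDegree n r = 2 * (m : ℝ) / n := by
  have hn' : (0 : ℝ) < n := by exact_mod_cast hn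
  have hm' : 2 * (m : ℝ) ≤ (n : ℝ) ^ 2 := by exact_mod_cast hm
  obtain ⟨h1, h2⟩ := hr
  have e1 : 1 / (2 * (n : ℝ) ^ 2) * m ≤ 1 / 4 := by
    rw [div_mul_eq_mul_div, one_mul, div_le_iff₀ (by positivity)]
    linarith
  have h3 : (m : ℝ) - 1 / 4 ≤ n * r / 2 := by
    have := mul_le_mul_of_nonneg_left h1 (by positivity : (0 : ℝ) ≤ n / 2)
    have e2 : (n : ℝ) / 2 * ((1 - 1 / (2 * (n : ℝ) ^ 2)) * (2 * m / n)) =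
        m - 1 / (2 * (n : ℝ) ^ 2) * m := by field_simp
    linarith
  have h4 : n * r / 2 ≤ (m : ℝ) + 1 / 4 := by
    have := mul_le_mul_of_nonneg_left h2 (by positivity : (0 : ℝ) ≤ n / 2)
    have e2 : (n : ℝ) / 2 * ((1 + 1 / (2 * (n : ℝ) ^ 2)) * (2 * m / n)) =
        m + 1 / (2 * (n : ℝ) ^ 2) * m := by field_simp
    linarith
  have h5 := abs_le.1 (abs_sub_round (n * r / 2))
  have h6 : round (n * r / 2) = (m : ℤ) := by
    have l1 : ((round (n * r / 2) : ℤ) : ℝ) < ((m + 1 : ℤ) : ℝ) := by push_cast; linarith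
    have l2 : ((m - 1 : ℤ) : ℝ) < ((round (n * r / 2) : ℤ) : ℝ) := by push_cast; linarith
    have l1' := Int.cast_lt.1 l1
    have l2' := Int.cast_lt.1 l2
    omega
  rw [roundDegree, h6, Int.cast_natCast]

/-- As log₂ n ≥ 1, the left side is at most 104·log₂ n, and 104/log 2 < 151. -/
theorem log_two_bound {n : ℕ} (hn : 2 ≤ n) :
    ((52 * (Nat.log 2 n + 1) : ℕ) : ℝ) ≤ 151 * Real.log n := by
  have hn' : (0 : ℝ) < n := by positivity
  have h1 : 1 ≤ Nat.log 2 n := Nat.log_pos (by norm_num) hn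
  have h2 : (2 : ℝ) ^ Nat.log 2 n ≤ n := by exact_mod_cast Nat.pow_log_le_self 2 (by omega)
  have h3 := Real.log_le_log (by positivity) h2
  rw [Real.log_pow] at h3
  have h4 := Real.log_two_gt_d9
  have h5 : (1 : ℝ) ≤ (Nat.log 2 n : ℕ) := by exact_mod_cast h1
  push_cast
  nlinarith

namespace NetGraph

variable {G : NetGraph}

theorem card_nbrs_pos (hG : G.NoIsolated) {x : ℕ} (hx : x ∈ G.verts) : 0 < (G.nbrs x).card := by
  obtain ⟨y, hy⟩ := hG x hx
  exact Finset.card_pos.2 ⟨y, G.mem_nbrs.2 hy⟩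

theorem card_nbrs_le (x : ℕ) : (G.nbrs x).card ≤ G.verts.card :=
  Finset.card_le_card fun _ hy => G.mem_verts_right (G.mem_nbrs.1 hy)

theorem card_verts_le_two_mul (hG : G.NoIsolated) : G.verts.card ≤ 2 * G.edges.card := by
  rw [two_mul_card_edges, Finset.card_eq_sum_ones]
  exact Finset.sum_le_sum fun x hx => card_nbrs_pos hG hx

theorem two_mul_card_edges_le : 2 * G.edges.card ≤ G.verts.card ^ 2 := by
  rw [two_mul_card_edges, pow_two]
  exact (Finset.sum_le_card_nsmul _ _ _ fun x _ => card_nbrs_le x)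

end NetGraph

/-- The number of samples for the relative accuracy `ε` and degrees at least `τ`. -/
noncomputable def sampleSize (n : ℕ) (ε : ℝ) (τ : ℕ) : ℕ :=
  ⌈10 ^ 10 * Real.sqrt ((n : ℝ) / τ) / ε ^ 2⌉₊

/-- The scale of the rounded weights. -/
noncomputable def weightScale (n : ℕ) (ε : ℝ) : ℕ := n * ⌈16 / ε⌉₊

theorem one_le_sqrt_div {n τ : ℕ} (hτ : 0 < τ) (hτn : τ ≤ n) : 1 ≤ Real.sqrt ((n : ℝ) / τ) := by
  rw [Real.one_le_sqrt, one_le_div (by exact_mod_cast hτ)]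
  exact_mod_cast hτn

theorem le_sampleSize (n : ℕ) (ε : ℝ) (τ : ℕ) :
    10 ^ 10 * Real.sqrt ((n : ℝ) / τ) / ε ^ 2 ≤ sampleSize n ε τ := Nat.le_ceil _

theorem sampleSize_le {n τ : ℕ} {ε : ℝ} (hτ : 0 < τ) (hτn : τ ≤ n) (hε : 0 < ε) (hε1 : ε < 1) :
    (sampleSize n ε τ : ℝ) ≤ 2 * 10 ^ 10 * Real.sqrt ((n : ℝ) / τ) / ε ^ 2 := by
  have h1 := one_le_sqrt_div hτ hτn
  have h2 : 1 ≤ 10 ^ 10 * Real.sqrt ((n : ℝ) / τ) / ε ^ 2 := by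
    rw [one_le_div (by positivity)]
    have : ε ^ 2 ≤ 1 := by nlinarith
    linarith
  have h3 := (Nat.ceil_lt_add_one (zero_le_one.trans h2)).le
  rw [sampleSize]
  refine h3.trans ?_
  rw [show 2 * 10 ^ 10 * Real.sqrt ((n : ℝ) / τ) / ε ^ 2 =
    10 ^ 10 * Real.sqrt ((n : ℝ) / τ) / ε ^ 2 + 10 ^ 10 * Real.sqrt ((n : ℝ) / τ) / ε ^ 2 by ring]
  linarith

theorem le_weightScale {n : ℕ} {ε : ℝ} (hε : 0 < ε) : (n : ℝ) ≤ ε / 16 * weightScale n ε := by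
  have h1 : 16 / ε ≤ (⌈16 / ε⌉₊ : ℝ) := Nat.le_ceil _
  rw [div_le_iff₀ hε] at h1
  rw [weightScale, Nat.cast_mul]
  have := mul_le_mul_of_nonneg_left h1 (Nat.cast_nonneg (α := ℝ) n)
  nlinarith

/-- All weights fit into the digits provided: the sample size is O(n⁵) and the scale O(n³), so 8 of
the 52 blocks pay for n⁸ and 44 for the constant. The lower bound on ε keeps this polynomial in n.
-/
theorem sampleSize_mul_lt {n τ : ℕ} {ε : ℝ} (hn : 2 ≤ n) (hτ : 0 < τ) (hτn : τ ≤ n)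
    (hε : 1 / (2 * (n : ℝ) ^ 2) ≤ ε) (hε1 : ε < 1) :
    sampleSize n ε τ * (2 * weightScale n ε) < 2 ^ (52 * (Nat.log 2 n + 1)) := by
  have hn' : (2 : ℝ) ≤ n := by exact_mod_cast hn
  have hn0 : (0 : ℝ) < n := by linarith
  have hε0 : 0 < ε := lt_of_lt_of_le (by positivity) hε
  have hinv : 1 / ε ≤ 2 * (n : ℝ) ^ 2 := by
    rw [div_le_iff₀ (by positivity)] at hε
    rw [div_le_iff₀ hε0]
    linarith
  have hinv2 : 1 / ε ^ 2 ≤ 4 * (n : ℝ) ^ 4 := by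
    have := pow_le_pow_left₀ (by positivity) hinv 2
    rw [div_pow, one_pow] at this
    linarith [this, show (2 * (n : ℝ) ^ 2) ^ 2 = 4 * (n : ℝ) ^ 4 by ring]
  have hsqrt : Real.sqrt ((n : ℝ) / τ) ≤ n := by
    rw [Real.sqrt_le_iff]
    refine ⟨hn0.le, (div_le_self hn0.le (by exact_mod_cast hτ)).trans ?_⟩
    nlinarith
  have hs : (sampleSize n ε τ : ℝ) ≤ 8 * 10 ^ 10 * (n : ℝ) ^ 5 := by
    refine (sampleSize_le hτ hτn hε0 hε1).trans ?_
    rw [div_eq_mul_one_div]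
    calc 2 * 10 ^ 10 * Real.sqrt ((n : ℝ) / τ) * (1 / ε ^ 2)
        ≤ 2 * 10 ^ 10 * n * (4 * (n : ℝ) ^ 4) := by gcongr
      _ = _ := by ring
  have hQ : (weightScale n ε : ℝ) ≤ 33 * (n : ℝ) ^ 3 := by
    have h1 := (Nat.ceil_lt_add_one (by positivity : (0 : ℝ) ≤ 16 / ε)).le
    have h2 : 16 / ε = 16 * (1 / ε) := by ring
    have h3 : (⌈16 / ε⌉₊ : ℝ) ≤ 33 * (n : ℝ) ^ 2 := by nlinarith
    rw [weightScale, Nat.cast_mul]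
    calc (n : ℝ) * ⌈16 / ε⌉₊ ≤ n * (33 * (n : ℝ) ^ 2) := by gcongr
      _ = _ := by ring
  have hlt : (n : ℝ) < 2 ^ (Nat.log 2 n + 1) := by
    exact_mod_cast Nat.lt_pow_succ_log_self (by norm_num) n
  have h8 : (n : ℝ) ^ 8 ≤ 2 ^ (8 * (Nat.log 2 n + 1)) := by
    rw [mul_comm, pow_mul]
    exact pow_le_pow_left₀ hn0.le hlt.le 8
  have h44 : (2 : ℝ) ^ 44 ≤ 2 ^ (44 * (Nat.log 2 n + 1)) :=
    pow_le_pow_right₀ (by norm_num) (by omega)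
  have hfin : (sampleSize n ε τ : ℝ) * (2 * weightScale n ε) < 2 ^ (52 * (Nat.log 2 n + 1)) := by
    calc (sampleSize n ε τ : ℝ) * (2 * weightScale n ε)
        ≤ 8 * 10 ^ 10 * (n : ℝ) ^ 5 * (2 * (33 * (n : ℝ) ^ 3)) := by gcongr
      _ = (528 * 10 ^ 10) * (n : ℝ) ^ 8 := by ring
      _ < 2 ^ 44 * (n : ℝ) ^ 8 := mul_lt_mul_of_pos_right (by norm_num) (by positivity)
      _ ≤ 2 ^ (44 * (Nat.log 2 n + 1)) * 2 ^ (8 * (Nat.log 2 n + 1)) := by gcongr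
      _ = 2 ^ (52 * (Nat.log 2 n + 1)) := by rw [← pow_add]; congr 1; ring
  exact_mod_cast hfin

/-- The cost bound for a number of samples which is at most the number used by either of the two
methods. -/
theorem le_mul_min_sqrt {n τ : ℕ} {ε d x : ℝ} (hτ : 0 < τ) (hτn : τ ≤ n) (hε : 0 < ε)
    (hε1 : ε < 1) (hd : 0 < d) (hτd : d / 1500 ≤ τ) (hx : x ≤ 40000 / ε ^ 2 * d)
    (hxs : x ≤ sampleSize n ε τ) :
    x ≤ 10 ^ 12 * (1 / ε ^ 2) * min d (Real.sqrt ((n : ℝ) / d)) := by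
  have hn0 : (0 : ℝ) < n := by exact_mod_cast hτ.trans_le hτn
  have hτ0 : (0 : ℝ) < τ := by exact_mod_cast hτ
  have h1 : Real.sqrt ((n : ℝ) / τ) ≤ 39 * Real.sqrt ((n : ℝ) / d) := by
    rw [Real.sqrt_le_iff]
    refine ⟨by positivity, ?_⟩
    rw [mul_pow, Real.sq_sqrt (by positivity), div_le_iff₀ hτ0]
    have : (n : ℝ) / d * (d / 1500) ≤ n / d * τ := mul_le_mul_of_nonneg_left hτd (by positivity)
    have e : (n : ℝ) / d * (d / 1500) = n / 1500 := by field_simp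
    nlinarith
  have h2 := (hxs.trans (sampleSize_le hτ hτn hε hε1))
  have he : 0 < 1 / ε ^ 2 := by positivity
  rw [mul_min_of_nonneg _ _ (by positivity)]
  refine le_min (hx.trans ?_) (h2.trans ?_)
  · rw [div_eq_mul_one_div]
    have := mul_pos he hd
    nlinarith
  · rw [div_eq_mul_one_div]
    have h3 := mul_le_mul_of_nonneg_right h1 he.le
    have h4 := mul_nonneg (Real.sqrt_nonneg ((n : ℝ) / d)) he.le
    nlinarith

/-- Only the middle term, the variance from single pairs of draws, needs s of order √(n/τ); it uses
m = O(nτ). The other two need just s of order ε⁻². -/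
theorem failure_le {ε n τ s Q m μ p : ℝ} (hε0 : 0 < ε) (hε1 : ε ≤ 1) (hn0 : 0 < n) (hτ0 : 0 < τ)
    (hs0 : 0 < s) (hm0 : 0 < m) (hμ0 : 0 < μ)
    (hsge : 10 ^ 10 * Real.sqrt (n / τ) / ε ^ 2 ≤ s) (hs1 : 10 ^ 10 / ε ^ 2 ≤ s)
    (hp1 : 1 / 1500 ≤ p) (hμ : Q ^ 2 * p / m ≤ μ) (hm : m ≤ 750 * (n * τ)) :
    1 / ((ε / 16) ^ 2 * (s * p)) + (4 * (Q / τ) ^ 2 / ((ε / 16) ^ 2 * (s ^ 2 * μ)) +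
      4 * Q ^ 2 / (m * ((ε / 16) ^ 2 * (s * μ)))) ≤ 1 / 1000 := by
  have hp0 : 0 < p := by linarith
  have hεs : 10 ^ 10 ≤ ε ^ 2 * s := by
    rw [div_le_iff₀ (by positivity)] at hs1
    linarith
  have hεsp : 6 * 10 ^ 6 ≤ ε ^ 2 * (s * p) := by
    have := mul_le_mul hεs hp1 (by norm_num) (by positivity)
    linarith
  have h1 : Q ^ 2 * p ≤ μ * m := by rwa [div_le_iff₀ hm0] at hμ
  have t1 : 1 / ((ε / 16) ^ 2 * (s * p)) ≤ 1 / 3000 := by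
    refine one_div_le_one_div_of_le (by norm_num) ?_
    linarith [show (ε / 16) ^ 2 * (s * p) = ε ^ 2 * (s * p) / 256 by ring]
  have t3 : 4 * Q ^ 2 / (m * ((ε / 16) ^ 2 * (s * μ))) ≤ 1 / 3000 := by
    rw [div_le_iff₀ (by positivity)]
    have h2 : ε ^ 2 * s * (Q ^ 2 * p) ≤ ε ^ 2 * s * (μ * m) :=
      mul_le_mul_of_nonneg_left h1 (by positivity)
    have h3 := mul_le_mul_of_nonneg_right hεsp (sq_nonneg Q)
    have e1 : m * ((ε / 16) ^ 2 * (s * μ)) = ε ^ 2 * s * (μ * m) / 256 := by ring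
    have e2 : ε ^ 2 * (s * p) * Q ^ 2 = ε ^ 2 * s * (Q ^ 2 * p) := by ring
    rw [e1]
    rw [e2] at h3
    have h4 := sq_nonneg Q
    linarith
  have t2 : 4 * (Q / τ) ^ 2 / ((ε / 16) ^ 2 * (s ^ 2 * μ)) ≤ 1 / 10000 := by
    have h3 : Q ^ 2 ≤ 1125000 * (μ * τ) * n := by
      have e1 := mul_le_mul_of_nonneg_left hp1 (sq_nonneg Q)
      have e2 := mul_le_mul_of_nonneg_left hm hμ0.le
      linarith
    have h4 : 10 ^ 20 * n ≤ s ^ 2 * ε ^ 2 * τ := by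
      rw [div_le_iff₀ (by positivity)] at hsge
      have e1 := pow_le_pow_left₀ (by positivity) hsge 2
      rw [mul_pow, Real.sq_sqrt (by positivity), ← mul_div_assoc, div_le_iff₀ hτ0] at e1
      have e2 : ε ^ 2 ≤ 1 := pow_le_one₀ hε0.le hε1
      have e3 := mul_le_mul_of_nonneg_left e2 (by positivity : 0 ≤ s ^ 2 * ε ^ 2 * τ)
      linarith [show (s * ε ^ 2) ^ 2 * τ = s ^ 2 * ε ^ 2 * τ * ε ^ 2 by ring]
    have h5 := mul_le_mul_of_nonneg_left h4 (by positivity : 0 ≤ μ * τ)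
    rw [div_pow, ← mul_div_assoc, div_div, div_le_iff₀ (by positivity)]
    have h6 : 0 ≤ s ^ 2 * ε ^ 2 * τ * (μ * τ) := by positivity
    have e4 : τ ^ 2 * ((ε / 16) ^ 2 * (s ^ 2 * μ)) = s ^ 2 * ε ^ 2 * τ * (μ * τ) / 256 := by ring
    rw [e4]
    linarith
  linarith

/-! ### The degree estimator and its analysis. -/

namespace Algorithm

/-- The number of binary digits of the weights. -/
def digitCount (n : ℕ) : ℕ := 52 * (Nat.log 2 n + 1)

/-- The estimate from two samples of edges. -/
noncomputable def sampleDegree (n : ℕ) (ε : ℝ) (ρ : ℝ → ℝ) (τ : ℕ) : Algorithm additiveModel :=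
  -- The means are sp and about 2s²Q²p/m, so the quotient is close to 2m/n.
  sampleEstimate (fun H Z => ρ (4 * (weightScale n ε : ℝ) ^ 2 * sampleSize n ε τ / n * H / Z))
    (weightScale n ε) τ (sampleSize n ε τ) (digitCount n)

/-- Estimate the average degree by the sum of reciprocals of degrees, and turn to the estimate from
two samples after as many edges as these contain. -/
noncomputable def estimateAbove (n : ℕ) (ε : ℝ) (ρ : ℝ → ℝ) (τ : ℕ) : Algorithm additiveModel :=
  -- Reaching T takes about Td/2 draws, whence 2k/T. The constant makes each tail at most 2/5000 by
  -- Chebyshev's inequality.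
  untilSum (40000 / ε ^ 2) (fun k => ρ (2 * k / (40000 / ε ^ 2))) (sampleDegree n ε ρ τ)
    (sampleSize n ε τ) 0 0

/-- The estimate of the average degree, to within a factor `1 ± ε`. -/
noncomputable def degreeEstimator (n : ℕ) (ε : ℝ) (ρ : ℝ → ℝ) : Algorithm additiveModel :=
  observe fun o => estimateAbove n ε ρ (min o.1.2 o.2.2)

variable {G : NetGraph} {n τ : ℕ} {ε B : ℝ} {ρ : ℝ → ℝ} {good : ℝ → Prop}

/-- The accuracy ε/16 is used both for rounding and for sampling. The lower bound on τ gives m ≤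
750nτ, and the one on the heavy edges gives p ≥ 1/1500. -/
theorem failProb_sampleDegree_le (hG : G.NoIsolated) (hV : G.verts.card = n) (hn : 2 ≤ n)
    (hε : 1 / (2 * (n : ℝ) ^ 2) ≤ ε) (hε1 : ε < 1) (hτ : 0 < τ) (hτn : τ ≤ n)
    (hτd : G.avgDegree / 1500 ≤ τ) (hheavy : (G.edges.card : ℝ) / 1500 ≤ (G.heavy τ).card)
    (hρ : ∀ r, IsRelApprox ε G.avgDegree r → good (ρ r)) {c : ℕ}
    (hc : ∀ c' : ℕ, c' ≤ c + 6 * sampleSize n ε τ + 16 * sampleSize n ε τ * digitCount n ^ 2 →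
      (c' : ℝ) ≤ B) (κ : Finset ℕ) :
    (sampleDegree n ε ρ τ).failProb G (fun r c => good r ∧ (c : ℝ) ≤ B) κ c ≤ 1 / 1000 := by
  have hn0 : (0 : ℝ) < n := by positivity
  have hε0 : 0 < ε := lt_of_lt_of_le (by positivity) hε
  have hτ0 : (0 : ℝ) < τ := by exact_mod_cast hτ
  have hm1 : 0 < G.edges.card := by
    have := G.card_verts_le_two_mul hG
    omega
  set m : ℝ := (G.edges.card : ℝ) with hm
  have hm0 : 0 < m := Nat.cast_pos.2 hm1
  set s := sampleSize n ε τ with hs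
  set Q := weightScale n ε with hQ
  set μ := G.avg fun e => G.avg (G.pairing Q τ e) with hμ
  set p : ℝ := m⁻¹ * (G.heavy τ).card with hp
  have hd : G.avgDegree = 2 * m / n := by rw [NetGraph.avgDegree, hV]
  have hQn : (n : ℝ) ≤ ε / 16 * Q := le_weightScale hε0
  have hQ0 : (0 : ℝ) < Q := by nlinarith
  have hsge : 10 ^ 10 * Real.sqrt ((n : ℝ) / τ) / ε ^ 2 ≤ s := le_sampleSize n ε τ
  have hsq := one_le_sqrt_div hτ hτn
  have hs1 : 10 ^ 10 / ε ^ 2 ≤ (s : ℝ) := by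
    refine le_trans ?_ hsge
    gcongr
    linarith
  have hs0 : (0 : ℝ) < s := lt_of_lt_of_le (by positivity) hs1
  have hp1 : 1 / 1500 ≤ p := by
    rw [hp, inv_mul_eq_div, le_div_iff₀ hm0]
    linarith
  have hp0 : 0 < p := by linarith
  have hN : (m⁻¹) ^ 2 * (2 * (Q : ℝ) ^ 2 * (G.heavy τ).card) = 2 * Q ^ 2 * p / m := by
    rw [hp]
    field_simp
  have hμu : μ ≤ 2 * Q ^ 2 * p / m := by
    rw [← hN]
    exact NetGraph.avg_avg_pairing_le Q τ
  have hμl : (1 - ε / 16) ^ 2 * (2 * Q ^ 2 * p / m) ≤ μ := by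
    rw [mul_comm, ← hN]
    refine NetGraph.le_avg_avg_pairing τ (by linarith) fun x hx => ⟨G.card_nbrs_pos hG hx, ?_⟩
    have : ((G.nbrs x).card : ℝ) ≤ n := by
      rw [← hV]
      exact_mod_cast NetGraph.card_nbrs_le x
    linarith
  have hμl' : Q ^ 2 * p / m ≤ μ := by
    refine le_trans ?_ hμl
    have h1 : 1 / 2 ≤ (1 - ε / 16) ^ 2 := by nlinarith
    have h2 := mul_le_mul_of_nonneg_right h1 (by positivity : 0 ≤ 2 * Q ^ 2 * p / m)
    refine le_trans (le_of_eq ?_) h2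
    ring
  have hμ0 : 0 < μ := lt_of_lt_of_le (by positivity) hμl'
  have hA0 : 0 < (s : ℝ) * p := by positivity
  have hN0 : 0 < (s : ℝ) ^ 2 * (2 * Q ^ 2 * p / m) := by positivity
  refine (failProb_sampleEstimate_le (Finset.card_pos.1 hm1) _ hτ (t := ε / 16) (p := p) (μ := μ)
    (by positivity) (by exact_mod_cast hs0) hp0 hμ0
    (sampleSize_mul_lt hn hτ hτn hε hε1) hp hμ ?_ κ).trans ?_
  · intro H Z c' hH hZ hc'
    refine ⟨hρ _ ?_, hc c' hc'⟩
    have := isRelApprox_div (t := ε / 16) (d := G.avgDegree)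
      (c := 4 * (Q : ℝ) ^ 2 * s / n) (N := (s : ℝ) ^ 2 * (2 * Q ^ 2 * p / m)) (M := s ^ 2 * μ)
      (by positivity) (by linarith) hN0 (by positivity) (by rw [hd]; positivity)
      (by rw [hd]; field_simp; ring)
      (by nlinarith [mul_le_mul_of_nonneg_left hμl (sq_nonneg (s : ℝ))])
      (mul_le_mul_of_nonneg_left hμu (sq_nonneg _)) hH hZ
    rwa [show 16 * (ε / 16) = ε by ring] at this
  · exact failure_le hε0 hε1.le hn0 hτ0 hs0 hm0 hμ0 hsge hs1 hp1 hμl' (by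
      rw [hd, div_div, div_le_iff₀ (by positivity)] at hτd
      linarith)

end Algorithm

namespace Algorithm

variable {G : NetGraph} {n τ : ℕ} {ε B : ℝ} {ρ : ℝ → ℝ} {good : ℝ → Prop}

theorem one_le_avgDegree (hG : G.NoIsolated) (h : 0 < G.verts.card) : 1 ≤ G.avgDegree := by
  rw [NetGraph.avgDegree, one_le_div (by exact_mod_cast h)]
  exact_mod_cast NetGraph.card_verts_le_two_mul hG

/-- The constants combine to 28·151²·10¹² < 10¹⁸. -/
theorem cost_le (hn : 2 ≤ n) (hε0 : 0 < ε) (hε1 : ε < 1) {d x : ℝ} (hτ : 0 < τ) (hτn : τ ≤ n)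
    (hd : 0 < d) (hτd : d / 1500 ≤ τ)
    (hB : 10 ^ 18 * (1 / ε ^ 2) * Real.log n ^ 2 * min d (Real.sqrt ((n : ℝ) / d)) ≤ B)
    (hx : x ≤ 40000 / ε ^ 2 * d) (hxs : x ≤ sampleSize n ε τ) :
    28 * x * (digitCount n : ℝ) ^ 2 ≤ B := by
  have h1 := le_mul_min_sqrt hτ hτn hε0 hε1 hd hτd hx hxs
  have h2 := pow_le_pow_left₀ (Nat.cast_nonneg _) (log_two_bound hn) 2
  have h3 : (0 : ℝ) ≤ 1 / ε ^ 2 * min d (Real.sqrt ((n : ℝ) / d)) :=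
    mul_nonneg (by positivity) (le_min hd.le (Real.sqrt_nonneg _))
  have h4 := mul_le_mul_of_nonneg_right h1 (sq_nonneg (digitCount n : ℝ))
  have h5 := mul_le_mul_of_nonneg_left h2 h3
  have h6 : 0 ≤ 1 / ε ^ 2 * min d (Real.sqrt ((n : ℝ) / d)) * Real.log n ^ 2 :=
    mul_nonneg h3 (sq_nonneg _)
  refine le_trans ?_ hB
  rw [mul_pow] at h5
  change 1 / ε ^ 2 * min d (Real.sqrt ((n : ℝ) / d)) * (digitCount n : ℝ) ^ 2 ≤ _ at h5
  linarith

/-- The mean of one term is `q`, so after the two critical numbers of draws the mean sum misses `T`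
by at least εT/2 on either side. The last bound limits the number of draws for the cost. -/
theorem tail_bounds {T d q : ℝ} (hε0 : 0 < ε) (hε1 : ε < 1) (hT : T = 40000 / ε ^ 2) (hd : 1 ≤ d)
    (hq : q = 2 / d) :
    ((⌊(1 - ε / 2) * T * d / 2⌋₊ : ℝ) * q + ε / 2 * T ≤ T) ∧
    (T + ε / 2 * T ≤ (⌈(1 + ε / 2) * T * d / 2⌉₊ : ℝ) * q) ∧
    ((⌈(1 + ε / 2) * T * d / 2⌉₊ : ℝ) * q ≤ 2 * T) ∧
    ((⌈(1 + ε / 2) * T * d / 2⌉₊ : ℝ) ≤ T * d) := by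
  have hT1 : 40000 ≤ T := by
    rw [hT, le_div_iff₀ (by positivity)]
    nlinarith
  have hd0 : 0 < d := by linarith
  have hq0 : 0 < q := by rw [hq]; positivity
  have hq2 : q ≤ 2 := by
    rw [hq, div_le_iff₀ hd0]
    linarith
  have hTd : T ≤ T * d := le_mul_of_one_le_right (by linarith) hd
  have h1 : (⌊(1 - ε / 2) * T * d / 2⌋₊ : ℝ) ≤ (1 - ε / 2) * T * d / 2 :=
    Nat.floor_le (by
      have : 0 ≤ 1 - ε / 2 := by linarith
      positivity)
  have h2 : (1 + ε / 2) * T * d / 2 ≤ (⌈(1 + ε / 2) * T * d / 2⌉₊ : ℝ) := Nat.le_ceil _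
  have h3 : (⌈(1 + ε / 2) * T * d / 2⌉₊ : ℝ) ≤ (1 + ε / 2) * T * d / 2 + 1 :=
    (Nat.ceil_lt_add_one (by positivity)).le
  have e : ∀ a : ℝ, a * T * d / 2 * q = a * T := fun a => by
    rw [hq]
    field_simp
  have h1' := mul_le_mul_of_nonneg_right h1 hq0.le
  have h2' := mul_le_mul_of_nonneg_right h2 hq0.le
  have h3' := mul_le_mul_of_nonneg_right h3 hq0.le
  rw [e] at h1' h2'
  rw [add_mul ((1 + ε / 2) * T * d / 2), e] at h3'
  have h4 : ε * T ≤ T := mul_le_of_le_one_left (by linarith) hε1.le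
  have h5 : ε * (T * d) ≤ T * d := mul_le_of_le_one_left (by linarith) hε1.le
  refine ⟨?_, ?_, ?_, ?_⟩ <;> nlinarith

/-- Rounding up to an integer adds at most 1 to the number of draws, which the unused half of ε
absorbs because εTd ≥ 4. -/
theorem stop_approx {T d : ℝ} {k : ℕ} (hε0 : 0 < ε) (hε1 : ε < 1) (hT : T = 40000 / ε ^ 2)
    (hd : 1 ≤ d) (h1 : ⌊(1 - ε / 2) * T * d / 2⌋₊ < k) (h2 : k ≤ ⌈(1 + ε / 2) * T * d / 2⌉₊) :
    IsRelApprox ε d (2 * k / T) := by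
  have hT0 : 0 < T := by rw [hT]; positivity
  have hεT : 4 ≤ ε * T := by
    rw [hT, ← mul_div_assoc, le_div_iff₀ (by positivity)]
    nlinarith
  have h1' := Nat.lt_of_floor_lt h1
  have h2' : (k : ℝ) ≤ (1 + ε / 2) * T * d / 2 + 1 :=
    (Nat.cast_le.2 h2).trans (Nat.ceil_lt_add_one (by positivity)).le
  have h3 : 4 ≤ ε * T * d := by nlinarith
  constructor
  · rw [le_div_iff₀ hT0]
    nlinarith
  · rw [div_le_iff₀ hT0]
    nlinarith

/-- If `k₂ ≤ s`, the first method ends in time with high probability. Otherwise s is below the cost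
bound of the first method too, and turning to the two samples is affordable. -/
theorem failProb_estimateAbove_le (hG : G.NoIsolated) (hV : G.verts.card = n) (hn : 2 ≤ n)
    (hε : 1 / (2 * (n : ℝ) ^ 2) ≤ ε) (hε1 : ε < 1) (hτ : 0 < τ) (hτn : τ ≤ n)
    (hτd : G.avgDegree / 1500 ≤ τ) (hheavy : (G.edges.card : ℝ) / 1500 ≤ (G.heavy τ).card)
    (hρ : ∀ r, IsRelApprox ε G.avgDegree r → good (ρ r))
    (hB : 10 ^ 18 * (1 / ε ^ 2) * Real.log n ^ 2 *
      min G.avgDegree (Real.sqrt ((n : ℝ) / G.avgDegree)) ≤ B) (κ : Finset ℕ) :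
    (estimateAbove n ε ρ τ).failProb G (fun r c => good r ∧ (c : ℝ) ≤ B) κ 3 ≤ 1 / 500 := by
  have hn0 : (0 : ℝ) < n := by positivity
  have hε0 : 0 < ε := lt_of_lt_of_le (by positivity) hε
  have hd1 : 1 ≤ G.avgDegree := one_le_avgDegree hG (by omega)
  have hm1 : 0 < G.edges.card := by
    have := G.card_verts_le_two_mul hG
    omega
  have hE : G.edges.Nonempty := Finset.card_pos.1 hm1
  have hm0 : (0 : ℝ) < G.edges.card := Nat.cast_pos.2 hm1
  have hpos : ∀ x ∈ G.verts, 0 < (G.nbrs x).card := fun x hx => NetGraph.card_nbrs_pos hG hx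
  obtain ⟨T, hT⟩ : ∃ T : ℝ, T = 40000 / ε ^ 2 := ⟨_, rfl⟩
  obtain ⟨q, hq⟩ : ∃ q : ℝ, q = (G.edges.card : ℝ)⁻¹ * G.verts.card := ⟨_, rfl⟩
  obtain ⟨s, hs⟩ : ∃ s, s = sampleSize n ε τ := ⟨_, rfl⟩
  have hqd : q = 2 / G.avgDegree := by
    rw [hq, NetGraph.avgDegree]
    field_simp
  have hq0 : 0 < q := by rw [hqd]; positivity
  have hT0 : 0 < T := by rw [hT]; positivity
  have hεT : ε ^ 2 * T = 40000 := by rw [hT]; field_simp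
  obtain ⟨b1, b2, b3, b4⟩ := tail_bounds hε0 hε1 hT hd1 hqd
  obtain ⟨k₁, hk₁⟩ : ∃ k, k = ⌊(1 - ε / 2) * T * G.avgDegree / 2⌋₊ := ⟨_, rfl⟩
  obtain ⟨k₂, hk₂⟩ : ∃ k, k = ⌈(1 + ε / 2) * T * G.avgDegree / 2⌉₊ := ⟨_, rfl⟩
  rw [← hk₁] at b1
  rw [← hk₂] at b2 b3 b4
  have hJ : 1 ≤ digitCount n := by
    rw [digitCount]
    omega
  have hJ2 : (1 : ℝ) ≤ (digitCount n : ℝ) ^ 2 := one_le_pow₀ (by exact_mod_cast hJ)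
  have hcost : ∀ k : ℕ, k ≤ k₂ → k ≤ s → 28 * (k : ℝ) * (digitCount n : ℝ) ^ 2 ≤ B := by
    intro k h1 h2
    refine cost_le hn hε0 hε1 hτ hτn (by linarith) hτd hB ?_ ?_
    · rw [← hT]
      exact (Nat.cast_le.2 h1).trans b4
    · rw [← hs]
      exact_mod_cast h2
  have hgood : ∀ k, k₁ < k → k ≤ k₂ → k ≤ s →
      good (ρ (2 * k / T)) ∧ ((3 + 3 * k : ℕ) : ℝ) ≤ B := by
    intro k h1 h2 h3
    refine ⟨hρ _ (stop_approx hε0 hε1 hT hd1 (hk₁ ▸ h1) (hk₂ ▸ h2)), ?_⟩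
    refine le_trans ?_ (hcost k h2 h3)
    have : (1 : ℝ) ≤ k := by exact_mod_cast (show 1 ≤ k by omega)
    push_cast
    nlinarith
  -- When `k₂ ≤ s`, reaching the second method is simply counted as failure; it already forces the
  -- first `k₂` draws to fall short of `T`. The cost so far is 3 for the first edge and 3 for each
  -- draw.
  have hK : ∀ κ, (sampleDegree n ε ρ τ).failProb G (fun r c => good r ∧ (c : ℝ) ≤ B) κ
      (3 + 3 * s) ≤ if k₂ ≤ s then 1 else 1 / 1000 := by
    intro κ
    split_ifs with h
    · exact failProb_le_one _ _ _ _ _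
    · refine failProb_sampleDegree_le hG hV hn hε hε1 hτ hτn hτd hheavy hρ ?_ κ
      intro c' hc'
      rw [← hs] at hc'
      refine le_trans ?_ (hcost s (by omega) le_rfl)
      have h1 : 1 ≤ s := by
        have h2 := le_sampleSize n ε τ
        have h3 := one_le_sqrt_div hτ hτn
        have h4 : (0 : ℝ) < sampleSize n ε τ := lt_of_lt_of_le (by positivity) h2
        rw [hs]
        exact_mod_cast h4
      have h2 : c' ≤ 28 * s * digitCount n ^ 2 := by
        have h3 : s ≤ s * digitCount n ^ 2 := Nat.le_mul_of_pos_right _ (by positivity)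
        rw [mul_assoc] at hc' ⊢
        omega
      exact_mod_cast h2
  have h0 := failProb_untilSum_le G _ hE (T := T) (fin := fun k => ρ (2 * k / T)) (c₀ := 3)
    (by split_ifs <;> norm_num) hK hgood s 0 0 κ (by simp) hT0
  have hest : estimateAbove n ε ρ τ = untilSum T (fun k => ρ (2 * k / T)) (sampleDegree n ε ρ τ)
      s 0 0 := by rw [hT, hs, estimateAbove]
  rw [hest]
  refine h0.trans ?_
  simp only [Nat.sub_zero, zero_add]
  rw [NetGraph.tupleAvg_add, NetGraph.tupleAvg_take hE (m := k₁)
    (fun l => indicator (T ≤ (l.map fun e => recip (G.record e)).sum))]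
  have ha : 0 < ε / 2 * T := by positivity
  have hvar : ∀ {x y : ℝ}, x ≤ y * T → 2 * x / (ε / 2 * T) ^ 2 ≤ y / 5000 := by
    intro x y hx
    rw [div_le_iff₀ (by positivity)]
    have : (ε / 2 * T) ^ 2 = 10000 * T := by
      rw [show (ε / 2 * T) ^ 2 = ε ^ 2 * T * T / 4 by ring, hεT]
      ring
    rw [this]
    linarith
  have hmin : ((min k₁ s : ℕ) : ℝ) * q ≤ k₁ * q :=
    mul_le_mul_of_nonneg_right (by exact_mod_cast min_le_left _ _) hq0.le
  have c1 : G.tupleAvg (min k₁ s) (fun l => indicator (T ≤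
      (l.map fun e => recip (G.record e)).sum)) ≤ 1 / 5000 := by
    refine (NetGraph.tupleAvg_le_recip_sum hE hpos _ ha ?_).trans ?_
    · rw [← hq]
      linarith
    · rw [← hq]
      exact hvar (by linarith)
  by_cases h : k₂ ≤ s
  · simp only [if_pos h]
    rw [NetGraph.tupleAvg_take hE (m := k₂)
      (fun l => indicator ((l.map fun e => recip (G.record e)).sum < T)), min_eq_left h]
    have c2 : G.tupleAvg k₂ (fun l => indicator
        ((l.map fun e => recip (G.record e)).sum < T)) ≤ 2 / 5000 := by
      refine (NetGraph.tupleAvg_recip_sum_lt hE hpos _ ha ?_).trans ?_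
      · rw [← hq]
        exact b2
      · rw [← hq]
        exact hvar b3
    linarith
  · simp only [if_neg h]
    rw [NetGraph.tupleAvg_const hE]
    linarith

/-- The first edge gives a bad τ with probability at most 2/1500 + 1/1500, and 1/500 is added for
the rest. -/
theorem failProb_degreeEstimator_lt (hG : G.NoIsolated) (hV : G.verts.card = n) (hn : 2 ≤ n)
    (hε : 1 / (2 * (n : ℝ) ^ 2) ≤ ε) (hε1 : ε < 1)
    (hρ : ∀ r, IsRelApprox ε G.avgDegree r → good (ρ r))
    (hB : 10 ^ 18 * (1 / ε ^ 2) * Real.log n ^ 2 *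
      min G.avgDegree (Real.sqrt ((n : ℝ) / G.avgDegree)) ≤ B) :
    (degreeEstimator n ε ρ).failProb G (fun r c => good r ∧ (c : ℝ) ≤ B) ∅ 0 < 1 / 100 := by
  have hn0 : (0 : ℝ) < n := by positivity
  have hd1 : 1 ≤ G.avgDegree := one_le_avgDegree hG (by omega)
  have hm1 : 0 < G.edges.card := by
    have := G.card_verts_le_two_mul hG
    omega
  have hE : G.edges.Nonempty := Finset.card_pos.1 hm1
  have hm0 : (0 : ℝ) < G.edges.card := Nat.cast_pos.2 hm1
  have h1 : (degreeEstimator n ε ρ).failProb G (fun r c => good r ∧ (c : ℝ) ≤ B) ∅ 0 ≤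
      G.avg fun e => indicator ((G.minDeg e : ℝ) < G.avgDegree / 1500) +
        (indicator (((G.heavy (G.minDeg e)).card : ℝ) < (G.edges.card : ℝ) / 1500) + 1 / 500) := by
    rw [degreeEstimator, failProb_observe G _ hE]
    refine NetGraph.avg_mono fun e he => ?_
    change (estimateAbove n ε ρ (G.minDeg e)).failProb G _ _ (0 + 3) ≤ _
    have i1 := indicator_nonneg ((G.minDeg e : ℝ) < G.avgDegree / 1500)
    have i2 := indicator_nonneg (((G.heavy (G.minDeg e)).card : ℝ) < (G.edges.card : ℝ) / 1500)
    by_cases c1 : (G.minDeg e : ℝ) < G.avgDegree / 1500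
    · rw [indicator_pos c1]
      exact (failProb_le_one _ _ _ _ _).trans (by linarith)
    by_cases c2 : ((G.heavy (G.minDeg e)).card : ℝ) < (G.edges.card : ℝ) / 1500
    · rw [indicator_pos c2]
      exact (failProb_le_one _ _ _ _ _).trans (by linarith)
    have hpos : 0 < G.minDeg e := lt_min
      (NetGraph.card_nbrs_pos hG (NetGraph.out_fst_mem_verts he))
      (NetGraph.card_nbrs_pos hG (NetGraph.out_snd_mem_verts he))
    have hle : G.minDeg e ≤ n := by
      rw [← hV]
      exact (min_le_left _ _).trans (NetGraph.card_nbrs_le _)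
    refine (failProb_estimateAbove_le hG hV hn hε hε1 hpos hle (not_lt.1 c1) (not_lt.1 c2) hρ hB
      _).trans ?_
    linarith
  refine h1.trans_lt ?_
  rw [NetGraph.avg_add, NetGraph.avg_add, NetGraph.avg_const hE]
  have h2 := NetGraph.avg_minDeg_lt_le (G := G) (θ := G.avgDegree / 1500)
  have h3 := NetGraph.avg_heavy_lt_le (G := G) (θ := (G.edges.card : ℝ) / 1500) (by positivity)
  rw [max_eq_left (by linarith)] at h2
  have e2 : (G.edges.card : ℝ)⁻¹ * (G.verts.card * (G.avgDegree / 1500)) = 2 / 1500 := by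
    rw [NetGraph.avgDegree, hV]
    field_simp
  have e3 : (G.edges.card : ℝ)⁻¹ * ((G.edges.card : ℝ) / 1500) = 1 / 1500 := by field_simp
  rw [e2] at h2
  rw [e3] at h3
  linarith

/-- Arbitrarily small ε would need too many binary digits. Below 1/(2n²) the accuracy is frozen and
the result rounded, which makes it exact. -/
theorem degree_upper_bound : ∃ (C : ℝ) (k : ℕ) (A : ℕ → ℝ → Algorithm additiveModel), 0 < C ∧
    ∀ (n : ℕ) (ε : ℝ), 2 ≤ n → 0 < ε → ε < 1 →
      ∀ G : NetGraph, G.verts.card = n → G.NoIsolated →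
        99 / 100 < (A n ε).successProb G (IsRelApprox ε G.avgDegree)
          (C * (1 / ε ^ 2) * Real.log n ^ k
            * min G.avgDegree (Real.sqrt ((n : ℝ) / G.avgDegree))) ∧
        99 / 100 < (A n ε).successProb G (IsRelApprox ε G.avgDegree)
          (C * (1 / ε ^ 2) * Real.log n ^ k * (n : ℝ) ^ (1 / 3 : ℝ)) := by
  -- The power of log n is 2 because both weights are expanded in binary.
  refine ⟨10 ^ 18, 2, fun n ε => degreeEstimator n (max ε (1 / (2 * (n : ℝ) ^ 2)))
    (if 1 / (2 * (n : ℝ) ^ 2) ≤ ε then id else roundDegree n), by norm_num, ?_⟩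
  intro n ε hn hε hε1 G hV hG
  have hn0 : (0 : ℝ) < n := by positivity
  have hn2 : (2 : ℝ) ≤ n := by exact_mod_cast hn
  have hd1 : 1 ≤ G.avgDegree := one_le_avgDegree hG (by omega)
  have hρ : ∀ r, IsRelApprox (max ε (1 / (2 * (n : ℝ) ^ 2))) G.avgDegree r →
      IsRelApprox ε G.avgDegree
        ((if 1 / (2 * (n : ℝ) ^ 2) ≤ ε then id else roundDegree n : ℝ → ℝ) r) := by
    intro r hr
    split_ifs with h
    · rwa [max_eq_left h] at hr
    · rw [max_eq_right (not_le.1 h).le, NetGraph.avgDegree, hV] at hr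
      have h2 := G.two_mul_card_edges_le
      rw [hV] at h2
      rw [roundDegree_eq (by omega) h2 hr, NetGraph.avgDegree, hV]
      have : 0 ≤ 2 * (G.edges.card : ℝ) / n := by positivity
      constructor <;> nlinarith
  have hmax : max ε (1 / (2 * (n : ℝ) ^ 2)) < 1 := by
    refine max_lt hε1 ?_
    rw [div_lt_one (by positivity)]
    nlinarith
  have hmin0 : 0 ≤ min G.avgDegree (Real.sqrt ((n : ℝ) / G.avgDegree)) :=
    le_min (by linarith) (Real.sqrt_nonneg _)
  have hB : 10 ^ 18 * (1 / max ε (1 / (2 * (n : ℝ) ^ 2)) ^ 2) * Real.log n ^ 2 *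
      min G.avgDegree (Real.sqrt ((n : ℝ) / G.avgDegree)) ≤ 10 ^ 18 * (1 / ε ^ 2) *
      Real.log n ^ 2 * min G.avgDegree (Real.sqrt ((n : ℝ) / G.avgDegree)) := by
    have : 1 / max ε (1 / (2 * (n : ℝ) ^ 2)) ^ 2 ≤ 1 / ε ^ 2 :=
      one_div_le_one_div_of_le (by positivity)
        (pow_le_pow_left₀ hε.le (le_max_left _ _) 2)
    gcongr
  refine ⟨lt_successProb G _ _ _ (failProb_degreeEstimator_lt hG hV hn (le_max_right _ _) hmax hρ
    hB), lt_successProb G _ _ _ (failProb_degreeEstimator_lt hG hV hn (le_max_right _ _) hmax hρ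
    (hB.trans ?_))⟩
  exact mul_le_mul_of_nonneg_left (min_sqrt_div_le_rpow hn0) (by positivity)

end Algorithm

theorem theorem1p6 :
    -- (a) upper bound with random edges, random neighbours, degrees and additive queries
    (∃ (C : ℝ) (k : ℕ) (A : ℕ → ℝ → Algorithm additiveModel), 0 < C ∧
      ∀ (n : ℕ) (ε : ℝ), 2 ≤ n → 0 < ε → ε < 1 →
        ∀ G : NetGraph, G.verts.card = n → G.NoIsolated →
          99 / 100 < (A n ε).successProb G (IsRelApprox ε G.avgDegree)
            (C * (1 / ε ^ 2) * Real.log n ^ k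
              * min G.avgDegree (Real.sqrt ((n : ℝ) / G.avgDegree))) ∧
          99 / 100 < (A n ε).successProb G (IsRelApprox ε G.avgDegree)
            (C * (1 / ε ^ 2) * Real.log n ^ k * (n : ℝ) ^ (1 / 3 : ℝ))) ∧
    -- (b) lower bound, even with full neighbourhood access
    (∀ c : ℝ, 1 ≤ c → ∃ (c₀ : ℝ) (N : ℕ), 0 < c₀ ∧
      ∀ (n : ℕ), N ≤ n → ∀ V : Finset ℕ, V.card = n →
        ∀ (A : Algorithm fullNbrModel) (B : ℝ),
          (∀ G : NetGraph, G.verts = V → G.NoIsolated →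
            2 / 3 ≤ A.successProb G (IsFactorApprox c G.avgDegree) B) →
          c₀ * (n : ℝ) ^ (1 / 3 : ℝ) ≤ B) ∧
    -- (b) lower bound with pair queries in place of additive queries
    (∀ c : ℝ, 1 ≤ c → ∃ (c₀ c₁ : ℝ) (N : ℕ), 0 < c₀ ∧ 0 < c₁ ∧
      ∀ (n : ℕ), N ≤ n → ∀ V : Finset ℕ, V.card = n →
        ∀ D : ℝ, Real.sqrt n ≤ D → D ≤ n →
          ∀ (A : Algorithm pairModel) (B : ℝ),
            (∀ G : NetGraph, G.verts = V → G.NoIsolated →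
              c₁ * D ≤ G.avgDegree → G.avgDegree ≤ D →
              2 / 3 ≤ A.successProb G (IsFactorApprox c G.avgDegree) B) →
            c₀ * min (Real.sqrt n) ((n : ℝ) / D) ≤ B) := by
  exact ⟨Algorithm.degree_upper_bound, fullNbr_lower_bound, pair_lower_bound⟩
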